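/- Let $\mathbb O$ be the octonions. Let $\mathrm{Spin}(7)\subset \mathrm{Cl}(\mathbb R^7)$ act on $\mathbb R^8=\mathbb O$ by the spin representation (in which $v\in\operatorname{Im}\mathbb O=\mathbb R^7$ acts by left multiplication), hence on $S^7\subset\mathbb O$, with isotropy group $G_2$ at $o=1$. Let $G_2=\mathrm{Aut}(\mathbb O)$ act on $S^6\subset\operatorname{Im}\mathbb O$, with isotropy group $\mathrm{SU}(3)$ at $o=i$. In either case write $M=G/K$, and let $\mathfrak g=\mathfrak k\oplus\mathfrak m$ be a reductive decomposition, i.e. $\mathrm{Ad}(K)\mathfrak m\subseteq\mathfrak m$ (one exists). Write $[X,Y]_{\mathfrak m}$ for the $\mathfrak m$-component of $[X,Y]$, and $X^*$ for the fundamental vector field $X^*_p=\frac{d}{dt}\big|_{0}\exp(tX)p$. The Nomizu map $\Lambda:\mathfrak m\to\mathfrak{gl}(\mathfrak m)$ of a $G$-invariant affine connection $\nabla$ on $M$ is given by $\Lambda(X)Y=(\nabla_{X^*}Y^*-[X^*,Y^*])_o$, where $\mathfrak m\cong T_oM$ via $X\mapsto X^*_o$. Let $\mathfrak{aff}_G(F(M))$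 denote the real affine space of $G$-invariant affine connections on $M$. (1) For $S^7=\mathrm{Spin}(7)/G_2$: for every $\alpha\in\mathbb R$ there is exactly one $\mathrm{Spin}(7)$-invariant affine connection $\nabla^\alpha$ on $S^7$ with Nomizu map $\Lambda^\alpha(X)Y=\frac{1-\alpha}{2}[X,Y]_{\mathfrak m}$, and every $\mathrm{Spin}(7)$-invariant affine connection on $S^7$ equals $\nabla^\alpha$ for exactly one $\alpha\in\mathbb R$. Moreover $\dim_{\mathbb R}\mathfrak{aff}_{\mathrm{Spin}(7)}(F(S^7))=1$. (2) For $S^6=G_2/\mathrm{SU}(3)$: $\mathfrak m$ carries an $\mathrm{Ad}(\mathrm{SU}(3))$-invariant complex structure $J$; fix any such $J$ and put $(a+bi)X=aX+bJX$ for $a,b\in\mathbb R$, $X\in\mathfrak m$. For every $\alpha\in\mathbb C$ there is exactly one $G_2$-invariant affine connection $\nabla^\alpha$ on $S^6$ with Nomizu map $\Lambda^\alpha(X)Y=\frac{1-\alpha}{2}[X,Y]_{\mathfrak m}$, and every $G_2$-invariant affine connection on $S^6$ equals $\nabla^\alpha$ for exactly one $\alpha\in\mathbb C$. Moreover $\dim_{\mathbb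 R}\mathfrak{aff}_{G_2}(F(S^6))=2$. (3) In both cases $G$-invariant Riemannian metrics exist, and for every $G$-invariant Riemannian metric $g$ on $M$ the set of $G$-invariant connections that are metric with respect to $g$ is all of $\mathfrak{aff}_G(F(M))$. -/

import Mathlib

open scoped Manifold ContDiff Quaternion

noncomputable section

/-! ### Affine connections, invariance and metric compatibility on a manifold -/

namespace InvConn

section Manifold

variable {EM : Type*} [NormedAddCommGroup EM] [NormedSpace ℝ EM]
  {H : Type*} [TopologicalSpace H] (I : ModelWithCorners ℝ EM H)
  (M : Type*) [TopologicalSpace M] [ChartedSpace H M] [IsManifold I ∞ M]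

/-- Smooth vector fields on `M`, i.e. smooth sections of the tangent bundle. -/
abbrev VF : Type _ := Cₛ^∞⟮I; EM, (TangentSpace I : M → Type _)⟯

/-- Bare operators `(X, Y) ↦ D X Y` on smooth vector fields (a real vector space, pointwise). -/
abbrev Operator : Type _ := VF I M → VF I M → VF I M

/-- Smooth Riemannian metrics on `M`. -/
abbrev RMetric : Type _ := Bundle.ContMDiffRiemannianMetric I ∞ EM (TangentSpace I : M → Type _)

variable {I M}

/-- The product `f X` of a smooth function and a smooth vector field. -/
def fsmul (f : C^∞⟮I, M; ℝ⟯) (X : VF I M) : VF I M :=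
  ⟨fun x => f x • X x, ContMDiff.smul_section f.contMDiff X.contMDiff⟩

/-- An affine connection on `M` (a Koszul connection on the tangent bundle): `D X Y` is `∇_X Y`. It
is recorded by its action on smooth vector fields only, so that two connections are equal
precisely when they are equal in the usual sense. -/
structure IsAffineConnection (D : Operator I M) : Prop where
  add_left : ∀ X X' Y, D (X + X') Y = D X Y + D X' Y
  smul_left : ∀ (f : C^∞⟮I, M; ℝ⟯) X Y, D (fsmul f X) Y = fsmul f (D X Y)
  add_right : ∀ X Y Y', D X (Y + Y') = D X Y + D X Y'
  leibniz : ∀ (f : C^∞⟮I, M; ℝ⟯) X Y x,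
    D X (fsmul f Y) x = f x • D X Y x + (mvfderiv I f x (X x)) • Y x

/-- The vector fields `X`, `X'` are `φ`-related: `dφ ∘ X = X' ∘ φ`. For a diffeomorphism `φ` this
says that `X'` is the push-forward of `X`. -/
def IsRelated (φ : M → M) (X X' : VF I M) : Prop :=
  ∀ x, mfderiv I I φ x (X x) = X' (φ x)

/-- `φ_* (∇_X Y) = ∇_{φ_* X} (φ_* Y)`. -/
def IsInvariantUnder (φ : M → M) (D : Operator I M) : Prop :=
  ∀ X X' Y Y', IsRelated φ X X' → IsRelated φ Y Y' → IsRelated φ (D X Y) (D X' Y')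

/-- A Riemannian metric invariant under `φ`, i.e. for which `φ` is an isometry. -/
def IsInvariantMetric (φ : M → M)
    (g : RMetric I M) : Prop :=
  ∀ x (v w : TangentSpace I x),
    g.inner (φ x) (mfderiv I I φ x v) (mfderiv I I φ x w) = g.inner x v w

/-- `∇ g = 0`, i.e. `X (g(Y, Z)) = g(∇_X Y, Z) + g(Y, ∇_X Z)`. -/
def IsMetric (g : RMetric I M)
    (D : Operator I M) : Prop :=
  ∀ (X Y Z : VF I M) x,
    mvfderiv I (fun y => g.inner y (Y y) (Z y)) x (X x)
      = g.inner x (D X Y x) (Z x) + g.inner x (Y x) (D X Z x)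

/-- The affine space of affine connections on `M` which are invariant under a family `Φ` of
transformations of `M`. -/
def invariantConnections (Φ : Set (M → M)) : AffineSubspace ℝ (Operator I M) where
  carrier := {D | IsAffineConnection D ∧ ∀ φ ∈ Φ, IsInvariantUnder φ D}
  smul_vsub_vadd_mem' := by
    rintro c D₁ D₂ D₃ ⟨h₁, i₁⟩ ⟨h₂, i₂⟩ ⟨h₃, i₃⟩
    refine ⟨⟨?_, ?_, ?_, ?_⟩, ?_⟩
    · intro X X' Y
      simp only [vsub_eq_sub, vadd_eq_add, Pi.add_apply, Pi.smul_apply, Pi.sub_apply,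
        h₁.add_left, h₂.add_left, h₃.add_left]
      module
    · intro f X Y
      ext x
      simp only [vsub_eq_sub, vadd_eq_add, Pi.add_apply, Pi.smul_apply, Pi.sub_apply,
        h₁.smul_left, h₂.smul_left, h₃.smul_left]
      simp only [fsmul, ContMDiffSection.coe_add, ContMDiffSection.coe_smul,
        ContMDiffSection.coe_sub, ContMDiffSection.coeFn_mk, Pi.add_apply, Pi.smul_apply,
        Pi.sub_apply]
      module
    · intro X Y Y'
      simp only [vsub_eq_sub, vadd_eq_add, Pi.add_apply, Pi.smul_apply, Pi.sub_apply,
        h₁.add_right, h₂.add_right, h₃.add_right]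
      module
    · intro f X Y x
      simp only [vsub_eq_sub, vadd_eq_add, Pi.add_apply, Pi.smul_apply, Pi.sub_apply,
        ContMDiffSection.coe_add, ContMDiffSection.coe_smul, ContMDiffSection.coe_sub,
        h₁.leibniz, h₂.leibniz, h₃.leibniz]
      module
    · intro φ hφ X X' Y Y' hX hY x
      have e₁ := i₁ φ hφ X X' Y Y' hX hY x
      have e₂ := i₂ φ hφ X X' Y Y' hX hY x
      have e₃ := i₃ φ hφ X X' Y Y' hX hY x
      simp only [vsub_eq_sub, vadd_eq_add, Pi.add_apply, Pi.smul_apply, Pi.sub_apply,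
        ContMDiffSection.coe_add, ContMDiffSection.coe_smul, ContMDiffSection.coe_sub,
        map_add, map_smul, map_sub, e₁, e₂, e₃]

/-- The set of invariant connections that are metric with respect to `g`. -/
def invariantMetricConnections (Φ : Set (M → M))
    (g : RMetric I M) :
    Set (Operator I M) :=
  {D | D ∈ invariantConnections Φ ∧ IsMetric g D}

end Manifold

/-! ### Spheres with a group of linear isometries -/

section Sphere

variable {E : Type*} [NormedAddCommGroup E] [InnerProductSpace ℝ E]

attribute [local instance] LieRing.ofAssociativeRing

/-- The unit sphere of `E`. -/
abbrev Sph (E : Type*) [NormedAddCommGroup E] [InnerProductSpace ℝ E] : Type _ :=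
  Metric.sphere (0 : E) 1

/-- The action of a linear isometry on the unit sphere. -/
def sphereMap (g : E ≃ₗᵢ[ℝ] E) (x : Sph E) : Sph E :=
  ⟨g x, by simp⟩

/-- The transformations of the sphere coming from the group `G`. -/
def sphereMaps (G : Subgroup (E ≃ₗᵢ[ℝ] E)) : Set (Sph E → Sph E) :=
  {φ | ∃ g ∈ G, φ = sphereMap g}

/-- A linear isometry as a bounded operator. -/
abbrev toOp (g : E ≃ₗᵢ[ℝ] E) : E →L[ℝ] E := (g.toContinuousLinearEquiv : E →L[ℝ] E)

/-- The Lie algebra of a linear group `G`: it is generated by all `A` with `exp (t A) ∈ G` for all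
real `t`. (For a closed group these `A` already form a Lie algebra.) -/
def lieAlg (G : Subgroup (E ≃ₗᵢ[ℝ] E)) : LieSubalgebra ℝ (E →L[ℝ] E) :=
  LieSubalgebra.lieSpan ℝ (E →L[ℝ] E)
    {A | ∀ t : ℝ, ∃ g ∈ G, toOp g = NormedSpace.exp (t • A)}

/-- The Lie algebra `𝔨` of the isotropy group of the point `o`, inside the Lie algebra of `G`:
those `A` with `A o = 0`, equivalently `exp (t A) o = o` for all `t`. -/
def isotropyAlg (G : Subgroup (E ≃ₗᵢ[ℝ] E)) (o : Sph E) : Submodule ℝ (lieAlg G) where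
  carrier := {A | (A : E →L[ℝ] E) o = 0}
  add_mem' := by
    intro A B hA hB
    simp only [Set.mem_ofPred_eq] at hA hB ⊢
    simp [hA, hB]
  zero_mem' := by simp
  smul_mem' := by
    intro c A hA
    simp only [Set.mem_ofPred_eq] at hA ⊢
    simp [hA]

/-- `B = Ad(g) A`. -/
def IsAd {G : Subgroup (E ≃ₗᵢ[ℝ] E)} (g : E ≃ₗᵢ[ℝ] E) (A B : lieAlg G) : Prop :=
  (B : E →L[ℝ] E) = toOp g ∘L (A : E →L[ℝ] E) ∘L toOp g⁻¹

/-- A reductive decomposition `𝔤 = 𝔨 ⊕ 𝔪`, `Ad(K) 𝔪 ⊆ 𝔪`, for the isotropy group `K` of `o`. -/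
structure ReductiveDecomposition (G : Subgroup (E ≃ₗᵢ[ℝ] E)) (o : Sph E) where
  𝔪 : Submodule ℝ (lieAlg G)
  isCompl : IsCompl 𝔪 (isotropyAlg G o)
  ad_mem : ∀ g ∈ G, g o = o → ∀ A ∈ 𝔪, ∀ B : lieAlg G, IsAd g A B → B ∈ 𝔪

namespace ReductiveDecomposition

variable {G : Subgroup (E ≃ₗᵢ[ℝ] E)} {o : Sph E}

/-- `[X, Y]_𝔪`, the `𝔪`-component of the Lie bracket of `X, Y ∈ 𝔪`. -/
def bracket (R : ReductiveDecomposition G o) (X Y : R.𝔪) : R.𝔪 :=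
  Submodule.projectionOnto R.𝔪 (isotropyAlg G o) R.isCompl ⁅(X : lieAlg G), (Y : lieAlg G)⁆

/-- An `Ad(K)`-invariant complex structure `J` on `𝔪`. -/
structure ComplexStructure (R : ReductiveDecomposition G o) where
  J : R.𝔪 →ₗ[ℝ] R.𝔪
  sq : ∀ X, J (J X) = -X
  equivariant : ∀ g ∈ G, g o = o → ∀ X Y : R.𝔪,
    IsAd g (X : lieAlg G) (Y : lieAlg G) → IsAd g (J X : lieAlg G) (J Y : lieAlg G)

/-- Multiplication of `X ∈ 𝔪` by a complex number `z`, where `i` acts as `J`. -/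
def ComplexStructure.csmul {R : ReductiveDecomposition G o} (S : R.ComplexStructure)
    (z : ℂ) (X : R.𝔪) : R.𝔪 :=
  z.re • X + z.im • S.J X

variable {n : ℕ} [Fact (Module.finrank ℝ E = n + 1)]

/-- `ξ` is the fundamental vector field `x ↦ d/dt exp(tA) x = A x` on the sphere. -/
def IsFundamental (A : E →L[ℝ] E) (ξ : VF (𝓡 n) (Sph E)) : Prop :=
  ∀ x : Sph E, mvfderiv (𝓡 n) (Subtype.val : Sph E → E) x (ξ x) = A (x : E)

/-- `Λ` is the Nomizu map of the invariant connection `D`: with `X*` the fundamental vector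
field of `X ∈ 𝔪` and with `𝔪` identified with `T_o` by `X ↦ X*_o`, one has
`Λ(X) Y = (∇_{X*} Y* - [X*, Y*])_o`. -/
def HasNomizuMap (R : ReductiveDecomposition G o) (D : Operator (𝓡 n) (Sph E))
    (Λ : R.𝔪 → R.𝔪 → R.𝔪) : Prop :=
  ∀ (X Y : R.𝔪) (ξ υ ζ : VF (𝓡 n) (Sph E)),
    IsFundamental (X : lieAlg G).1 ξ → IsFundamental (Y : lieAlg G).1 υ →
    IsFundamental (Λ X Y : lieAlg G).1 ζ →
      D ξ υ o - VectorField.mlieBracket (𝓡 n) (fun x => ξ x) (fun x => υ x) o = ζ o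

/-- The Nomizu map `Λ^α(X) Y = (1 - α)/2 [X, Y]_𝔪` for real `α`. -/
def nomizu (R : ReductiveDecomposition G o) (α : ℝ) (X Y : R.𝔪) : R.𝔪 :=
  ((1 - α) / 2) • R.bracket X Y

/-- The Nomizu map `Λ^α(X) Y = (1 - α)/2 [X, Y]_𝔪` for complex `α`. -/
def nomizuC (R : ReductiveDecomposition G o) (S : R.ComplexStructure) (α : ℂ) (X Y : R.𝔪) : R.𝔪 :=
  S.csmul ((1 - α) / 2) (R.bracket X Y)

end ReductiveDecomposition

end Sphere

/-! ### Octonions, `Spin(7)` and `G₂` -/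

/-- The octonions as pairs of quaternions, with the Euclidean inner product. -/
abbrev Oct : Type := WithLp 2 (ℍ[ℝ] × ℍ[ℝ])

namespace Oct

lemma ext {x y : Oct} (h₁ : x.fst = y.fst) (h₂ : x.snd = y.snd) : x = y :=
  WithLp.ofLp_injective 2 (Prod.ext h₁ h₂)

/-- The Cayley-Dickson product `(a, b) (c, d) = (a c - d̄ b, d a + b c̄)`. -/
def mul : Oct →ₗ[ℝ] Oct →ₗ[ℝ] Oct :=
  LinearMap.mk₂ ℝ
    (fun x y => WithLp.toLp 2
      (x.fst * y.fst - star y.snd * x.snd, y.snd * x.fst + x.snd * star y.fst))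
    (by intro x y z; apply Oct.ext <;> simp [add_mul, mul_add] <;> abel)
    (by intro c x y; apply Oct.ext <;> simp [smul_sub])
    (by intro x y z; apply Oct.ext <;> simp [add_mul, mul_add] <;> abel)
    (by intro c x y; apply Oct.ext <;> simp [smul_sub])

/-- The unit octonion. -/
def one : Oct := WithLp.toLp 2 (1, 0)

/-- The imaginary octonions. -/
abbrev Im : Type := ↥((Submodule.span ℝ {one})ᗮ : Submodule ℝ Oct)

lemma norm_one : ‖one‖ = 1 := by
  rw [WithLp.prod_norm_eq_of_L2]
  simp [one]

instance finrank_oct : Fact (Module.finrank ℝ Oct = 7 + 1) := by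
  constructor
  rw [LinearEquiv.finrank_eq (WithLp.linearEquiv 2 ℝ (ℍ[ℝ] × ℍ[ℝ])), Module.finrank_prod,
    Quaternion.finrank_eq_four]

instance finrank_im : Fact (Module.finrank ℝ Im = 6 + 1) := by
  constructor
  have h : Fact (Module.finrank ℝ Oct = 6 + 1 + 1) := finrank_oct
  refine Submodule.finrank_orthogonal_span_singleton (n := 6 + 1) ?_
  intro h0
  have := norm_one
  rw [h0] at this
  simp at this

/-- The quadratic form `v ↦ -|v|²` on `Im 𝕆 = ℝ⁷`. -/
def Q : QuadraticForm ℝ Im := -LinearMap.BilinMap.toQuadraticMap (innerₗ Im)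

lemma re_eq_zero (v : Im) : (v : Oct).fst.re = 0 := by
  have h := (Submodule.mem_orthogonal_singleton_iff_inner_right).1 v.2
  simpa [one, WithLp.prod_inner_apply, Quaternion.inner_def] using h

lemma mul_mul_of_star (w x : Oct) (ha : star w.fst = -w.fst) :
    mul w (mul w x) = -(Quaternion.normSq w.fst + Quaternion.normSq w.snd) • x := by
  have haa : w.fst * w.fst = -((Quaternion.normSq w.fst : ℝ) : ℍ[ℝ]) := by
    rw [← Quaternion.star_mul_self, ha, neg_mul, neg_neg]
  refine Oct.ext ?_ ?_
  · have : w.fst * (w.fst * x.fst - star x.snd * w.snd)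
        - star (x.snd * w.fst + w.snd * star x.fst) * w.snd
        = -(Quaternion.normSq w.fst + Quaternion.normSq w.snd) • x.fst := by
      simp only [star_add, star_mul, star_star, ha]
      have : w.fst * (w.fst * x.fst - star x.snd * w.snd)
          - (-w.fst * star x.snd + x.fst * star w.snd) * w.snd
          = w.fst * w.fst * x.fst - x.fst * (star w.snd * w.snd) := by noncomm_ring
      rw [this, haa, Quaternion.star_mul_self, neg_mul, Quaternion.coe_mul_eq_smul,
        Quaternion.mul_coe_eq_smul]
      module
    exact this
  · have : (x.snd * w.fst + w.snd * star x.fst) * w.fst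
        + w.snd * star (w.fst * x.fst - star x.snd * w.snd)
        = -(Quaternion.normSq w.fst + Quaternion.normSq w.snd) • x.snd := by
      simp only [star_sub, star_mul, star_star, ha]
      have : (x.snd * w.fst + w.snd * star x.fst) * w.fst
          + w.snd * (star x.fst * -w.fst - star w.snd * x.snd)
          = x.snd * (w.fst * w.fst) - w.snd * star w.snd * x.snd := by noncomm_ring
      rw [this, haa, Quaternion.self_mul_star, mul_neg, Quaternion.coe_mul_eq_smul,
        Quaternion.mul_coe_eq_smul]
      module
    exact this

/-- Left multiplication by imaginary octonions satisfies the Clifford relation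
`v (v x) = -|v|² x`. -/
lemma mul_mul_self (v : Im) :
    (mul.comp (Submodule.subtype _) v : Module.End ℝ Oct) *
      (mul.comp (Submodule.subtype _) v : Module.End ℝ Oct)
      = algebraMap ℝ (Module.End ℝ Oct) (Q v) := by
  have ha : star (v : Oct).fst = -(v : Oct).fst := Quaternion.star_eq_neg.2 (re_eq_zero v)
  have hQ : Q v = -(Quaternion.normSq (v : Oct).fst + Quaternion.normSq (v : Oct).snd) := by
    rw [← Quaternion.inner_self, ← Quaternion.inner_self]
    exact congrArg Neg.neg (WithLp.prod_inner_apply (v : Oct) (v : Oct))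
  rw [hQ, Algebra.algebraMap_eq_smul_one]
  exact LinearMap.ext fun x => mul_mul_of_star v x ha

/-- The 8-dimensional spin representation: the real Clifford module `Δ₇ = 𝕆 = ℝ⁸`, on which
a vector `v ∈ Im 𝕆 = ℝ⁷` acts by octonionic left multiplication. -/
def spinRep : CliffordAlgebra Q →ₐ[ℝ] Module.End ℝ Oct :=
  CliffordAlgebra.lift Q ⟨mul.comp (Submodule.subtype _), mul_mul_self⟩

/-- `Spin(7) ⊆ Cl(ℝ⁷)`, acting (faithfully and isometrically) on `Δ₇ = ℝ⁸` by the
spin representation. -/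
def spin7 : Subgroup (Oct ≃ₗᵢ[ℝ] Oct) where
  carrier := {g | ∃ s ∈ spinGroup Q, ∀ x, g x = spinRep s x}
  one_mem' := ⟨1, one_mem _, by simp⟩
  mul_mem' := by
    rintro g h ⟨s, hs, hg⟩ ⟨t, ht, hh⟩
    exact ⟨s * t, mul_mem hs ht, by simp [hg, hh]⟩
  inv_mem' := by
    rintro g ⟨s, hs, hg⟩
    refine ⟨star s, spinGroup.star_mem hs, fun x => ?_⟩
    have h1 : spinRep (star s) (spinRep s (g⁻¹ x)) = g⁻¹ x := by
      rw [← Module.End.mul_apply, ← map_mul, spinGroup.star_mul_self_of_mem hs, map_one,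
        Module.End.one_apply]
    rw [← h1, ← hg]
    congr 1
    exact (g.apply_symm_apply x)

/-- `G₂ = Aut(𝕆)`, acting (faithfully and isometrically) on `Im 𝕆 = ℝ⁷`. -/
def g2 : Subgroup (Im ≃ₗᵢ[ℝ] Im) where
  carrier := {g | ∃ φ : Oct ≃ₗ[ℝ] Oct, (∀ x y, φ (mul x y) = mul (φ x) (φ y)) ∧
    ∀ v : Im, φ (v : Oct) = (g v : Oct)}
  one_mem' := ⟨LinearEquiv.refl ℝ Oct, by simp, by simp⟩
  mul_mem' := by
    rintro g h ⟨φ, hφ, hg⟩ ⟨ψ, hψ, hh⟩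
    exact ⟨ψ.trans φ, by simp [hφ, hψ], by simp [hg, hh]⟩
  inv_mem' := by
    rintro g ⟨φ, hφ, hg⟩
    refine ⟨φ.symm, fun x y => ?_, fun v => ?_⟩
    · apply φ.injective
      simp [hφ]
    · apply φ.injective
      rw [hg, φ.apply_symm_apply]
      exact congrArg Subtype.val (g.apply_symm_apply v).symm

/-- The affine space of `Spin(7)`-invariant affine connections on `S⁷`. -/
def aff7 : AffineSubspace ℝ (Operator (𝓡 7) (Sph Oct)) :=
  invariantConnections (sphereMaps spin7)

/-- The affine space of `G₂`-invariant affine connections on `S⁶`. -/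
def aff6 : AffineSubspace ℝ (Operator (𝓡 6) (Sph Im)) :=
  invariantConnections (sphereMaps g2)

/-- The base point `1 ∈ S⁷ ⊆ 𝕆`, with isotropy group `G₂` in `Spin(7)`. -/
def basePoint7 : Sph Oct := ⟨one, by simp [norm_one]⟩

/-- The imaginary unit `(i, 0)`. -/
def imI : Oct := WithLp.toLp 2 (((Complex.I : ℂ) : ℍ[ℝ]), 0)

lemma inner_one_imI : inner ℝ one imI = 0 := by
  rw [WithLp.prod_inner_apply, Quaternion.inner_def, Quaternion.inner_def]
  simp [one, imI]

lemma norm_imI : ‖imI‖ = 1 := by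
  have h : ‖((Complex.I : ℂ) : ℍ[ℝ])‖ = 1 := by
    rw [norm_eq_sqrt_real_inner, Quaternion.inner_self, Quaternion.normSq_def']
    simp
  rw [WithLp.prod_norm_eq_of_L2]
  simp [imI, h]

/-- The base point `i ∈ S⁶ ⊆ Im 𝕆`, with isotropy group `SU(3)` in `G₂`. -/
def basePoint6 : Sph Im :=
  ⟨⟨imI, Submodule.mem_orthogonal_singleton_iff_inner_right.2 inner_one_imI⟩, by
    rw [mem_sphere_zero_iff_norm]
    exact norm_imI⟩

end Oct

end InvConn

end

noncomputable section
namespace InvConn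

/-! Two affine connections differ by a tensor. Relative to the Levi-Civita connection of the round
sphere (`levi`), which every linear isometry preserves, an invariant connection is therefore an
invariant bilinear tensor. Since the group is transitive, that tensor is determined by its value at
`o`, a bilinear map on the tangent space commuting with the isotropy group. The invariant theory
needed at `o` is collected in `Classified` and established in `Oct.classified7` and
`Oct.classified6`: such maps are the real multiples of the vector product on `Im 𝕆` for `S⁷`, and
the combinations of the two maps `(u, v) ↦ (u × v)^⊥` and `i × (u × v)` on `i^⊥` for `S⁶`. This
gives dimensions one and two.

No representation theory of `G₂` or `SU(3)` enters. All classifications use one kind of isotropy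
element, the flip (`Oct.IsFlip`): the involution that is the identity on a quaternion subalgebra and
`-1` on its orthogonal complement. Flips lie in `Spin(7)` because the volume element of the Clifford
algebra acts by a scalar on `𝕆`. Spin elements preserve the triple product `(x ȳ) z` by the Moufang
identities, so those fixing `1` are automorphisms of `𝕆`.

For `X ∈ 𝔪` with `X o = u`, the tangential part of `X v` is again an isotropy-invariant bilinear
map, hence `∑ κ i • T i`. As the `T i` are skew in their arguments, `[X, Y]_𝔪` corresponds to `2 ∑ κ
i • T i`, while `conn T c` has Nomizu map `∑ (κ + c) i • T i`. So `Λ^α` belongs to `c = -α κ`. The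
vector `κ` is nonzero since the Lie algebra contains no transvections of the round symmetric space
in at least one direction (`not_flat`). For complex `α`, an invariant `J` acts on the
two-dimensional space of tensors with square `-1`, which makes `α ↦ c` bijective.

Finally, invariant metrics are multiples of the round metric (again by flips), and each `T i x u` is
a skew operator on the tangent space, so adding tensors to the Levi-Civita connection keeps it
metric. -/

lemma two_le_infty : (2 : WithTop ℕ∞) ≤ ∞ := by
  exact WithTop.coe_le_coe.2 le_top

/-! ### Lie brackets of vector fields tested on a vector-valued map. -/

section Bracket
open VectorField Set

variable {V : Type*} [NormedAddCommGroup V] [NormedSpace ℝ V] 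
  {M : Type*} [TopologicalSpace M] [ChartedSpace V M] [IsManifold 𝓘(ℝ, V) ∞ M]
  {F : Type*} [NormedAddCommGroup F] [NormedSpace ℝ F]

/-- Pulling `X` back by the inverse chart inserts the inverse of exactly the derivative that the
chain rule produces, so the two cancel. -/
lemma fderiv_comp_extChartAt_symm {f : M → F} (hf : MDifferentiable 𝓘(ℝ, V) 𝓘(ℝ, F) f) (x : M)
    {y : V} (hy : y ∈ (extChartAt 𝓘(ℝ, V) x).target)
    (X : Π x : M, TangentSpace 𝓘(ℝ, V) x) :
    fderiv ℝ (f ∘ (extChartAt 𝓘(ℝ, V) x).symm) y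
        (mpullbackWithin 𝓘(ℝ, V) 𝓘(ℝ, V) (extChartAt 𝓘(ℝ, V) x).symm X (range 𝓘(ℝ, V)) y)
      = mvfderiv 𝓘(ℝ, V) f ((extChartAt 𝓘(ℝ, V) x).symm y)
          (X ((extChartAt 𝓘(ℝ, V) x).symm y)) := by
  have : IsManifold 𝓘(ℝ, V) 1 M := IsManifold.of_le (n := ∞) (by norm_cast)
  have hφ := mdifferentiableWithinAt_extChartAt_symm hy
  have hi := isInvertible_mfderivWithin_extChartAt_symm hy
  simp only [mpullbackWithin_apply]
  have h := mfderiv_comp_mfderivWithin y (hf _) hφ (by simp [modelWithCornersSelf_coe, uniqueMDiffWithinAt_univ])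
  obtain ⟨e, he⟩ := hi
  have h2 : fderiv ℝ (f ∘ (extChartAt 𝓘(ℝ, V) x).symm) y
      = mfderivWithin 𝓘(ℝ, V) 𝓘(ℝ, F) (f ∘ (extChartAt 𝓘(ℝ, V) x).symm) (range 𝓘(ℝ, V)) y := by
    simp
  rw [h2, h, ← he, ContinuousLinearMap.inverse_equiv]
  have h3 : ∀ w, mfderiv 𝓘(ℝ, V) 𝓘(ℝ, F) f ((extChartAt 𝓘(ℝ, V) x).symm y) (e (e.symm w))
      = mfderiv 𝓘(ℝ, V) 𝓘(ℝ, F) f ((extChartAt 𝓘(ℝ, V) x).symm y) w := fun w => by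
    rw [e.apply_symm_apply]
  exact h3 _

/-- The identity `[X, Y] f = X (Y f) - Y (X f)` for vector-valued `f`, obtained from the flat case
in a chart. Applied to the inclusion of the sphere, it turns brackets into ambient derivatives. -/
lemma mvfderiv_mlieBracket [CompleteSpace V] {f : M → F} (hf : ContMDiff 𝓘(ℝ, V) 𝓘(ℝ, F) ∞ f)
    (X Y : VF 𝓘(ℝ, V) M) (x : M)
    (hX : ContMDiff 𝓘(ℝ, V) 𝓘(ℝ, F) ∞ (fun y => mvfderiv 𝓘(ℝ, V) f y (X y)))
    (hY : ContMDiff 𝓘(ℝ, V) 𝓘(ℝ, F) ∞ (fun y => mvfderiv 𝓘(ℝ, V) f y (Y y))) :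
    mvfderiv 𝓘(ℝ, V) f x (mlieBracket 𝓘(ℝ, V) (fun x => X x) (fun x => Y x) x)
      = mvfderiv 𝓘(ℝ, V) (fun y => mvfderiv 𝓘(ℝ, V) f y (Y y)) x (X x)
        - mvfderiv 𝓘(ℝ, V) (fun y => mvfderiv 𝓘(ℝ, V) f y (X y)) x (Y x) := by
  have : IsManifold 𝓘(ℝ, V) 1 M := IsManifold.of_le (n := ∞) (by norm_cast)
  have : IsManifold 𝓘(ℝ, V) 2 M := IsManifold.of_le (n := ∞) two_le_infty
  set φ := extChartAt 𝓘(ℝ, V) x with hφ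
  have hx : φ x ∈ φ.target := mem_extChartAt_target x
  have hxx : φ.symm (φ x) = x := extChartAt_to_inv x
  have ht : φ.target ∈ nhds (φ x) := extChartAt_target_mem_nhds x
  have dX := (X.mdifferentiableAt (x := x)).mdifferentiableWithinAt (s := univ)
    |>.differentiableWithinAt_mpullbackWithin_vectorField
  have dY := (Y.mdifferentiableAt (x := x)).mdifferentiableWithinAt (s := univ)
    |>.differentiableWithinAt_mpullbackWithin_vectorField
  set V' := mpullbackWithin 𝓘(ℝ, V) 𝓘(ℝ, V) φ.symm (fun x => X x) (range 𝓘(ℝ, V)) with hV'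
  set W' := mpullbackWithin 𝓘(ℝ, V) 𝓘(ℝ, V) φ.symm (fun x => Y x) (range 𝓘(ℝ, V)) with hW'
  have key : ∀ (g : M → F), ContMDiff 𝓘(ℝ, V) 𝓘(ℝ, F) ∞ g → ∀ Z : Π x : M, TangentSpace 𝓘(ℝ, V) x,
      fderiv ℝ (g ∘ φ.symm) (φ x)
        (mpullbackWithin 𝓘(ℝ, V) 𝓘(ℝ, V) φ.symm Z (range 𝓘(ℝ, V)) (φ x)) =
      mvfderiv 𝓘(ℝ, V) g x (Z x) := by
    intro g hg Z
    rw [fderiv_comp_extChartAt_symm (hg.mdifferentiable (by simp)) x hx]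
    rw [hxx]
  -- Equality is needed near `φ x` and not only at the point, because both sides are differentiated
  -- once more.
  have ev : ∀ Z : Π x : M, TangentSpace 𝓘(ℝ, V) x,
      (fun y => fderiv ℝ (f ∘ φ.symm) y
        (mpullbackWithin 𝓘(ℝ, V) 𝓘(ℝ, V) φ.symm Z (range 𝓘(ℝ, V)) y)) =ᶠ[nhds (φ x)]
      (fun y => mvfderiv 𝓘(ℝ, V) f y (Z y)) ∘ φ.symm := by
    intro Z
    filter_upwards [ht] with y hy
    exact fderiv_comp_extChartAt_symm (hf.mdifferentiable (by simp)) x hy Z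
  have hfc : ContDiffAt ℝ ∞ (f ∘ φ.symm) (φ x) := by
    rw [← contMDiffAt_iff_contDiffAt]
    exact hf.contMDiffAt.comp _
      ((contMDiffOn_extChartAt_symm x).contMDiffAt ht)
  have dX' : DifferentiableAt ℝ V' (φ x) := by
    have h := dX
    rw [show (extChartAt 𝓘(ℝ, V) x).symm ⁻¹' univ ∩ range 𝓘(ℝ, V) = univ by simp] at h
    exact differentiableWithinAt_univ.1 h
  have dY' : DifferentiableAt ℝ W' (φ x) := by
    have h := dY
    rw [show (extChartAt 𝓘(ℝ, V) x).symm ⁻¹' univ ∩ range 𝓘(ℝ, V) = univ by simp] at h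
    exact differentiableWithinAt_univ.1 h
  have main := fderiv_apply_lieBracket hfc (by simpa using two_le_infty) dY' dX'
  rw [(ev _).fderiv_eq, (ev _).fderiv_eq, key _ hY, key _ hX] at main
  rw [← main]
  have hφx : MDifferentiableAt 𝓘(ℝ, V) 𝓘(ℝ, V) φ x :=
    mdifferentiableAt_extChartAt (ChartedSpace.mem_chart_source x)
  have hff : f =ᶠ[nhds x] (f ∘ φ.symm) ∘ φ := by
    filter_upwards [extChartAt_source_mem_nhds (I := 𝓘(ℝ, V)) x] with y hy
    simp only [Function.comp_apply]
    rw [φ.left_inv hy]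
  obtain ⟨e, he⟩ := isInvertible_mfderiv_extChartAt (I := 𝓘(ℝ, V)) (mem_extChartAt_source x)
  have h1 : ∀ w, mvfderiv 𝓘(ℝ, V) f x w = fderiv ℝ (f ∘ φ.symm) (φ x) (e w) := by
    intro w
    have h2 : HasMFDerivAt 𝓘(ℝ, V) 𝓘(ℝ, F) f x
        ((fderiv ℝ (f ∘ φ.symm) (φ x)).comp (mfderiv 𝓘(ℝ, V) 𝓘(ℝ, V) φ x)) :=
      (((hfc.differentiableAt (by simp)).hasFDerivAt.hasMFDerivAt).comp x
        hφx.hasMFDerivAt).congr_of_eventuallyEq hff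
    rw [← he] at h2
    exact congrArg (fun A : V →L[ℝ] F => A w) h2.mfderiv
  rw [h1, mlieBracket, mlieBracketWithin_apply, ← he, ContinuousLinearMap.inverse_equiv]
  have h3 : ∀ w, fderiv ℝ (f ∘ φ.symm) (φ x) (e (e.symm w)) = fderiv ℝ (f ∘ φ.symm) (φ x) w :=
    fun w => by rw [e.apply_symm_apply]
  refine (h3 _).trans ?_
  rw [show (extChartAt 𝓘(ℝ, V) x).symm ⁻¹' univ ∩ range 𝓘(ℝ, V) = univ by simp]
  exact congrArg (fun B : V → V => fderiv ℝ (f ∘ φ.symm) (φ x) (B (φ x)))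
    (lieBracketWithin_univ (𝕜 := ℝ) (V := V') (W := W'))

end Bracket

/-! ### Vector fields on the sphere as maps to the ambient space. -/

section Analysis

variable {E : Type*} [NormedAddCommGroup E] [InnerProductSpace ℝ E]
  {n : ℕ} [Fact (Module.finrank ℝ E = n + 1)]

/-- A vector field on the sphere as a map to the ambient space. -/
def hat (X : VF (𝓡 n) (Sph E)) (x : Sph E) : E :=
  mvfderiv (𝓡 n) (Subtype.val : Sph E → E) x (X x)

lemma contMDiff_mvfderiv_apply {F : Type*} [NormedAddCommGroup F] [NormedSpace ℝ F]
    {f : Sph E → F} (hf : ContMDiff (𝓡 n) 𝓘(ℝ, F) ∞ f) (X : VF (𝓡 n) (Sph E)) :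
    ContMDiff (𝓡 n) 𝓘(ℝ, F) ∞ (fun x => mvfderiv (𝓡 n) f x (X x)) := by
  have h1 := hf.contMDiff_tangentMap (m := ∞) (by simp)
  exact (contMDiff_snd_tangentBundle_modelSpace F 𝓘(ℝ, F)).comp (h1.comp X.contMDiff)

lemma contMDiff_hat (X : VF (𝓡 n) (Sph E)) : ContMDiff (𝓡 n) 𝓘(ℝ, E) ∞ (hat X) :=
  contMDiff_mvfderiv_apply contMDiff_coe_sphere X

lemma hat_injective : Function.Injective (hat : VF (𝓡 n) (Sph E) → Sph E → E) := by
  intro X Y h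
  ext1 x
  exact injective_mvfderiv_subtypeVal_sphere x (congrFun h x)

lemma inner_hat (X : VF (𝓡 n) (Sph E)) (x : Sph E) : inner ℝ (x : E) (hat X x) = 0 := by
  have : hat X x ∈ (mvfderiv (𝓡 n) ((↑) : Sph E → E) x).range := ⟨X x, rfl⟩
  rw [range_mvfderiv_subtypeVal] at this
  exact Submodule.mem_orthogonal_singleton_iff_inner_right.1 this

lemma exists_mvfderiv_eq (x : Sph E) {v : E} (hv : inner ℝ (x : E) v = 0) :
    ∃ w : TangentSpace (𝓡 n) x, mvfderiv (𝓡 n) (Subtype.val : Sph E → E) x w = v := by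
  have : v ∈ (mvfderiv (𝓡 n) ((↑) : Sph E → E) x).range := by
    rw [range_mvfderiv_subtypeVal]
    exact Submodule.mem_orthogonal_singleton_iff_inner_right.2 hv
  exact this

/-- Radial projection to the sphere, with a junk value at the origin. -/
def radial (o : Sph E) (y : E) : Sph E :=
  open Classical in
  if h : y = 0 then o else ⟨‖y‖⁻¹ • y, by simp [norm_smul, h]⟩

lemma radial_coe (o x : Sph E) : radial o (x : E) = x := by
  have h : (x : E) ≠ 0 := ne_zero_of_mem_unit_sphere x
  have h1 : ‖(x : E)‖ = 1 := norm_eq_of_mem_sphere x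
  ext
  simp [radial, h, h1]

lemma contMDiffAt_radial (o : Sph E) {y : E} (hy : y ≠ 0) :
    ContMDiffAt 𝓘(ℝ, E) (𝓡 n) ∞ (radial o) y := by
  let U : TopologicalSpace.Opens E := ⟨{0}ᶜ, isOpen_compl_singleton⟩
  have hU : ∀ y : U, (y : E) ≠ 0 := fun y => y.2
  have h1 : ContMDiff 𝓘(ℝ, E) 𝓘(ℝ, E) ∞ (fun y : U => ‖(y : E)‖⁻¹ • (y : E)) := by
    intro y
    have h : ContDiffAt ℝ ∞ (fun y : E => ‖y‖⁻¹ • y) (y : E) :=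
      ((contDiffAt_id.norm ℝ (hU y)).inv (by simpa using hU y)).smul contDiffAt_id
    exact h.contMDiffAt.comp y contMDiff_subtype_val.contMDiffAt
  have h2 := h1.codRestrict_sphere (n := n) (fun y => by simp [norm_smul, hU y])
  rw [← contMDiffAt_subtype_iff (U := U) (x := ⟨y, hy⟩)]
  refine (h2 ⟨y, hy⟩).congr_of_eventuallyEq (Filter.Eventually.of_forall fun z => ?_)
  ext
  simp [radial, hU z]

/-- The candidate field exists pointwise; its smoothness comes from the radial retraction. Since
`radial ∘ Subtype.val = id`, the field is the differential of `radial` applied to the smooth ambient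
map `f`. -/
lemma exists_hat_eq {f : Sph E → E} (hf : ContMDiff (𝓡 n) 𝓘(ℝ, E) ∞ f)
    (h : ∀ x : Sph E, inner ℝ (x : E) (f x) = 0) : ∃ X : VF (𝓡 n) (Sph E), hat X = f := by
  choose X hX using fun x => exists_mvfderiv_eq (n := n) x (h x)
  have hsec : ContMDiff (𝓡 n) (𝓘(ℝ, E).prod 𝓘(ℝ, E)) ∞
      (fun x : Sph E => (⟨(x : E), f x⟩ : TangentBundle 𝓘(ℝ, E) E)) := by
    intro x
    rw [Bundle.contMDiffAt_totalSpace]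
    refine ⟨contMDiff_coe_sphere x, ?_⟩
    simp only [trivializationAt_model_space_apply]
    exact hf x
  refine ⟨⟨X, fun x₀ => ?_⟩, funext hX⟩
  have h1 : ContMDiffOn 𝓘(ℝ, E) (𝓡 n) ∞ (radial x₀) {0}ᶜ :=
    fun y hy => (contMDiffAt_radial x₀ hy).contMDiffWithinAt
  have h2 := h1.contMDiffOn_tangentMapWithin (m := ∞) (by simp)
    isOpen_compl_singleton.uniqueMDiffOn
  have h0 : ∀ x : Sph E, (x : E) ∈ ({0}ᶜ : Set E) := fun x => ne_zero_of_mem_unit_sphere x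
  have h3 : ContMDiff (𝓡 n) ((𝓡 n).prod 𝓘(ℝ, EuclideanSpace ℝ (Fin n))) ∞
      (fun x : Sph E => tangentMapWithin 𝓘(ℝ, E) (𝓡 n) (radial x₀) {0}ᶜ ⟨(x : E), f x⟩) :=
    h2.comp_contMDiff hsec fun x => h0 x
  refine (h3 x₀).congr_of_eventuallyEq (Filter.Eventually.of_forall fun x => ?_)
  simp only
  rw [tangentMapWithin_eq_tangentMap (isOpen_compl_singleton.uniqueMDiffWithinAt (h0 x))
    ((contMDiffAt_radial x₀ (h0 x)).mdifferentiableAt (by simp))]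
  have h4 : (⟨(x : E), f x⟩ : TangentBundle 𝓘(ℝ, E) E)
      = tangentMap (𝓡 n) 𝓘(ℝ, E) (Subtype.val : Sph E → E) ⟨x, X x⟩ := by
    rw [← hX x]; rfl
  rw [h4, ← tangentMap_comp_at]
  · rw [show radial x₀ ∘ (Subtype.val : Sph E → E) = id from funext (radial_coe x₀), tangentMap_id]
    rfl
  · exact (contMDiffAt_radial x₀ (h0 x)).mdifferentiableAt (by simp)
  · exact (contMDiff_coe_sphere (m := 1)).mdifferentiableAt one_ne_zero

@[simp] lemma hat_add (X Y : VF (𝓡 n) (Sph E)) : hat (X + Y) = hat X + hat Y := by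
  ext1 x; simp [hat]

@[simp] lemma hat_sub (X Y : VF (𝓡 n) (Sph E)) : hat (X - Y) = hat X - hat Y := by
  ext1 x; simp [hat]

@[simp] lemma hat_smul (c : ℝ) (X : VF (𝓡 n) (Sph E)) : hat (c • X) = c • hat X := by
  ext1 x; simp [hat]

@[simp] lemma hat_fsmul (f : C^∞⟮𝓡 n, Sph E; ℝ⟯) (X : VF (𝓡 n) (Sph E)) (x : Sph E) :
    hat (fsmul f X) x = f x • hat X x := by
  simp [hat, fsmul]

lemma contMDiff_sphereMap (g : E ≃ₗᵢ[ℝ] E) : ContMDiff (𝓡 n) (𝓡 n) ∞ (sphereMap g) := by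
  refine ContMDiff.codRestrict_sphere (f := fun x : Sph E => g x) ?_ (fun x => by simp)
  exact (g.toContinuousLinearEquiv : E →L[ℝ] E).contMDiff.comp contMDiff_coe_sphere

lemma mvfderiv_clm_comp {F G : Type*} [NormedAddCommGroup F] [NormedSpace ℝ F]
    [NormedAddCommGroup G] [NormedSpace ℝ G] (A : F →L[ℝ] G)
    {f : Sph E → F} {x : Sph E} (hf : MDifferentiableAt (𝓡 n) 𝓘(ℝ, F) f x)
    (v : TangentSpace (𝓡 n) x) :
    mvfderiv (𝓡 n) (fun y => A (f y)) x v = A (mvfderiv (𝓡 n) f x v) :=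
  congrArg (fun B : EuclideanSpace ℝ (Fin n) →L[ℝ] G => B v)
    (A.hasFDerivAt.hasMFDerivAt.comp x hf.hasMFDerivAt).mfderiv

lemma mdifferentiableAt_coe_sphere (x : Sph E) :
    MDifferentiableAt (𝓡 n) 𝓘(ℝ, E) (Subtype.val : Sph E → E) x :=
  (contMDiff_coe_sphere (m := 1)).mdifferentiableAt one_ne_zero

lemma mvfderiv_comp_sphereMap {F : Type*} [NormedAddCommGroup F] [NormedSpace ℝ F]
    {f : Sph E → F} (g : E ≃ₗᵢ[ℝ] E) {x : Sph E}
    (hf : MDifferentiableAt (𝓡 n) 𝓘(ℝ, F) f (sphereMap g x)) (v : TangentSpace (𝓡 n) x) :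
    mvfderiv (𝓡 n) (fun y => f (sphereMap g y)) x v
      = mvfderiv (𝓡 n) f (sphereMap g x) (mfderiv (𝓡 n) (𝓡 n) (sphereMap g) x v) :=
  mfderiv_comp_apply x hf ((contMDiff_sphereMap g).mdifferentiableAt (by simp)) v

lemma coe_mfderiv_sphereMap (g : E ≃ₗᵢ[ℝ] E) (x : Sph E) (v : TangentSpace (𝓡 n) x) :
    mvfderiv (𝓡 n) (Subtype.val : Sph E → E) (sphereMap g x) (mfderiv (𝓡 n) (𝓡 n) (sphereMap g) x v)
      = g (mvfderiv (𝓡 n) (Subtype.val : Sph E → E) x v) := by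
  rw [← mvfderiv_comp_sphereMap g (mdifferentiableAt_coe_sphere _)]
  exact mvfderiv_clm_comp (toOp g) (mdifferentiableAt_coe_sphere x) v

/-- The differential of the inclusion is injective and carries the differential of `sphereMap g` to
the linear map `g`, so relatedness can be tested in `E`. -/
lemma isRelated_iff (g : E ≃ₗᵢ[ℝ] E) (X X' : VF (𝓡 n) (Sph E)) :
    IsRelated (sphereMap g) X X' ↔ ∀ x, g (hat X x) = hat X' (sphereMap g x) := by
  refine forall_congr' fun x => ?_
  rw [← (injective_mvfderiv_subtypeVal_sphere (sphereMap g x)).eq_iff, coe_mfderiv_sphereMap]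
  rfl

end Analysis
end InvConn
end

noncomputable section
namespace InvConn

/-! ### The Levi-Civita connection and tensorial operators on the sphere. -/

section Connections

variable {E : Type*} [NormedAddCommGroup E] [InnerProductSpace ℝ E]
  {n : ℕ} [Fact (Module.finrank ℝ E = n + 1)]

/-- The vector field on the sphere given by a smooth tangential map to the ambient space. -/
def mkVF (f : Sph E → E) (hf : ContMDiff (𝓡 n) 𝓘(ℝ, E) ∞ f)
    (h : ∀ x : Sph E, inner ℝ (x : E) (f x) = 0) : VF (𝓡 n) (Sph E) :=
  (exists_hat_eq hf h).choose

@[simp] lemma hat_mkVF (f : Sph E → E) (hf : ContMDiff (𝓡 n) 𝓘(ℝ, E) ∞ f)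
    (h : ∀ x : Sph E, inner ℝ (x : E) (f x) = 0) : hat (mkVF f hf h) = f :=
  (exists_hat_eq hf h).choose_spec

lemma eq_of_hat_eq {X Y : VF (𝓡 n) (Sph E)} (h : ∀ x, hat X x = hat Y x) : X = Y :=
  hat_injective (funext h)

lemma mdifferentiableAt_hat (X : VF (𝓡 n) (Sph E)) (x : Sph E) :
    MDifferentiableAt (𝓡 n) 𝓘(ℝ, E) (hat X) x :=
  (contMDiff_hat X).mdifferentiableAt (by simp)

omit [Fact (Module.finrank ℝ E = n + 1)] in
lemma inner_coe_self (x : Sph E) : inner ℝ (x : E) (x : E) = 1 := by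
  rw [real_inner_self_eq_norm_sq, norm_eq_of_mem_sphere]; norm_num

lemma mvfderiv_inner {f g : Sph E → E} {x : Sph E}
    (hf : MDifferentiableAt (𝓡 n) 𝓘(ℝ, E) f x) (hg : MDifferentiableAt (𝓡 n) 𝓘(ℝ, E) g x)
    (v : TangentSpace (𝓡 n) x) :
    mvfderiv (𝓡 n) (fun y => (inner ℝ (f y) (g y) : ℝ)) x v
      = inner ℝ (f x) (mvfderiv (𝓡 n) g x v) + inner ℝ (mvfderiv (𝓡 n) f x v) (g x) := by
  have h2 := hf.hasMFDerivAt.2.inner ℝ hg.hasMFDerivAt.2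
  have h1 : HasMFDerivAt (𝓡 n) 𝓘(ℝ, ℝ) (fun y => (inner ℝ (f y) (g y) : ℝ)) x _ :=
    ⟨hf.continuousAt.inner hg.continuousAt, h2⟩
  have h3 := congrArg (fun B : EuclideanSpace ℝ (Fin n) →L[ℝ] ℝ => B v) h1.mfderiv
  refine Eq.trans h3 ?_
  simp [writtenInExtChartAt, mvfderiv]
  rfl

lemma contMDiff_inner {f g : Sph E → E} (hf : ContMDiff (𝓡 n) 𝓘(ℝ, E) ∞ f)
    (hg : ContMDiff (𝓡 n) 𝓘(ℝ, E) ∞ g) :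
    ContMDiff (𝓡 n) 𝓘(ℝ, ℝ) ∞ (fun x => (inner ℝ (f x) (g x) : ℝ)) :=
  (contDiff_inner (n := ∞)).contMDiff.comp (hf.prodMk_space hg)

lemma mvfderiv_coe (X : VF (𝓡 n) (Sph E)) (x : Sph E) :
    mvfderiv (𝓡 n) (Subtype.val : Sph E → E) x (X x) = hat X x := rfl

/-- Differentiate `⟨x, Y⟩ = 0` along `X`. This is the normal component that `levi` has to remove. -/
lemma inner_mvfderiv_hat (X Y : VF (𝓡 n) (Sph E)) (x : Sph E) :
    inner ℝ (x : E) (mvfderiv (𝓡 n) (hat Y) x (X x)) = -inner ℝ (hat X x) (hat Y x) := by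
  have h := mvfderiv_inner (mdifferentiableAt_coe_sphere x) (mdifferentiableAt_hat Y x) (X x)
  have h0 : (fun y : Sph E => (inner ℝ (y : E) (hat Y y) : ℝ)) = fun _ => 0 :=
    funext fun y => inner_hat Y y
  rw [h0, mvfderiv_const, mvfderiv_coe] at h
  simp only [_root_.zero_apply] at h
  linarith

/-- The Levi-Civita connection of the round sphere. -/
def levi : Operator (𝓡 n) (Sph E) := fun X Y =>
  mkVF (fun x => mvfderiv (𝓡 n) (hat Y) x (X x) + (inner ℝ (hat X x) (hat Y x) : ℝ) • (x : E))
    ((contMDiff_mvfderiv_apply (contMDiff_hat Y) X).add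
      ((contMDiff_inner (contMDiff_hat X) (contMDiff_hat Y)).smul contMDiff_coe_sphere))
    (fun x => by
      rw [inner_add_right, inner_mvfderiv_hat, inner_smul_right, inner_coe_self]; ring)

lemma hat_levi (X Y : VF (𝓡 n) (Sph E)) (x : Sph E) :
    hat (levi X Y) x
      = mvfderiv (𝓡 n) (hat Y) x (X x) + (inner ℝ (hat X x) (hat Y x) : ℝ) • (x : E) := by
  simp [levi]

lemma isAffineConnection_levi : IsAffineConnection (levi : Operator (𝓡 n) (Sph E)) where
  add_left X X' Y := eq_of_hat_eq fun x => by
    simp only [hat_add, Pi.add_apply, hat_levi, ContMDiffSection.coe_add, map_add, inner_add_left]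
    module
  smul_left f X Y := eq_of_hat_eq fun x => by
    simp only [hat_fsmul, hat_levi, inner_smul_left, smul_add, smul_smul, RCLike.conj_to_real]
    simp only [fsmul, ContMDiffSection.coeFn_mk, map_smul]
  add_right X Y Y' := eq_of_hat_eq fun x => by
    simp only [hat_add, Pi.add_apply, hat_levi, inner_add_right]
    rw [mvfderiv_add (mdifferentiableAt_hat Y x) (mdifferentiableAt_hat Y' x)]
    simp only [_root_.add_apply]
    module
  leibniz f X Y x := by
    apply injective_mvfderiv_subtypeVal_sphere x
    simp only [map_add, map_smul, mvfderiv_coe, hat_levi, hat_fsmul, inner_smul_right]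
    have h : hat (fsmul f Y) = (f : Sph E → ℝ) • hat Y := funext fun y => hat_fsmul f Y y
    rw [h, mvfderiv_smul (f.contMDiff.mdifferentiableAt (by simp)) (mdifferentiableAt_hat Y x)]
    simp only [_root_.add_apply, _root_.smul_apply,
      ContinuousLinearMap.smulRight_apply]
    module

/-- A linear `g` commutes with the ambient derivative, and an isometry preserves the coefficient of
the normal correction. -/
lemma isInvariantUnder_levi (g : E ≃ₗᵢ[ℝ] E) :
    IsInvariantUnder (sphereMap g) (levi : Operator (𝓡 n) (Sph E)) := by
  intro X X' Y Y' hX hY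
  rw [isRelated_iff] at hY ⊢
  have hX1 := (isRelated_iff g X X').1 hX
  intro x
  rw [hat_levi, hat_levi, ← hX1, ← hY, ← hX x,
    ← mvfderiv_comp_sphereMap g (mdifferentiableAt_hat Y' _)]
  have h : (fun y => hat Y' (sphereMap g y)) = fun y => toOp g (hat Y y) :=
    funext fun y => (hY y).symm
  rw [h, mvfderiv_clm_comp (toOp g) (mdifferentiableAt_hat Y x), map_add, map_smul,
    LinearIsometryEquiv.inner_map_map]
  rfl

/-- The vector field on the sphere obtained by projecting a constant vector. -/
def proj (u : E) : VF (𝓡 n) (Sph E) :=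
  mkVF (fun x => u - (inner ℝ (x : E) u : ℝ) • (x : E))
    (contMDiff_const.sub ((contMDiff_inner contMDiff_coe_sphere contMDiff_const).smul contMDiff_coe_sphere))
    (fun x => by rw [inner_sub_right, inner_smul_right, inner_coe_self]; ring)

lemma hat_proj (u : E) (x : Sph E) :
    hat (proj u : VF (𝓡 n) (Sph E)) x = u - (inner ℝ (x : E) u : ℝ) • (x : E) := by
  simp [proj]

/-- A constant function. -/
def constFun (c : ℝ) : C^∞⟮𝓡 n, Sph E; ℝ⟯ := ⟨fun _ => c, contMDiff_const⟩

lemma proj_add (u v : E) : (proj (u + v) : VF (𝓡 n) (Sph E)) = proj u + proj v :=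
  eq_of_hat_eq fun x => by
    simp only [hat_add, Pi.add_apply, hat_proj, inner_add_right]; module

lemma proj_smul (c : ℝ) (u : E) :
    (proj (c • u) : VF (𝓡 n) (Sph E)) = fsmul (constFun c) (proj u) :=
  eq_of_hat_eq fun x => by
    have h : (constFun c : C^∞⟮𝓡 n, Sph E; ℝ⟯) x = c := rfl
    rw [hat_fsmul, hat_proj, hat_proj, inner_smul_right, h]; module

/-- Operators that are bilinear over the smooth functions. -/
structure IsTensorial (S : Operator (𝓡 n) (Sph E)) : Prop where
  add_left : ∀ X X' Y, S (X + X') Y = S X Y + S X' Y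
  smul_left : ∀ (f : C^∞⟮𝓡 n, Sph E; ℝ⟯) X Y, S (fsmul f X) Y = fsmul f (S X Y)
  add_right : ∀ X Y Y', S X (Y + Y') = S X Y + S X Y'
  smul_right : ∀ (f : C^∞⟮𝓡 n, Sph E; ℝ⟯) X Y, S X (fsmul f Y) = fsmul f (S X Y)

/-- The derivative of `f` in the Leibniz rule is the same for both connections and cancels. -/
lemma IsAffineConnection.isTensorial_sub {D D' : Operator (𝓡 n) (Sph E)}
    (h : IsAffineConnection D) (h' : IsAffineConnection D') : IsTensorial (D - D') where
  add_left X X' Y := by simp only [Pi.sub_apply, h.add_left, h'.add_left]; abel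
  smul_left f X Y := eq_of_hat_eq fun x => by
    simp only [Pi.sub_apply, h.smul_left, h'.smul_left, hat_sub, hat_fsmul, smul_sub]
  add_right X Y Y' := by simp only [Pi.sub_apply, h.add_right, h'.add_right]; abel
  smul_right f X Y := by
    ext x
    simp only [Pi.sub_apply, ContMDiffSection.coe_sub, h.leibniz, h'.leibniz]
    simp only [fsmul, ContMDiffSection.coeFn_mk, ContMDiffSection.coe_sub, Pi.sub_apply]
    module

/-- The bilinear map on the ambient space determined by a tensorial operator. -/
def tensorAt {S : Operator (𝓡 n) (Sph E)} (hS : IsTensorial S) (x : Sph E) : E →ₗ[ℝ] E →ₗ[ℝ] E :=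
  LinearMap.mk₂ ℝ (fun u v => hat (S (proj u) (proj v)) x)
    (fun u u' v => by rw [proj_add, hS.add_left, hat_add]; rfl)
    (fun c u v => by rw [proj_smul, hS.smul_left, hat_fsmul]; rfl)
    (fun u v v' => by rw [proj_add, hS.add_right, hat_add]; rfl)
    (fun c u v => by rw [proj_smul, hS.smul_right, hat_fsmul]; rfl)

lemma tensorAt_apply {S : Operator (𝓡 n) (Sph E)} (hS : IsTensorial S) (x : Sph E) (u v : E) :
    tensorAt hS x u v = hat (S (proj u) (proj v)) x := rfl

lemma hat_sum {ι : Type*} (s : Finset ι) (X : ι → VF (𝓡 n) (Sph E)) (x : Sph E) :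
    hat (∑ i ∈ s, X i) x = ∑ i ∈ s, hat (X i) x := by
  classical
  induction s using Finset.induction_on with
  | empty => simp [hat]
  | insert a s ha ih => rw [Finset.sum_insert ha, Finset.sum_insert ha, hat_add, Pi.add_apply, ih]

/-- The component of a vector field along a fixed vector. -/
def component (b : E) (X : VF (𝓡 n) (Sph E)) : C^∞⟮𝓡 n, Sph E; ℝ⟯ :=
  ⟨fun x => inner ℝ b (hat X x), contMDiff_inner contMDiff_const (contMDiff_hat X)⟩

lemma component_apply (b : E) (X : VF (𝓡 n) (Sph E)) (x : Sph E) :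
    component b X x = inner ℝ b (hat X x) := rfl

/-- The projected constant fields `proj (b i)` span globally over the smooth functions: the normal
parts add up to `⟨x, X⟩ x`, which vanishes. -/
lemma eq_sum_fsmul_proj {ι : Type*} [Fintype ι] (b : OrthonormalBasis ι ℝ E)
    (X : VF (𝓡 n) (Sph E)) : X = ∑ i, fsmul (component (b i) X) (proj (b i)) :=
  eq_of_hat_eq fun x => by
    rw [hat_sum]
    simp only [hat_fsmul, hat_proj, component_apply, smul_sub, Finset.sum_sub_distrib]
    rw [b.sum_repr']
    have : ∑ i, (inner ℝ (b i) (hat X x) : ℝ) • ((inner ℝ (x : E) (b i) : ℝ) • (x : E)) = 0 := by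
      simp_rw [smul_smul]
      rw [← Finset.sum_smul]
      have := b.sum_inner_mul_inner (x : E) (hat X x)
      simp_rw [mul_comm]
      rw [this, inner_hat, zero_smul]
    rw [this, sub_zero]

/-- Locality of a tensor usually needs bump functions. Here the global expansion `eq_sum_fsmul_proj`
in both arguments replaces them. -/
lemma IsTensorial.hat_apply {S : Operator (𝓡 n) (Sph E)} (hS : IsTensorial S)
    (X Y : VF (𝓡 n) (Sph E)) (x : Sph E) :
    hat (S X Y) x = tensorAt hS x (hat X x) (hat Y x) := by
  have : FiniteDimensional ℝ E := .of_fact_finrank_eq_succ n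
  let b := stdOrthonormalBasis ℝ E
  have hl : ∀ Y, S X Y = ∑ i, fsmul (component (b i) X) (S (proj (b i)) Y) := fun Y => by
    have := map_sum (AddMonoidHom.mk' (fun X => S X Y) fun X X' => hS.add_left X X' Y)
      (fun i => fsmul (component (b i) X) (proj (b i))) Finset.univ
    rw [← eq_sum_fsmul_proj] at this
    simpa only [AddMonoidHom.mk'_apply, hS.smul_left] using this
  have hr : ∀ X, S X Y = ∑ i, fsmul (component (b i) Y) (S X (proj (b i))) := fun X => by
    have := map_sum (AddMonoidHom.mk' (fun Y => S X Y) fun Y Y' => hS.add_right X Y Y')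
      (fun i => fsmul (component (b i) Y) (proj (b i))) Finset.univ
    rw [← eq_sum_fsmul_proj] at this
    simpa only [AddMonoidHom.mk'_apply, hS.smul_right] using this
  have hX : tensorAt hS x (hat X x) (hat Y x)
      = tensorAt hS x (∑ i, (inner ℝ (b i) (hat X x) : ℝ) • b i)
          (∑ j, (inner ℝ (b j) (hat Y x) : ℝ) • b j) := by
    rw [b.sum_repr', b.sum_repr']
  rw [hX, hl, hat_sum, map_sum (tensorAt hS x)]
  rw [LinearMap.sum_apply]
  refine Finset.sum_congr rfl fun i _ => ?_
  rw [hat_fsmul, component_apply, hr, hat_sum, map_smul, LinearMap.smul_apply, map_sum]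
  simp only [hat_fsmul, component_apply, map_smul, tensorAt_apply]

end Connections
end InvConn
end

noncomputable section
namespace InvConn

/-! ### Invariant connections from invariant bilinear maps at the base point. -/

section Tensors

variable {E : Type*} [NormedAddCommGroup E] [InnerProductSpace ℝ E]
  {n : ℕ} [Fact (Module.finrank ℝ E = n + 1)]

variable (E n) in
/-- A smooth family of bilinear maps on the ambient space with values in the tangent spaces of the
sphere. -/
structure TangentTensor where
  toFun : Sph E → E →ₗ[ℝ] E →ₗ[ℝ] E
  smooth : ∀ {f g : Sph E → E}, ContMDiff (𝓡 n) 𝓘(ℝ, E) ∞ f → ContMDiff (𝓡 n) 𝓘(ℝ, E) ∞ g →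
    ContMDiff (𝓡 n) 𝓘(ℝ, E) ∞ (fun x => toFun x (f x) (g x))
  tangent : ∀ (x : Sph E) u v, inner ℝ (x : E) (toFun x u v) = 0

namespace TangentTensor

instance : CoeFun (TangentTensor E n) (fun _ => Sph E → E →ₗ[ℝ] E →ₗ[ℝ] E) := ⟨toFun⟩

/-- The operator on vector fields defined by a tensor. -/
def op (T : TangentTensor E n) : Operator (𝓡 n) (Sph E) := fun X Y =>
  mkVF (fun x => T x (hat X x) (hat Y x)) (T.smooth (contMDiff_hat X) (contMDiff_hat Y))
    (fun x => T.tangent x _ _)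

lemma hat_op (T : TangentTensor E n) (X Y : VF (𝓡 n) (Sph E)) (x : Sph E) :
    hat (T.op X Y) x = T x (hat X x) (hat Y x) := by
  simp [op]

end TangentTensor

variable {ι : Type*} [Fintype ι] (T : ι → TangentTensor E n)

/-- Linear combinations of tensors, as operators. -/
def combo : (ι → ℝ) →ₗ[ℝ] Operator (𝓡 n) (Sph E) :=
  Fintype.linearCombination ℝ fun i => (T i).op

lemma hat_combo (c : ι → ℝ) (X Y : VF (𝓡 n) (Sph E)) (x : Sph E) :
    hat (combo T c X Y) x = ∑ i, c i • T i x (hat X x) (hat Y x) := by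
  simp [combo, Fintype.linearCombination_apply, Finset.sum_apply, hat_sum, TangentTensor.hat_op]

/-- The connection differing from the Levi-Civita connection by a combination of tensors. -/
def conn (c : ι → ℝ) : Operator (𝓡 n) (Sph E) := levi + combo T c

lemma hat_conn (c : ι → ℝ) (X Y : VF (𝓡 n) (Sph E)) (x : Sph E) :
    hat (conn T c X Y) x = hat (levi X Y) x + ∑ i, c i • T i x (hat X x) (hat Y x) := by
  simp [conn, hat_combo]

lemma isAffineConnection_conn (c : ι → ℝ) : IsAffineConnection (conn T c) where
  add_left X X' Y := eq_of_hat_eq fun x => by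
    simp only [hat_conn, isAffineConnection_levi.add_left, hat_add, Pi.add_apply, map_add,
      LinearMap.add_apply, smul_add, Finset.sum_add_distrib]
    abel
  smul_left f X Y := eq_of_hat_eq fun x => by
    simp only [hat_conn, isAffineConnection_levi.smul_left, hat_fsmul, map_smul,
      LinearMap.smul_apply, smul_add, Finset.smul_sum, smul_comm (f x)]
  add_right X Y Y' := eq_of_hat_eq fun x => by
    simp only [hat_conn, isAffineConnection_levi.add_right, hat_add, Pi.add_apply, map_add,
      smul_add, Finset.sum_add_distrib]
    abel
  leibniz f X Y x := by
    apply injective_mvfderiv_subtypeVal_sphere x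
    have h := congrArg (mvfderiv (𝓡 n) (Subtype.val : Sph E → E) x)
      (isAffineConnection_levi.leibniz f X Y x)
    simp only [map_add, map_smul, mvfderiv_coe] at h ⊢
    simp only [hat_conn, h, hat_fsmul, map_smul, smul_add, Finset.smul_sum, smul_comm (f x)]
    abel

/-- Invariant-theoretic data for a group acting on a sphere: the tensors `T i` form a basis
of the invariant bilinear maps on the tangent space at `o`, they are skew, and invariant symmetric
forms on the tangent space are unique up to a factor. -/
structure Classified (G : Subgroup (E ≃ₗᵢ[ℝ] E)) (o : Sph E) : Prop where
  transitive : ∀ x : Sph E, ∃ g ∈ G, sphereMap g o = x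
  equivariant : ∀ i, ∀ g ∈ G, ∀ x u v, g (T i x u v) = T i (sphereMap g x) (g u) (g v)
  classify : ∀ B : E →ₗ[ℝ] E →ₗ[ℝ] E, (∀ u v, inner ℝ (o : E) (B u v) = 0) →
    (∀ g ∈ G, g o = o → ∀ u v, inner ℝ (o : E) u = 0 → inner ℝ (o : E) v = 0 →
      g (B u v) = B (g u) (g v)) →
    ∃ c : ι → ℝ, ∀ u v, inner ℝ (o : E) u = 0 → inner ℝ (o : E) v = 0 →
      B u v = ∑ i, c i • T i o u v
  independent : ∀ c : ι → ℝ, (∀ u v, inner ℝ (o : E) u = 0 → inner ℝ (o : E) v = 0 →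
    ∑ i, c i • T i o u v = 0) → c = 0
  antisymm : ∀ i u v, inner ℝ (o : E) u = 0 → inner ℝ (o : E) v = 0 → T i o u v = -T i o v u
  skew : ∀ i (x : Sph E) u v w, inner ℝ (x : E) u = 0 → inner ℝ (x : E) v = 0 →
    inner ℝ (x : E) w = 0 → inner ℝ (T i x u v) w = -(inner ℝ v (T i x u w) : ℝ)
  metric_unique : ∀ h : E →ₗ[ℝ] E →ₗ[ℝ] ℝ, (∀ u v, h u v = h v u) →
    (∀ g ∈ G, g o = o → ∀ u v, inner ℝ (o : E) u = 0 → inner ℝ (o : E) v = 0 →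
      h (g u) (g v) = h u v) →
    ∃ r : ℝ, ∀ u v, inner ℝ (o : E) u = 0 → inner ℝ (o : E) v = 0 → h u v = r * inner ℝ u v

variable {T} {G : Subgroup (E ≃ₗᵢ[ℝ] E)} {o : Sph E}

omit [Fact (Module.finrank ℝ E = n + 1)] in
lemma coe_sphereMap (g : E ≃ₗᵢ[ℝ] E) (x : Sph E) : (sphereMap g x : E) = g x := rfl

omit [Fact (Module.finrank ℝ E = n + 1)] in
lemma inner_symm_apply (g : E ≃ₗᵢ[ℝ] E) (u v : E) : inner ℝ (g u) v = inner ℝ u (g.symm v) := by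
  rw [← g.inner_map_map u (g.symm v), g.apply_symm_apply]

lemma Classified.conn_mem (h : Classified T G o) (c : ι → ℝ) :
    conn T c ∈ (invariantConnections (sphereMaps G) : AffineSubspace ℝ (Operator (𝓡 n) (Sph E))) := by
  refine ⟨isAffineConnection_conn T c, ?_⟩
  rintro φ ⟨g, hg, rfl⟩ X X' Y Y' hX hY
  have hl := isInvariantUnder_levi g X X' Y Y' hX hY
  rw [isRelated_iff] at hX hY hl ⊢
  intro x
  rw [hat_conn, hat_conn, map_add, hl, map_sum]
  simp only [map_smul, h.equivariant _ g hg, hX, hY]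

/-- The difference `D - levi` is tensorial and equivariant. Its value at `o` commutes with the
isotropy group, hence is a combination of the `T i`, and transitivity carries this equality to every
point. -/
lemma Classified.exists_conn (h : Classified T G o) {D : Operator (𝓡 n) (Sph E)}
    (hD : D ∈ (invariantConnections (sphereMaps G) : AffineSubspace ℝ (Operator (𝓡 n) (Sph E)))) :
    ∃ c, D = conn T c := by
  obtain ⟨hD, hinv⟩ := hD
  have hS := hD.isTensorial_sub isAffineConnection_levi
  have heq : ∀ g ∈ G, ∀ x u v, g (tensorAt hS x u v) = tensorAt hS (sphereMap g x) (g u) (g v) := by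
    intro g hg x u v
    have hr : ∀ u : E, IsRelated (sphereMap g) (proj u : VF (𝓡 n) (Sph E)) (proj (g u)) := by
      intro u
      rw [isRelated_iff]
      intro x
      rw [hat_proj, hat_proj, map_sub, map_smul, coe_sphereMap, g.inner_map_map]
    have h1 := hinv _ ⟨g, hg, rfl⟩ _ _ _ _ (hr u) (hr v)
    have h2 := isInvariantUnder_levi g _ _ _ _ (hr u) (hr v)
    rw [isRelated_iff] at h1 h2
    simp only [tensorAt_apply, Pi.sub_apply, hat_sub, map_sub, h1, h2]
  obtain ⟨c, hc⟩ := h.classify (tensorAt hS o) (fun u v => inner_hat _ _) (fun g hg hgo u v _ _ => by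
    rw [heq g hg, show sphereMap g o = o from Subtype.ext hgo])
  refine ⟨c, ?_⟩
  funext X Y
  refine eq_of_hat_eq fun x => ?_
  have h1 := hS.hat_apply X Y x
  simp only [Pi.sub_apply, hat_sub] at h1
  rw [hat_conn, ← sub_eq_iff_eq_add', h1]
  obtain ⟨g, hg, rfl⟩ := h.transitive x
  -- The vectors at `g o` are moved back to the tangent space at `o`, where the classification
  -- applies.
  have hX := inner_hat X (sphereMap g o)
  have hY := inner_hat Y (sphereMap g o)
  rw [coe_sphereMap, inner_symm_apply] at hX hY
  have h2 := congrArg g (hc _ _ hX hY)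
  rw [heq g hg, map_sum] at h2
  simpa only [map_smul, h.equivariant _ g hg, g.apply_symm_apply] using h2

lemma Classified.combo_injective (h : Classified T G o) : Function.Injective (combo T) := by
  rw [← LinearMap.ker_eq_bot, LinearMap.ker_eq_bot']
  intro c hc
  refine h.independent c fun u v hu hv => ?_
  have h1 := hat_combo T c (proj u) (proj v) o
  rw [hc, hat_proj, hat_proj, hu, hv] at h1
  simpa [hat] using h1.symm

/-- The affine space is `levi` plus the range of `combo T`, and `combo T` is injective by
independence at `o`. -/
lemma Classified.finrank_direction (h : Classified T G o) :
    Module.finrank ℝ (invariantConnections (sphereMaps G) :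
      AffineSubspace ℝ (Operator (𝓡 n) (Sph E))).direction = Fintype.card ι := by
  have : (invariantConnections (sphereMaps G) :
      AffineSubspace ℝ (Operator (𝓡 n) (Sph E))).direction = LinearMap.range (combo T) := by
    ext S
    rw [AffineSubspace.mem_direction_iff_eq_vsub_right (h.conn_mem 0)]
    constructor
    · rintro ⟨D, hD, rfl⟩
      obtain ⟨c, rfl⟩ := h.exists_conn hD
      exact ⟨c, by simp [conn]⟩
    · rintro ⟨c, rfl⟩
      exact ⟨_, h.conn_mem c, by simp [conn]⟩
  rw [this, LinearMap.finrank_range_of_inj h.combo_injective, Module.finrank_pi]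

end Tensors

end InvConn
end

noncomputable section
namespace InvConn

/-! ### Invariant metrics and metric compatibility. -/

section Metrics

variable {E : Type*} [NormedAddCommGroup E] [InnerProductSpace ℝ E]
  {n : ℕ} [Fact (Module.finrank ℝ E = n + 1)]
  {ι : Type*} [Fintype ι] {T : ι → TangentTensor E n} {G : Subgroup (E ≃ₗᵢ[ℝ] E)} {o : Sph E}

lemma isRelated_proj (g : E ≃ₗᵢ[ℝ] E) (u : E) :
    IsRelated (sphereMap g) (proj u : VF (𝓡 n) (Sph E)) (proj (g u)) := by
  rw [isRelated_iff]
  intro x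
  rw [hat_proj, hat_proj, map_sub, map_smul, coe_sphereMap, g.inner_map_map]

lemma proj_hat (X : VF (𝓡 n) (Sph E)) (x : Sph E) :
    (proj (hat X x) : VF (𝓡 n) (Sph E)) x = X x := by
  apply injective_mvfderiv_subtypeVal_sphere x
  rw [mvfderiv_coe, mvfderiv_coe, hat_proj, inner_hat, zero_smul, sub_zero]

/-- The bilinear form on the ambient space induced by a Riemannian metric on the sphere. -/
def metricForm (g : RMetric (𝓡 n) (Sph E)) (x : Sph E) : E →ₗ[ℝ] E →ₗ[ℝ] ℝ :=
  LinearMap.mk₂ ℝ (fun u v => g.inner x ((proj u : VF (𝓡 n) (Sph E)) x)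
      ((proj v : VF (𝓡 n) (Sph E)) x))
    (fun u u' v => by rw [proj_add, ContMDiffSection.coe_add, Pi.add_apply, map_add]; rfl)
    (fun c u v => by
      rw [proj_smul]
      change g.inner x (c • (proj u : VF (𝓡 n) (Sph E)) x) _ = _
      rw [map_smul]
      rfl)
    (fun u v v' => by rw [proj_add, ContMDiffSection.coe_add, Pi.add_apply, map_add])
    (fun c u v => by
      rw [proj_smul]
      exact map_smul (g.inner x _) c ((proj v : VF (𝓡 n) (Sph E)) x))

lemma metricForm_apply (g : RMetric (𝓡 n) (Sph E)) (x : Sph E) (u v : E) :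
    metricForm g x u v = g.inner x ((proj u : VF (𝓡 n) (Sph E)) x)
      ((proj v : VF (𝓡 n) (Sph E)) x) := rfl

lemma metricForm_hat (g : RMetric (𝓡 n) (Sph E)) (X Y : VF (𝓡 n) (Sph E)) (x : Sph E) :
    metricForm g x (hat X x) (hat Y x) = g.inner x (X x) (Y x) := by
  rw [metricForm_apply, proj_hat, proj_hat]

lemma metricForm_map {g : RMetric (𝓡 n) (Sph E)} {a : E ≃ₗᵢ[ℝ] E}
    (h : IsInvariantMetric (sphereMap a) g) (x : Sph E) (u v : E) :
    metricForm g (sphereMap a x) (a u) (a v) = metricForm g x u v := by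
  rw [metricForm_apply, metricForm_apply, ← isRelated_proj a u x, ← isRelated_proj a v x]
  exact h x _ _

/-- At `o` the metric is an isotropy-invariant symmetric form, so a multiple of the inner product;
transitivity makes the factor the same everywhere. -/
lemma Classified.exists_inner_eq (h : Classified T G o) {g : RMetric (𝓡 n) (Sph E)}
    (hg : ∀ φ ∈ sphereMaps G, IsInvariantMetric φ g) :
    ∃ r : ℝ, ∀ (X Y : VF (𝓡 n) (Sph E)) x,
      g.inner x (X x) (Y x) = r * inner ℝ (hat X x) (hat Y x) := by
  obtain ⟨r, hr⟩ := h.metric_unique (metricForm g o) (fun u v => g.symm o _ _)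
    (fun a ha hao u v _ _ => by
      have := metricForm_map (hg _ ⟨a, ha, rfl⟩) o u v
      rwa [show sphereMap a o = o from Subtype.ext hao] at this)
  refine ⟨r, fun X Y x => ?_⟩
  obtain ⟨a, ha, rfl⟩ := h.transitive x
  have hX := inner_hat X (sphereMap a o)
  have hY := inner_hat Y (sphereMap a o)
  rw [coe_sphereMap, inner_symm_apply] at hX hY
  have h1 := metricForm_map (hg _ ⟨a, ha, rfl⟩) o (a.symm (hat X (sphereMap a o)))
    (a.symm (hat Y (sphereMap a o)))
  rw [a.apply_symm_apply, a.apply_symm_apply, metricForm_hat, hr _ _ hX hY,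
    LinearIsometryEquiv.inner_map_map] at h1
  exact h1

/-- The product rule for the ambient inner product accounts for `levi`, whose normal terms are
orthogonal to tangent vectors. The tensor terms cancel by `skew`, and a constant factor does not
matter. -/
lemma Classified.isMetric_conn (h : Classified T G o) {g : RMetric (𝓡 n) (Sph E)}
    (hg : ∀ φ ∈ sphereMaps G, IsInvariantMetric φ g) (c : ι → ℝ) : IsMetric g (conn T c) := by
  obtain ⟨r, hr⟩ := h.exists_inner_eq hg
  intro X Y Z x
  -- The factor `r` is absorbed into a bounded linear map on the first argument, so that
  -- `mvfderiv_inner` applies as it stands.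
  have h0 : (fun y => g.inner y (Y y) (Z y))
      = fun y => (inner ℝ ((r • ContinuousLinearMap.id ℝ E) (hat Y y)) (hat Z y) : ℝ) := by
    funext y
    rw [hr]
    simp [inner_smul_left]
  have hd : MDifferentiableAt (𝓡 n) 𝓘(ℝ, E)
      (fun y => (r • ContinuousLinearMap.id ℝ E) (hat Y y)) x :=
    ((r • ContinuousLinearMap.id ℝ E).contMDiff.comp (contMDiff_hat Y)).mdifferentiableAt
      (n := ∞) (by simp)
  rw [h0, hr, hr, mvfderiv_inner hd (mdifferentiableAt_hat Z x),
    mvfderiv_clm_comp _ (mdifferentiableAt_hat Y x)]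
  have hs : ∑ i, inner ℝ (c i • T i x (hat X x) (hat Y x)) (hat Z x)
      = -∑ i, (inner ℝ (hat Y x) (c i • T i x (hat X x) (hat Z x)) : ℝ) := by
    rw [← Finset.sum_neg_distrib]
    refine Finset.sum_congr rfl fun i _ => ?_
    rw [inner_smul_left, inner_smul_right,
      h.skew i x _ _ _ (inner_hat _ _) (inner_hat _ _) (inner_hat _ _)]
    simp
  have hY : (inner ℝ (hat Y x) (x : E) : ℝ) = 0 := by rw [real_inner_comm, inner_hat]
  simp only [hat_conn, hat_levi, inner_add_left, inner_add_right, sum_inner, inner_sum, hs]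
  simp only [inner_smul_left, inner_smul_right, inner_hat, hY, smul_apply,
    ContinuousLinearMap.id_apply, RCLike.conj_to_real]
  ring

lemma Classified.invariantMetricConnections_eq (h : Classified T G o) {g : RMetric (𝓡 n) (Sph E)}
    (hg : ∀ φ ∈ sphereMaps G, IsInvariantMetric φ g) :
    invariantMetricConnections (sphereMaps G) g
      = ((invariantConnections (sphereMaps G) : AffineSubspace ℝ (Operator (𝓡 n) (Sph E))) :
        Set (Operator (𝓡 n) (Sph E))) := by
  refine Set.Subset.antisymm (fun D hD => hD.1) fun D hD => ⟨hD, ?_⟩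
  obtain ⟨c, rfl⟩ := h.exists_conn hD
  exact h.isMetric_conn hg c

end Metrics

end InvConn
end

noncomputable section
namespace InvConn
-- The round metric and its smoothness.
section RoundMetric

open Bundle

variable {E : Type*} [NormedAddCommGroup E] [InnerProductSpace ℝ E]
  {n : ℕ} [Fact (Module.finrank ℝ E = n + 1)]

/-- The differential of the inclusion of the sphere, in the trivialization around `x₀`. -/
def inclCoord (x₀ x : Sph E) : EuclideanSpace ℝ (Fin n) →L[ℝ] E :=
  inTangentCoordinates (𝓡 n) 𝓘(ℝ, E) id (Subtype.val : Sph E → E)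
    (fun x => mfderiv (𝓡 n) 𝓘(ℝ, E) (Subtype.val : Sph E → E) x) x₀ x

lemma contMDiffAt_inclCoord (x₀ : Sph E) :
    ContMDiffAt (𝓡 n) 𝓘(ℝ, EuclideanSpace ℝ (Fin n) →L[ℝ] E) ∞ (inclCoord (n := n) x₀) x₀ :=
  ContMDiffAt.mfderiv_const (n := ω) contMDiff_coe_sphere.contMDiffAt (by simp)

/-- Smoothness is available for `inclCoord`, the metric is defined by the intrinsic differential;
this connects them. -/
lemma inclCoord_apply {x₀ x : Sph E}
    (hx : x ∈ (trivializationAt (EuclideanSpace ℝ (Fin n))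
      (TangentSpace (𝓡 n) : Sph E → Type _) x₀).baseSet) (v : EuclideanSpace ℝ (Fin n)) :
    inclCoord x₀ x v = mvfderiv (𝓡 n) (Subtype.val : Sph E → E) x
      ((trivializationAt (EuclideanSpace ℝ (Fin n))
        (TangentSpace (𝓡 n) : Sph E → Type _) x₀).symm x v) := by
  have hx' : (x : E) ∈ (trivializationAt E (TangentSpace 𝓘(ℝ, E) : E → Type _) (x₀ : E)).baseSet := by
    rw [TangentBundle.trivializationAt_baseSet]; simp [chartAt_self_eq]
  have h := ContinuousLinearMap.inCoordinates_eq (ϕ := mfderiv (𝓡 n) 𝓘(ℝ, E) (Subtype.val : Sph E → E) x)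
    hx hx'
  refine (congrArg (fun L : EuclideanSpace ℝ (Fin n) →L[ℝ] E => L v) h).trans ?_
  simp [mvfderiv]
  rfl

/-- The pullback of the inner product by a linear map. -/
def pullInner {V : Type*} [NormedAddCommGroup V] [NormedSpace ℝ V] (A : V →L[ℝ] E) :
    V →L[ℝ] V →L[ℝ] ℝ :=
  (innerSL ℝ : E →L[ℝ] E →L[ℝ] ℝ).bilinearComp A A

lemma contDiff_pullInner {V : Type*} [NormedAddCommGroup V] [NormedSpace ℝ V]
    [FiniteDimensional ℝ V] : ContDiff ℝ ∞ (pullInner : (V →L[ℝ] E) → V →L[ℝ] V →L[ℝ] ℝ) := by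
  refine contDiff_clm_apply_iff.2 fun v => contDiff_clm_apply_iff.2 fun w => ?_
  exact (contDiff_id.clm_apply contDiff_const).inner ℝ (contDiff_id.clm_apply contDiff_const)

/-- The differential of the inclusion of the sphere. -/
def inclDeriv (x : Sph E) : EuclideanSpace ℝ (Fin n) →L[ℝ] E :=
  mvfderiv (𝓡 n) (Subtype.val : Sph E → E) x

/-- The inner product of the ambient space, restricted to the tangent space of the sphere. -/
def roundInner (x : Sph E) : TangentSpace (𝓡 n) x →L[ℝ] TangentSpace (𝓡 n) x →L[ℝ] ℝ :=
  pullInner (V := EuclideanSpace ℝ (Fin n)) (inclDeriv x)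

lemma roundInner_apply (x : Sph E) (v w : TangentSpace (𝓡 n) x) :
    roundInner x v w = inner ℝ (mvfderiv (𝓡 n) (Subtype.val : Sph E → E) x v)
      (mvfderiv (𝓡 n) (Subtype.val : Sph E → E) x w) := rfl

variable (E n) in
/-- The round metric. -/
def roundMetric : RMetric (𝓡 n) (Sph E) where
  inner := roundInner
  symm x v w := by rw [roundInner_apply, roundInner_apply, real_inner_comm]
  pos x v hv := by
    rw [roundInner_apply]
    refine real_inner_self_pos.2 fun h => hv ?_
    exact injective_mvfderiv_subtypeVal_sphere x (by rw [h, map_zero])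
  isVonNBounded x := by
    obtain ⟨K, hK, h⟩ := LinearMap.exists_antilipschitzWith
      (inclDeriv x : EuclideanSpace ℝ (Fin n) →L[ℝ] E).toLinearMap
      (LinearMap.ker_eq_bot.2 (injective_mvfderiv_subtypeVal_sphere x))
    change Bornology.IsVonNBounded ℝ {v : EuclideanSpace ℝ (Fin n) |
      pullInner (V := EuclideanSpace ℝ (Fin n)) (inclDeriv x) v v < 1}
    -- The antilipschitz bound gives `‖v‖ ≤ K`; the radius `K + 1` makes it strict.
    refine (NormedSpace.isVonNBounded_ball ℝ (EuclideanSpace ℝ (Fin n)) (K + 1)).subset fun v hv => ?_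
    have h1 := h.le_mul_dist v 0
    have h2 : ‖(inclDeriv x : EuclideanSpace ℝ (Fin n) →L[ℝ] E) v‖ ≤ 1 := by
      have : ‖(inclDeriv x : EuclideanSpace ℝ (Fin n) →L[ℝ] E) v‖ ^ 2 < 1 := by
        rw [← real_inner_self_eq_norm_sq]; exact hv
      exact ((sq_lt_one_iff₀ (norm_nonneg _)).1 this).le
    rw [map_zero, dist_zero_right, dist_zero_right] at h1
    rw [mem_ball_zero_iff]
    have h3 := h1.trans (mul_le_mul_of_nonneg_left h2 K.2)
    exact lt_of_le_of_lt h3 (by simp)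
  contMDiff x₀ := by
    rw [contMDiffAt_section]
    -- In the trivialization around `x₀` the metric is the inner product pulled back by `inclCoord
    -- x₀ x`, a smooth function of that operator.
    have hA := contMDiffAt_inclCoord (n := n) x₀
    have hC := (contDiff_pullInner (E := E) (V := EuclideanSpace ℝ (Fin n))).contMDiff.contMDiffAt.comp
      x₀ hA
    refine hC.congr_of_eventuallyEq ?_
    have hbase := (trivializationAt (EuclideanSpace ℝ (Fin n))
      (TangentSpace (𝓡 n) : Sph E → Type _) x₀).open_baseSet.mem_nhds
      (FiberBundle.mem_baseSet_trivializationAt' x₀)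
    filter_upwards [hbase] with x hx
    ext v w
    rw [hom_trivializationAt_apply, inCoordinates_apply_eq₂ hx hx (Set.mem_univ _)]
    rw [roundInner_apply, ← inclCoord_apply hx, ← inclCoord_apply hx]
    simp; rfl

lemma isInvariantMetric_roundMetric (g : E ≃ₗᵢ[ℝ] E) :
    IsInvariantMetric (sphereMap g) (roundMetric E n : RMetric (𝓡 n) (Sph E)) := by
  intro x v w
  change roundInner (sphereMap g x) _ _ = roundInner x v w
  rw [roundInner_apply, roundInner_apply, coe_mfderiv_sphereMap, coe_mfderiv_sphereMap,
    g.inner_map_map]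

end RoundMetric

end InvConn
end

noncomputable section
namespace InvConn

/-! ### Lie algebras of linear isometry groups and reductive decompositions. -/

section LieAlgebra

variable {E : Type*} [NormedAddCommGroup E] [InnerProductSpace ℝ E] [FiniteDimensional ℝ E]

attribute [local instance] LieRing.ofAssociativeRing

variable {G : Subgroup (E ≃ₗᵢ[ℝ] E)} {o : Sph E}

lemma hasDerivAt_exp_apply (A : E →L[ℝ] E) (v : E) :
    HasDerivAt (fun t : ℝ => NormedSpace.exp (t • A) v) (A v) 0 := by
  have h := (hasDerivAt_exp_smul_const A (0 : ℝ)).clm_apply (hasDerivAt_const (0 : ℝ) v)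
  simpa using h

/-- For generators, differentiate `⟨exp(tA) u, exp(tA) v⟩ = ⟨u, v⟩` at `t = 0`. Skewness survives
linear combinations and commutators. -/
lemma inner_lieAlg {A : E →L[ℝ] E} (hA : A ∈ lieAlg G) :
    ∀ u v, inner ℝ (A u) v = -(inner ℝ u (A v) : ℝ) := by
  induction hA using LieSubalgebra.lieSpan_induction with
  | mem A hA =>
    intro u v
    have h1 := (hasDerivAt_exp_apply A u).inner ℝ (hasDerivAt_exp_apply A v)
    have h2 : (fun t : ℝ => (inner ℝ (NormedSpace.exp (t • A) u) (NormedSpace.exp (t • A) v) : ℝ))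
        = fun _ => inner ℝ u v := by
      funext t
      obtain ⟨g, -, hg⟩ := hA t
      rw [← hg]
      exact g.inner_map_map u v
    rw [h2] at h1
    have h3 := h1.unique (hasDerivAt_const _ _)
    simp only [zero_smul, NormedSpace.exp_zero] at h3
    change inner ℝ u (A v) + inner ℝ (A u) v = (0 : ℝ) at h3
    linarith
  | zero => simp
  | add A B _ _ hA hB => intro u v; simp [inner_add_left, inner_add_right, hA, hB]; ring
  | smul c A _ hA => intro u v; simp [inner_smul_left, inner_smul_right, hA]
  | lie A B _ _ hA hB =>
    intro u v
    simp [LieRing.of_associative_ring_bracket, inner_sub_left, inner_sub_right, hA, hB]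

omit [FiniteDimensional ℝ E] in
lemma toOp_mul_inv (g : E ≃ₗᵢ[ℝ] E) : toOp g * toOp g⁻¹ = 1 :=
  ContinuousLinearMap.ext fun x => g.apply_symm_apply x

omit [FiniteDimensional ℝ E] in
lemma toOp_inv_mul (g : E ≃ₗᵢ[ℝ] E) : toOp g⁻¹ * toOp g = 1 :=
  ContinuousLinearMap.ext fun x => g.symm_apply_apply x

lemma exp_conj (g : E ≃ₗᵢ[ℝ] E) (A : E →L[ℝ] E) :
    NormedSpace.exp (toOp g * A * toOp g⁻¹) = toOp g * NormedSpace.exp A * toOp g⁻¹ :=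
  let _ := NormedAlgebra.restrictScalars ℚ ℝ (E →L[ℝ] E)
  NormedSpace.exp_units_conj (𝔸 := E →L[ℝ] E) ⟨toOp g, toOp g⁻¹, toOp_mul_inv g, toOp_inv_mul g⟩ A

lemma conj_mem_lieAlg {g : E ≃ₗᵢ[ℝ] E} (hg : g ∈ G) {A : E →L[ℝ] E} (hA : A ∈ lieAlg G) :
    toOp g * A * toOp g⁻¹ ∈ lieAlg G := by
  induction hA using LieSubalgebra.lieSpan_induction with
  | mem A hA =>
    refine LieSubalgebra.subset_lieSpan fun t => ?_
    obtain ⟨a, ha, h⟩ := hA t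
    refine ⟨g * a * g⁻¹, mul_mem (mul_mem hg ha) (inv_mem hg), ?_⟩
    rw [← smul_mul_assoc, ← mul_smul_comm, exp_conj, ← h]
    rfl
  | zero => simp
  | add A B _ _ hA hB => rw [mul_add, add_mul]; exact add_mem hA hB
  | smul c A _ hA => rw [mul_smul_comm, smul_mul_assoc]; exact SMulMemClass.smul_mem c hA
  | lie A B _ _ hA hB =>
    have := (lieAlg G).lie_mem hA hB
    rw [LieRing.of_associative_ring_bracket] at this ⊢
    convert! this using 1
    have h : ∀ X : E →L[ℝ] E, toOp g⁻¹ * (toOp g * X) = X := fun X => by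
      rw [← mul_assoc, toOp_inv_mul, one_mul]
    simp only [mul_sub, sub_mul, mul_assoc, h]

/-- The trace form of a linear Lie algebra. -/
def traceForm (G : Subgroup (E ≃ₗᵢ[ℝ] E)) : LinearMap.BilinForm ℝ (lieAlg G) :=
  LinearMap.mk₂ ℝ (fun A B => LinearMap.trace ℝ E ((A.1 : E →ₗ[ℝ] E) * (B.1 : E →ₗ[ℝ] E)))
    (fun A A' B => by simp [add_mul]) (fun c A B => by simp)
    (fun A B B' => by simp [mul_add]) (fun c A B => by simp)

omit [FiniteDimensional ℝ E] in
lemma traceForm_apply (A B : lieAlg G) : traceForm G A B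
    = LinearMap.trace ℝ E ((A.1 : E →ₗ[ℝ] E) * (B.1 : E →ₗ[ℝ] E)) := rfl

omit [FiniteDimensional ℝ E] in
lemma traceForm_comm (A B : lieAlg G) : traceForm G A B = traceForm G B A := by
  rw [traceForm_apply, traceForm_apply, LinearMap.trace_mul_comm]

/-- For skew `A` the trace of `A²` is `-∑ ‖A eᵢ‖²`, so the trace form is negative definite. -/
lemma eq_zero_of_traceForm {A : lieAlg G} (h : traceForm G A A = 0) : A = 0 := by
  rw [traceForm_apply, LinearMap.trace_eq_sum_inner _ (stdOrthonormalBasis ℝ E)] at h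
  have h1 : ∀ i, inner ℝ (stdOrthonormalBasis ℝ E i)
      (((A.1 : E →ₗ[ℝ] E) * (A.1 : E →ₗ[ℝ] E)) (stdOrthonormalBasis ℝ E i))
      = -(‖A.1 (stdOrthonormalBasis ℝ E i)‖ ^ 2 : ℝ) := fun i => by
    rw [← real_inner_self_eq_norm_sq, inner_lieAlg A.2, neg_neg]
    rfl
  simp only [h1, Finset.sum_neg_distrib, neg_eq_zero] at h
  rw [Finset.sum_eq_zero_iff_of_nonneg (fun _ _ => sq_nonneg _)] at h
  apply Subtype.ext
  have : (A.1 : E →ₗ[ℝ] E) = 0 := (stdOrthonormalBasis ℝ E).toBasis.ext fun i => by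
    simpa using h i (Finset.mem_univ i)
  exact ContinuousLinearMap.coe_injective this

omit [FiniteDimensional ℝ E] in
lemma traceForm_conj (g : E ≃ₗᵢ[ℝ] E) {A B A' B' : lieAlg G} (hA : IsAd g A A') (hB : IsAd g B B') :
    traceForm G A' B' = traceForm G A B := by
  have h : (A'.1 : E →ₗ[ℝ] E) * (B'.1 : E →ₗ[ℝ] E)
      = (toOp g : E →ₗ[ℝ] E) * (A.1 * B.1 * toOp g⁻¹ : E →L[ℝ] E) := by
    rw [hA, hB]
    ext x
    exact congrArg (fun y => g (A.1 y)) (g.symm_apply_apply _)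
  rw [traceForm_apply, traceForm_apply, h, LinearMap.trace_mul_comm]
  congr 1
  ext x
  exact congrArg (fun y => A.1 (B.1 y)) (g.symm_apply_apply x)

/-- The complement is the orthogonal space of `𝔨` for the trace form, which is definite and
`Ad`-invariant. -/
lemma nonempty_reductiveDecomposition (G : Subgroup (E ≃ₗᵢ[ℝ] E)) (o : Sph E) :
    Nonempty (ReductiveDecomposition G o) := by
  have hfin : FiniteDimensional ℝ (lieAlg G) :=
    inferInstanceAs (FiniteDimensional ℝ (lieAlg G).toSubmodule)
  refine ⟨⟨(traceForm G).orthogonal (isotropyAlg G o), ?_, ?_⟩⟩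
  · refine ((LinearMap.BilinForm.isCompl_orthogonal_iff_disjoint
      (fun A B h => by rw [traceForm_comm, h])).2 ?_).symm
    rw [Submodule.disjoint_def]
    intro A hA hA'
    exact eq_zero_of_traceForm (hA' A hA)
  · intro g hg hgo A hA B hAB C hC
    have hgo' : g.symm o = o := by rw [← hgo, g.symm_apply_apply, hgo]
    -- Instead of testing `Ad(g) A` against `C ∈ 𝔨`, test `A` against `Ad(g⁻¹) C`, which is in `𝔨`
    -- since `g` fixes `o`.
    let C' : lieAlg G := ⟨toOp g⁻¹ * C.1 * toOp g⁻¹⁻¹, conj_mem_lieAlg (inv_mem hg) C.2⟩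
    have h1 : IsAd g C' C := by
      refine ContinuousLinearMap.ext fun x => ?_
      refine ((g.apply_symm_apply _).trans ?_).symm
      exact congrArg C.1 (g.apply_symm_apply x)
    have h2 : C' ∈ isotropyAlg G o := by
      change g.symm (C.1 (g o)) = 0
      rw [hgo, show C.1 o = 0 from hC, map_zero]
    have h3 := traceForm_conj g h1 hAB
    exact h3.trans (hA C' h2)

end LieAlgebra

end InvConn
end

noncomputable section
namespace InvConn

/-! ### Nomizu maps of invariant connections. -/

section Nomizu

set_option linter.unusedSectionVars false

variable {E : Type*} [NormedAddCommGroup E] [InnerProductSpace ℝ E] [FiniteDimensional ℝ E]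
  {n : ℕ} [Fact (Module.finrank ℝ E = n + 1)]

attribute [local instance] LieRing.ofAssociativeRing

variable {ι : Type*} [Fintype ι] {T : ι → TangentTensor E n} {G : Subgroup (E ≃ₗᵢ[ℝ] E)} {o : Sph E}

/-- The infinitesimal action is transitive at `o` and the sphere is not a symmetric space. -/
structure Infinitesimal (G : Subgroup (E ≃ₗᵢ[ℝ] E)) (o : Sph E) : Prop where
  surj : ∀ v, inner ℝ (o : E) v = 0 → ∃ A ∈ lieAlg G, A o = v
  not_flat : ∃ u, inner ℝ (o : E) u = 0 ∧ ∀ A ∈ lieAlg G, A o = u →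
    ∃ w, inner ℝ (o : E) w = 0 ∧ A w ≠ -(inner ℝ u w : ℝ) • (o : E)

namespace ReductiveDecomposition

variable (R : ReductiveDecomposition G o)

/-- The identification of `𝔪` with the tangent space at `o`, viewed in the ambient space. -/
def ev : R.𝔪 →ₗ[ℝ] E where
  toFun X := (X : lieAlg G).1 o
  map_add' _ _ := rfl
  map_smul' _ _ := rfl

lemma ev_apply (X : R.𝔪) : R.ev X = (X : lieAlg G).1 o := rfl

lemma ev_injective : Function.Injective R.ev := by
  rw [← LinearMap.ker_eq_bot, LinearMap.ker_eq_bot']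
  intro X hX
  exact Subtype.ext ((Submodule.disjoint_def.1 R.isCompl.disjoint) X X.2 hX)

lemma exists_section : ∃ s : E →ₗ[ℝ] R.𝔪, s ∘ₗ R.ev = LinearMap.id :=
  R.ev.exists_leftInverse_of_injective (LinearMap.ker_eq_bot.2 R.ev_injective)

/-- A linear map inverse to the identification of `𝔪` with the tangent space at `o`. -/
def sec : E →ₗ[ℝ] R.𝔪 := R.exists_section.choose

@[simp] lemma sec_ev (X : R.𝔪) : R.sec (R.ev X) = X :=
  LinearMap.congr_fun R.exists_section.choose_spec X

lemma inner_ev (X : R.𝔪) : inner ℝ (o : E) (R.ev X) = 0 := by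
  have h := inner_lieAlg (X : lieAlg G).2 o o
  rw [real_inner_comm] at h
  rw [ev_apply]
  linarith

lemma exists_ev_eq {A : E →L[ℝ] E} (hA : A ∈ lieAlg G) : ∃ X, R.ev X = A o := by
  have h : (⟨A, hA⟩ : lieAlg G) ∈ R.𝔪 ⊔ isotropyAlg G o := by
    rw [R.isCompl.sup_eq_top]; trivial
  obtain ⟨X, hX, Y, hY, h⟩ := Submodule.mem_sup.1 h
  refine ⟨⟨X, hX⟩, ?_⟩
  have h1 : X.1 + Y.1 = A := congrArg Subtype.val h
  rw [← h1, ev_apply, add_apply, show Y.1 o = 0 from hY, add_zero]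

variable {R}

lemma ev_sec (hi : Infinitesimal G o) {v : E} (hv : inner ℝ (o : E) v = 0) :
    R.ev (R.sec v) = v := by
  obtain ⟨A, hA, rfl⟩ := hi.surj v hv
  obtain ⟨X, hX⟩ := R.exists_ev_eq hA
  rw [← hX, sec_ev]

lemma inv_apply_base {g : E ≃ₗᵢ[ℝ] E} (hgo : g o = o) : g.symm o = o := by
  rw [← hgo, g.symm_apply_apply, hgo]

/-- `Ad(g) X` sends `o` to `g (X o)` because `g` fixes `o`. For the converse, `Ad(g) X` lies in `𝔪`,
where evaluation at `o` is injective. -/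
lemma isAd_iff {g : E ≃ₗᵢ[ℝ] E} (hg : g ∈ G) (hgo : g o = o) (X Y : R.𝔪) :
    IsAd g (X : lieAlg G) (Y : lieAlg G) ↔ R.ev Y = g (R.ev X) := by
  have key : ∀ Z : R.𝔪, IsAd g (X : lieAlg G) (Z : lieAlg G) → R.ev Z = g (R.ev X) := by
    intro Z hZ
    rw [ev_apply, hZ]
    change g ((X : lieAlg G).1 (g.symm o)) = _
    rw [inv_apply_base hgo]
    rfl
  refine ⟨key Y, fun h => ?_⟩
  let Z : lieAlg G := ⟨toOp g * (X : lieAlg G).1 * toOp g⁻¹, ?_⟩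
  · have hZ : IsAd g (X : lieAlg G) Z := rfl
    have hZm := R.ad_mem g hg hgo X X.2 Z hZ
    have : Y = ⟨Z, hZm⟩ := R.ev_injective (h.trans (key ⟨Z, hZm⟩ hZ).symm)
    rw [this]
    exact hZ
  · exact conj_mem_lieAlg hg (X : lieAlg G).2
  
/-- Passing to the `𝔪`-component changes the bracket by an element of `𝔨`, which kills `o`. -/
lemma ev_bracket (X Y : R.𝔪) : R.ev (R.bracket X Y)
    = (X : lieAlg G).1 (R.ev Y) - (Y : lieAlg G).1 (R.ev X) := by
  have h : ((R.bracket X Y : R.𝔪) : lieAlg G) - ⁅(X : lieAlg G), (Y : lieAlg G)⁆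
      ∈ isotropyAlg G o := by
    rw [← Submodule.projectionOnto_apply_eq_zero_iff R.isCompl, map_sub,
      Submodule.projectionOnto_apply_left, bracket, sub_self]
  have h1 : (R.bracket X Y : lieAlg G).1 o
    - (⁅(X : lieAlg G), (Y : lieAlg G)⁆ : lieAlg G).1 o = 0 := h
  rw [ev_apply, sub_eq_zero.1 h1]
  rfl

variable (R) in
/-- The bilinear map `(u, v) ↦ X v` for `X ∈ 𝔪` with `X o = u`, made tangential to the sphere. -/
def secForm : E →ₗ[ℝ] E →ₗ[ℝ] E :=
  LinearMap.mk₂ ℝ (fun u v => (R.sec u : lieAlg G).1 v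
      - (inner ℝ (o : E) ((R.sec u : lieAlg G).1 v) : ℝ) • (o : E))
    (fun u u' v => by
      rw [map_add]
      change ((R.sec u : lieAlg G).1 v + (R.sec u' : lieAlg G).1 v)
        - (inner ℝ (o : E) ((R.sec u : lieAlg G).1 v + (R.sec u' : lieAlg G).1 v) : ℝ) • (o : E) = _
      rw [inner_add_right]; module)
    (fun c u v => by
      rw [map_smul]
      change (c • (R.sec u : lieAlg G).1 v)
        - (inner ℝ (o : E) (c • (R.sec u : lieAlg G).1 v) : ℝ) • (o : E) = _
      rw [inner_smul_right]; module)
    (fun u v v' => by rw [map_add, inner_add_right]; module)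
    (fun c u v => by rw [map_smul, inner_smul_right]; module)

lemma secForm_apply (u v : E) : R.secForm u v = (R.sec u : lieAlg G).1 v
      - (inner ℝ (o : E) ((R.sec u : lieAlg G).1 v) : ℝ) • (o : E) := rfl

lemma inner_secForm (u v : E) : inner ℝ (o : E) (R.secForm u v) = 0 := by
  rw [secForm_apply, inner_sub_right, inner_smul_right, inner_coe_self]; ring

lemma secForm_ev (X : R.𝔪) {v : E} : R.secForm (R.ev X) v
    = (X : lieAlg G).1 v + (inner ℝ (R.ev X) v : ℝ) • (o : E) := by
  have h := inner_lieAlg (X : lieAlg G).2 o v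
  rw [secForm_apply, sec_ev, ev_apply, h]
  module

lemma secForm_map (hi : Infinitesimal G o) {g : E ≃ₗᵢ[ℝ] E} (hg : g ∈ G) (hgo : g o = o) {u : E}
    (hu : inner ℝ (o : E) u = 0) (v : E) : g (R.secForm u v) = R.secForm (g u) (g v) := by
  have hgu : inner ℝ (o : E) (g u) = 0 := by
    rw [← hgo, g.inner_map_map, hu]
  have h : IsAd g (R.sec u : lieAlg G) (R.sec (g u) : lieAlg G) := by
    rw [isAd_iff hg hgo, ev_sec hi hu, ev_sec hi hgu]
  have h1 : (R.sec (g u) : lieAlg G).1 (g v) = g ((R.sec u : lieAlg G).1 v) := by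
    rw [h]
    exact congrArg (fun y => g ((R.sec u : lieAlg G).1 y)) (g.symm_apply_apply v)
  rw [secForm_apply, secForm_apply, h1, map_sub, map_smul, hgo]
  congr 2
  conv_rhs => rw [← hgo, g.inner_map_map]

/-- The form is isotropy-invariant because `Ad` acts on `𝔪` as on the tangent space. If `κ` were
zero, each `X ∈ 𝔪` would map tangent vectors `v` to `-⟨X o, v⟩ o`, as an infinitesimal transvection
does, against `not_flat`. -/
lemma exists_secForm_eq (h : Classified T G o) (hi : Infinitesimal G o) :
    ∃ κ : ι → ℝ, κ ≠ 0 ∧ ∀ u v, inner ℝ (o : E) u = 0 → inner ℝ (o : E) v = 0 →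
      R.secForm u v = ∑ i, κ i • T i o u v := by
  obtain ⟨κ, hκ⟩ := h.classify R.secForm inner_secForm
    (fun g hg hgo u v hu _ => secForm_map hi hg hgo hu v)
  refine ⟨κ, ?_, hκ⟩
  rintro rfl
  obtain ⟨u, hu, hf⟩ := hi.not_flat
  obtain ⟨w, hw, hne⟩ := hf _ (R.sec u : lieAlg G).2 (ev_sec hi hu)
  apply hne
  have h1 := hκ u w hu hw
  rw [← ev_sec (R := R) hi hu, secForm_ev, ev_sec hi hu] at h1
  simpa [add_eq_zero_iff_eq_neg] using h1

lemma ev_bracket_eq_secForm (X Y : R.𝔪) :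
    R.ev (R.bracket X Y) = R.secForm (R.ev X) (R.ev Y) - R.secForm (R.ev Y) (R.ev X) := by
  rw [ev_bracket, secForm_ev, secForm_ev, real_inner_comm]
  abel

/-- The bracket is the skew part of `secForm` up to normalization; since the `T i` are already skew,
the two terms agree and give the factor `2`. -/
lemma ev_bracket_eq_sum (h : Classified T G o) {κ : ι → ℝ}
    (hκ : ∀ u v, inner ℝ (o : E) u = 0 → inner ℝ (o : E) v = 0 →
      R.secForm u v = ∑ i, κ i • T i o u v) (X Y : R.𝔪) :
    R.ev (R.bracket X Y) = (2 : ℝ) • ∑ i, κ i • T i o (R.ev X) (R.ev Y) := by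
  have hX := R.inner_ev X
  have hY := R.inner_ev Y
  rw [ev_bracket_eq_secForm, hκ _ _ hX hY, hκ _ _ hY hX]
  simp_rw [h.antisymm _ (R.ev Y) (R.ev X) hY hX, smul_neg, Finset.sum_neg_distrib]
  module

/-- The fundamental vector field of an element of the Lie algebra. -/
def fundamental (A : lieAlg G) : VF (𝓡 n) (Sph E) :=
  mkVF (fun x => A.1 (x : E)) (A.1.contMDiff.comp contMDiff_coe_sphere) fun x => by
    have h := inner_lieAlg A.2 x x
    rw [real_inner_comm] at h
    linarith

lemma hat_fundamental (A : lieAlg G) :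
    hat (fundamental A : VF (𝓡 n) (Sph E)) = fun x : Sph E => A.1 (x : E) := by
  rw [fundamental, hat_mkVF]

lemma isFundamental_iff (A : lieAlg G) (ξ : VF (𝓡 n) (Sph E)) :
    IsFundamental A.1 ξ ↔ ξ = fundamental A := by
  constructor
  · intro h
    refine eq_of_hat_eq fun x => ?_
    rw [hat_fundamental]
    exact h x
  · rintro rfl x
    rw [mvfderiv_coe, hat_fundamental]

lemma mvfderiv_hat_fundamental (A : lieAlg G) (X : VF (𝓡 n) (Sph E)) (x : Sph E) :
    mvfderiv (𝓡 n) (hat (fundamental A : VF (𝓡 n) (Sph E))) x (X x) = A.1 (hat X x) := by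
  rw [hat_fundamental]
  exact mvfderiv_clm_comp A.1 (mdifferentiableAt_coe_sphere x) _

/-- For a left action `A ↦ A*` reverses brackets: the result is `-[A, B]` applied to the point. -/
lemma mvfderiv_coe_mlieBracket (A B : lieAlg G) (x : Sph E) :
    mvfderiv (𝓡 n) (Subtype.val : Sph E → E) x
      (VectorField.mlieBracket (𝓡 n) (fun x => (fundamental A : VF (𝓡 n) (Sph E)) x)
        (fun x => (fundamental B : VF (𝓡 n) (Sph E)) x) x) = B.1 (A.1 x) - A.1 (B.1 x) := by
  have h := mvfderiv_mlieBracket (V := EuclideanSpace ℝ (Fin n)) (contMDiff_coe_sphere (n := n) (E := E))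
    (fundamental A) (fundamental B) x (contMDiff_hat _) (contMDiff_hat _)
  refine h.trans ?_
  refine (congrArg₂ (· - ·) (mvfderiv_hat_fundamental B (fundamental A) x)
    (mvfderiv_hat_fundamental A (fundamental B) x)).trans ?_
  rw [hat_fundamental, hat_fundamental]

/-- The Nomizu map of an invariant connection. -/
lemma hasNomizuMap_conn_iff {κ : ι → ℝ}
    (hκ : ∀ u v, inner ℝ (o : E) u = 0 → inner ℝ (o : E) v = 0 →
      R.secForm u v = ∑ i, κ i • T i o u v) (c : ι → ℝ) (Λ : R.𝔪 → R.𝔪 → R.𝔪) :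
    R.HasNomizuMap (conn T c) Λ ↔
      ∀ X Y, ∑ i, (κ + c) i • T i o (R.ev X) (R.ev Y) = R.ev (Λ X Y) := by
  have key : ∀ X Y : R.𝔪, mvfderiv (𝓡 n) (Subtype.val : Sph E → E) o
      (conn T c (fundamental (X : lieAlg G)) (fundamental (Y : lieAlg G)) o
        - VectorField.mlieBracket (𝓡 n)
          (fun x => (fundamental (X : lieAlg G) : VF (𝓡 n) (Sph E)) x)
          (fun x => (fundamental (Y : lieAlg G) : VF (𝓡 n) (Sph E)) x) o)
      = ∑ i, (κ + c) i • T i o (R.ev X) (R.ev Y) := by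
    intro X Y
    rw [map_sub, mvfderiv_coe_mlieBracket, mvfderiv_coe, hat_conn, hat_levi,
      mvfderiv_hat_fundamental, hat_fundamental, hat_fundamental]
    simp only [Pi.add_apply, add_smul, Finset.sum_add_distrib]
    -- The derivative of `Y*` gives `Y X o`, and subtracting the bracket `Y X o - X Y o` leaves `X Y
    -- o`. With the normal term of `levi` this is exactly `secForm`.
    rw [← hκ _ _ (R.inner_ev X) (R.inner_ev Y), secForm_ev]
    simp only [ev_apply]
    abel
  constructor
  · intro h X Y
    have h1 := h X Y (fundamental _) (fundamental _) (fundamental _) ((isFundamental_iff _ _).2 rfl)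
      ((isFundamental_iff _ _).2 rfl) ((isFundamental_iff _ _).2 rfl)
    rw [← key, h1, mvfderiv_coe, hat_fundamental, ev_apply]
  · intro h X Y ξ υ ζ hξ hυ hζ
    rw [isFundamental_iff] at hξ hυ hζ
    subst hξ hυ hζ
    apply injective_mvfderiv_subtypeVal_sphere o
    rw [key, h, mvfderiv_coe, hat_fundamental, ev_apply]

/-- By independence of the tensors, `conn T c` has Nomizu map `Λ α` exactly when `c = γ α`; every
invariant connection is some `conn T c`, so both uniqueness claims reduce to bijectivity of `γ`. -/
lemma existsUnique_of_bijective (h : Classified T G o) (hi : Infinitesimal G o) {κ : ι → ℝ}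
    (hκ : ∀ u v, inner ℝ (o : E) u = 0 → inner ℝ (o : E) v = 0 →
      R.secForm u v = ∑ i, κ i • T i o u v)
    {P : Type*} (γ : P → ι → ℝ) (hγ : Function.Bijective γ) (Λ : P → R.𝔪 → R.𝔪 → R.𝔪)
    (hΛ : ∀ α X Y, R.ev (Λ α X Y) = ∑ i, (κ + γ α) i • T i o (R.ev X) (R.ev Y)) :
    (∀ α, ∃! D : Operator (𝓡 n) (Sph E), D ∈ (invariantConnections (sphereMaps G) :
      AffineSubspace ℝ (Operator (𝓡 n) (Sph E))) ∧ R.HasNomizuMap D (Λ α)) ∧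
    (∀ D ∈ (invariantConnections (sphereMaps G) : AffineSubspace ℝ (Operator (𝓡 n) (Sph E))),
      ∃! α, R.HasNomizuMap D (Λ α)) := by
  have key : ∀ c α, R.HasNomizuMap (conn T c) (Λ α) ↔ c = γ α := by
    intro c α
    rw [hasNomizuMap_conn_iff hκ]
    constructor
    · intro hc
      rw [← sub_eq_zero]
      refine h.independent _ fun u v hu hv => ?_
      have h1 := hc (R.sec u) (R.sec v)
      rw [hΛ, ev_sec hi hu, ev_sec hi hv, ← sub_eq_zero, ← Finset.sum_sub_distrib] at h1
      rw [← h1]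
      refine Finset.sum_congr rfl fun i _ => ?_
      simp only [Pi.add_apply, Pi.sub_apply]
      module
    · rintro rfl X Y
      rw [hΛ]
  constructor
  · intro α
    refine ⟨conn T (γ α), ⟨h.conn_mem _, (key _ _).2 rfl⟩, ?_⟩
    rintro D ⟨hD, hN⟩
    obtain ⟨c, rfl⟩ := h.exists_conn hD
    rw [(key _ _).1 hN]
  · intro D hD
    obtain ⟨c, rfl⟩ := h.exists_conn hD
    obtain ⟨α, rfl⟩ := hγ.surjective c
    exact ⟨α, (key _ _).2 rfl, fun β hβ => (hγ.injective ((key _ _).1 hβ)).symm⟩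

lemma existsUnique_nomizu [Unique ι] (h : Classified T G o) (hi : Infinitesimal G o)
    (R : ReductiveDecomposition G o) :
    (∀ α : ℝ, ∃! D : Operator (𝓡 n) (Sph E), D ∈ (invariantConnections (sphereMaps G) :
      AffineSubspace ℝ (Operator (𝓡 n) (Sph E))) ∧ R.HasNomizuMap D (R.nomizu α)) ∧
    (∀ D ∈ (invariantConnections (sphereMaps G) : AffineSubspace ℝ (Operator (𝓡 n) (Sph E))),
      ∃! α : ℝ, R.HasNomizuMap D (R.nomizu α)) := by
  obtain ⟨κ, hne, hκ⟩ := exists_secForm_eq (R := R) h hi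
  have hne' : κ default ≠ 0 := fun h0 => hne (by
    funext i
    rw [Unique.eq_default i, h0]
    rfl)
  -- Solve `((1 - α) / 2) · 2κ = κ + c` for `c`.
  refine existsUnique_of_bijective h hi hκ (fun α : ℝ => -(α • κ)) ⟨fun α β hαβ => ?_, fun c => ?_⟩
    R.nomizu fun α X Y => ?_
  · have := congrFun hαβ default
    simpa [hne'] using this
  · refine ⟨-(c default / κ default), ?_⟩
    funext i
    rw [Unique.eq_default i]
    simp [hne']
  · rw [nomizu, map_smul, ev_bracket_eq_sum h hκ]
    simp only [Fintype.sum_unique, Pi.add_apply, Pi.neg_apply, Pi.smul_apply, smul_eq_mul]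
    module

variable {S : R.ComplexStructure}

variable (R S) in
/-- The complex structure on `𝔪`, transported to the ambient space. -/
def evJ : E →ₗ[ℝ] E := R.ev ∘ₗ S.J ∘ₗ R.sec

lemma evJ_ev (X : R.𝔪) : R.evJ S (R.ev X) = R.ev (S.J X) := by simp [evJ]

lemma evJ_map (hi : Infinitesimal G o) {g : E ≃ₗᵢ[ℝ] E} (hg : g ∈ G) (hgo : g o = o) {u : E}
    (hu : inner ℝ (o : E) u = 0) : g (R.evJ S u) = R.evJ S (g u) := by
  have hgu : inner ℝ (o : E) (g u) = 0 := by
    rw [← hgo, g.inner_map_map, hu]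
  have h : IsAd g (R.sec u : lieAlg G) (R.sec (g u) : lieAlg G) := by
    rw [isAd_iff hg hgo, ev_sec hi hu, ev_sec hi hgu]
  exact ((isAd_iff hg hgo _ _).1 (S.equivariant g hg hgo _ _ h)).symm

/-- An invariant `J` composed with an invariant tensor is again invariant, so the classification
applies to it. -/
lemma exists_evJ_sum_eq (h : Classified T G o) (hi : Infinitesimal G o) (κ : ι → ℝ) :
    ∃ κ' : ι → ℝ, ∀ u v, inner ℝ (o : E) u = 0 → inner ℝ (o : E) v = 0 →
      R.evJ S (∑ i, κ i • T i o u v) = ∑ i, κ' i • T i o u v := by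
  have heq : ∀ g ∈ G, g o = o → ∀ u v, inner ℝ (o : E) u = 0 → inner ℝ (o : E) v = 0 →
      g ((∑ i, κ i • T i o).compr₂ (R.evJ S) u v)
        = (∑ i, κ i • T i o).compr₂ (R.evJ S) (g u) (g v) := by
    intro g hg hgo u v _ _
    have h1 : inner ℝ (o : E) ((∑ i, κ i • T i o) u v) = 0 := by
      simp [inner_sum, inner_smul_right, (T _).tangent]
    rw [LinearMap.compr₂_apply, LinearMap.compr₂_apply, evJ_map hi hg hgo h1]
    congr 1
    have h2 := fun i => h.equivariant i g hg o u v
    rw [show sphereMap g o = o from Subtype.ext hgo] at h2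
    simp [h2]
  obtain ⟨κ', hκ'⟩ := h.classify _ (fun u v => R.inner_ev _) heq
  refine ⟨κ', fun u v hu hv => ?_⟩
  rw [← hκ' u v hu hv]
  simp

/-- With `κ'` the coefficients of `J` applied to `∑ κ i • T i`, the equation for `c` now reads `c =
-(Re α · κ + Im α · κ')`. No explicit form of `J` is used, only `J² = -1`. -/
lemma existsUnique_nomizuC (e : ι ≃ Fin 2) (h : Classified T G o) (hi : Infinitesimal G o)
    (R : ReductiveDecomposition G o) (S : R.ComplexStructure) :
    (∀ α : ℂ, ∃! D : Operator (𝓡 n) (Sph E), D ∈ (invariantConnections (sphereMaps G) :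
      AffineSubspace ℝ (Operator (𝓡 n) (Sph E))) ∧ R.HasNomizuMap D (R.nomizuC S α)) ∧
    (∀ D ∈ (invariantConnections (sphereMaps G) : AffineSubspace ℝ (Operator (𝓡 n) (Sph E))),
      ∃! α : ℂ, R.HasNomizuMap D (R.nomizuC S α)) := by
  obtain ⟨κ, hne, hκ⟩ := exists_secForm_eq (R := R) h hi
  obtain ⟨κ', hκ'⟩ := exists_evJ_sum_eq (S := S) h hi κ
  let γ : ℂ →ₗ[ℝ] ι → ℝ :=
    -(Complex.reLm.smulRight κ + Complex.imLm.smulRight κ')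
  have hγ : ∀ α : ℂ, γ α = -(α.re • κ + α.im • κ') := fun α => rfl
  have hJJ : ∀ u v, inner ℝ (o : E) u = 0 → inner ℝ (o : E) v = 0 →
      R.evJ S (∑ i, κ' i • T i o u v) = -∑ i, κ i • T i o u v := by
    intro u v hu hv
    rw [← hκ' u v hu hv, ← hκ u v hu hv, ← ev_sec (R := R) hi (inner_secForm u v), evJ_ev, evJ_ev,
      S.sq, map_neg]
  have hinj : Function.Injective γ := by
    rw [← LinearMap.ker_eq_bot, LinearMap.ker_eq_bot']
    intro α hα
    rw [hγ, neg_eq_zero] at hα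
    have h1 : ∀ u v, inner ℝ (o : E) u = 0 → inner ℝ (o : E) v = 0 →
        α.re • ∑ i, κ i • T i o u v + α.im • ∑ i, κ' i • T i o u v = 0 := by
      intro u v _ _
      rw [Finset.smul_sum, Finset.smul_sum, ← Finset.sum_add_distrib]
      refine Finset.sum_eq_zero fun i _ => ?_
      have := congrFun hα i
      simp only [Pi.add_apply, Pi.smul_apply, smul_eq_mul, Pi.zero_apply] at this
      rw [smul_smul, smul_smul, ← add_smul, this, zero_smul]
    have h2 : (α.re ^ 2 + α.im ^ 2) • κ = 0 := by
      refine h.independent _ fun u v hu hv => ?_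
      have h3 := h1 u v hu hv
      have h4 := congrArg (R.evJ S) h3
      rw [map_add, map_smul, map_smul, hJJ u v hu hv, hκ' u v hu hv, map_zero] at h4
      -- The relation and its image under `J` together eliminate `κ'`.
      have h5 : (α.re ^ 2 + α.im ^ 2) • ∑ i, κ i • T i o u v = 0 := by
        linear_combination (norm := module) α.re • h3 - α.im • h4
      rw [← h5, Finset.smul_sum]
      simp [smul_smul]
    have h6 := (smul_eq_zero.1 h2).resolve_right hne
    apply Complex.ext
    · exact pow_eq_zero_iff two_ne_zero |>.1 (by nlinarith [sq_nonneg α.re, sq_nonneg α.im])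
    · exact pow_eq_zero_iff two_ne_zero |>.1 (by nlinarith [sq_nonneg α.re, sq_nonneg α.im])
  have hbij : Function.Bijective γ := by
    -- Both `ℂ` and the coefficient space have real dimension two.
    refine ⟨hinj, (LinearMap.injective_iff_surjective_of_finrank_eq_finrank ?_).1 hinj⟩
    rw [Complex.finrank_real_complex, Module.finrank_pi, Fintype.card_congr e, Fintype.card_fin]
  refine existsUnique_of_bijective h hi hκ γ hbij (R.nomizuC S) fun α X Y => ?_
  have hX := R.inner_ev X
  have hY := R.inner_ev Y
  rw [nomizuC, ComplexStructure.csmul, map_add, map_smul, map_smul, ← evJ_ev,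
    ev_bracket_eq_sum h hκ, map_smul, hκ' _ _ hX hY]
  simp only [hγ, Pi.add_apply, Pi.neg_apply, Pi.smul_apply, smul_eq_mul, Finset.smul_sum,
    ← Finset.sum_add_distrib]
  refine Finset.sum_congr rfl fun i _ => ?_
  have h1 : ((1 - α) / 2).re = (1 - α.re) / 2 := by simp
  have h2 : ((1 - α) / 2).im = -α.im / 2 := by simp
  rw [h1, h2]
  module

lemma nonempty_complexStructure (hi : Infinitesimal G o) (R : ReductiveDecomposition G o)
    (j : E →ₗ[ℝ] E) (hj : ∀ u, inner ℝ (o : E) u = 0 → inner ℝ (o : E) (j u) = 0)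
    (hjj : ∀ u, inner ℝ (o : E) u = 0 → j (j u) = -u)
    (hg : ∀ g ∈ G, g o = o → ∀ u, inner ℝ (o : E) u = 0 → g (j u) = j (g u)) :
    Nonempty R.ComplexStructure := by
  have hev : ∀ X, R.ev (R.sec (j (R.ev X))) = j (R.ev X) := fun X =>
    ev_sec hi (hj _ (R.inner_ev X))
  refine ⟨⟨R.sec ∘ₗ j ∘ₗ R.ev, fun X => ?_, fun g hgG hgo X Y hXY => ?_⟩⟩
  · apply R.ev_injective
    simp only [LinearMap.comp_apply]
    rw [ev_sec hi, hev, hjj _ (R.inner_ev X), map_neg]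
    rw [hev]
    exact hj _ (hj _ (R.inner_ev X))
  · rw [isAd_iff hgG hgo] at hXY ⊢
    simp only [LinearMap.comp_apply]
    rw [hev, hev, hXY, hg g hgG hgo _ (R.inner_ev X)]

end ReductiveDecomposition

end Nomizu

end InvConn
end

noncomputable section
namespace InvConn

namespace Oct

local notation:70 x:70 " ⋆ " y:71 => mul x y

/-! ### Octonion algebra: alternativity, conjugation and Moufang identities. -/

section Algebra

lemma ext_components {x y : Oct} (h₁ : x.fst.re = y.fst.re) (h₂ : x.fst.imI = y.fst.imI)
    (h₃ : x.fst.imJ = y.fst.imJ) (h₄ : x.fst.imK = y.fst.imK) (h₅ : x.snd.re = y.snd.re)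
    (h₆ : x.snd.imI = y.snd.imI) (h₇ : x.snd.imJ = y.snd.imJ) (h₈ : x.snd.imK = y.snd.imK) :
    x = y :=
  Oct.ext (QuaternionAlgebra.ext h₁ h₂ h₃ h₄) (QuaternionAlgebra.ext h₅ h₆ h₇ h₈)

lemma fst_mul (x y : Oct) : (x ⋆ y).fst = x.fst * y.fst - star y.snd * x.snd := rfl

lemma snd_mul (x y : Oct) : (x ⋆ y).snd = y.snd * x.fst + x.snd * star y.fst := rfl

lemma fst_one : one.fst = 1 := rfl

lemma snd_one : one.snd = 0 := rfl

lemma inner_eq (x y : Oct) : inner ℝ x y = x.fst.re * y.fst.re + x.fst.imI * y.fst.imI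
    + x.fst.imJ * y.fst.imJ + x.fst.imK * y.fst.imK + x.snd.re * y.snd.re
    + x.snd.imI * y.snd.imI + x.snd.imJ * y.snd.imJ + x.snd.imK * y.snd.imK := by
  rw [WithLp.prod_inner_apply, Quaternion.inner_def, Quaternion.inner_def]
  simp
  ring

lemma one_mul (x : Oct) : one ⋆ x = x := by
  apply Oct.ext <;> simp [fst_mul, snd_mul, fst_one, snd_one]

lemma mul_one (x : Oct) : x ⋆ one = x := by
  apply Oct.ext <;> simp [fst_mul, snd_mul, fst_one, snd_one]

/-- Verified in the eight real coordinates. The flexible and Moufang laws below are derived from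
this and `mul_same_mul` by linearization, without coordinates. -/
lemma mul_mul_same (x y : Oct) : x ⋆ (x ⋆ y) = (x ⋆ x) ⋆ y := by
  apply ext_components <;> simp [fst_mul, snd_mul] <;> ring

lemma mul_same_mul (x y : Oct) : (y ⋆ x) ⋆ x = y ⋆ (x ⋆ x) := by
  apply ext_components <;> simp [fst_mul, snd_mul] <;> ring

/-- Octonionic conjugation. -/
def conj : Oct →ₗ[ℝ] Oct :=
  (2 : ℝ) • (innerₗ Oct one).smulRight one - LinearMap.id

lemma conj_apply (x : Oct) : conj x = (2 * inner ℝ one x : ℝ) • one - x := by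
  simp [conj, smul_smul]

lemma conj_mul (x y : Oct) : conj (x ⋆ y) = conj y ⋆ conj x := by
  simp only [conj_apply, inner_eq]
  apply ext_components <;> simp [fst_mul, snd_mul, fst_one, snd_one] <;> ring

lemma inner_mul_left (x y z : Oct) : inner ℝ (x ⋆ y) z = (inner ℝ y (conj x ⋆ z) : ℝ) := by
  simp only [conj_apply, inner_eq]
  simp [fst_mul, snd_mul, fst_one, snd_one]
  ring

lemma inner_mul_right (x y z : Oct) : inner ℝ (x ⋆ y) z = (inner ℝ x (z ⋆ conj y) : ℝ) := by
  simp only [conj_apply, inner_eq]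
  simp [fst_mul, snd_mul, fst_one, snd_one]
  ring

lemma mul_conj (x : Oct) : x ⋆ conj x = (inner ℝ x x : ℝ) • one := by
  simp only [conj_apply, inner_eq]
  apply ext_components <;> simp [fst_mul, snd_mul, fst_one, snd_one] <;> ring

lemma conj_one : conj one = one := by
  rw [conj_apply, real_inner_self_eq_norm_sq, norm_one]
  module

lemma conj_of_inner {a : Oct} (ha : inner ℝ one a = 0) : conj a = -a := by
  rw [conj_apply, ha]
  simp

lemma conj_conj (x : Oct) : conj (conj x) = x := by
  rw [conj_apply, conj_apply, inner_sub_right, inner_smul_right, real_inner_self_eq_norm_sq,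
    norm_one]
  module

lemma inner_mul_of_inner {a : Oct} (ha : inner ℝ one a = 0) (x y : Oct) :
    inner ℝ (a ⋆ x) y = -(inner ℝ x (a ⋆ y) : ℝ) := by
  rw [inner_mul_left, conj_of_inner ha, map_neg, LinearMap.neg_apply, inner_neg_right]

lemma inner_mul_of_inner_right {a : Oct} (ha : inner ℝ one a = 0) (x y : Oct) :
    inner ℝ (x ⋆ a) y = -(inner ℝ x (y ⋆ a) : ℝ) := by
  rw [inner_mul_right, conj_of_inner ha, map_neg, inner_neg_right]

/-- The left alternative law, linearized. -/
lemma mul_mul_add (a b x : Oct) : a ⋆ (b ⋆ x) + b ⋆ (a ⋆ x) = (a ⋆ b) ⋆ x + (b ⋆ a) ⋆ x := by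
  have h := mul_mul_same (a + b) x
  simp only [map_add, LinearMap.add_apply, mul_mul_same a, mul_mul_same b] at h
  linear_combination (norm := module) h

/-- The right alternative law, linearized. -/
lemma add_mul_mul (a b x : Oct) : (x ⋆ a) ⋆ b + (x ⋆ b) ⋆ a = x ⋆ (a ⋆ b) + x ⋆ (b ⋆ a) := by
  have h := mul_same_mul (a + b) x
  simp only [map_add, LinearMap.add_apply, mul_same_mul a, mul_same_mul b] at h
  linear_combination (norm := module) h

/-- For imaginary `a`, `b` the conjugate of `a b` is `b a`, so their sum is twice the real part of
`a b`. -/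
lemma mul_add_mul {a b : Oct} (ha : inner ℝ one a = 0) (hb : inner ℝ one b = 0) :
    a ⋆ b + b ⋆ a = (-(2 * inner ℝ a b) : ℝ) • one := by
  have h1 := conj_mul a b
  rw [conj_of_inner ha, conj_of_inner hb, map_neg, map_neg, LinearMap.neg_apply, neg_neg,
    conj_apply, real_inner_comm, inner_mul_of_inner ha, mul_one, real_inner_comm] at h1
  rw [← h1]
  module

lemma mul_mul_of_inner {a b : Oct} (ha : inner ℝ one a = 0) (hb : inner ℝ one b = 0) (x : Oct) :
    a ⋆ (b ⋆ x) + b ⋆ (a ⋆ x) = (-(2 * inner ℝ a b) : ℝ) • x := by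
  rw [mul_mul_add, ← LinearMap.add_apply, ← map_add, mul_add_mul ha hb, map_smul,
    LinearMap.smul_apply, one_mul]

lemma mul_mul_self_of_inner {a : Oct} (ha : inner ℝ one a = 0) (x : Oct) :
    a ⋆ (a ⋆ x) = (-(inner ℝ a a) : ℝ) • x := by
  have h := mul_mul_of_inner ha ha x
  rw [← two_smul ℝ, ← mul_neg, ← smul_smul] at h
  exact smul_right_injective Oct (two_ne_zero (α := ℝ)) h

lemma mul_self_of_inner {a : Oct} (ha : inner ℝ one a = 0) :
    a ⋆ a = (-(inner ℝ a a) : ℝ) • one := by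
  have := mul_mul_self_of_inner ha one
  rwa [mul_one] at this

/-- The flexible law. -/
lemma mul_mul_flexible (x y : Oct) : (x ⋆ y) ⋆ x = x ⋆ (y ⋆ x) := by
  have h1 := mul_mul_add x y x
  have h2 := mul_same_mul x y
  linear_combination (norm := module) -h1 - h2

/-- The left Moufang identity. -/
lemma moufang_left (x y z : Oct) : ((x ⋆ y) ⋆ x) ⋆ z = x ⋆ (y ⋆ (x ⋆ z)) := by
  have h1 := mul_mul_add (x ⋆ y) x z
  have h2 := add_mul_mul y (x ⋆ z) x
  have h3 := add_mul_mul y z (x ⋆ x)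
  have h4 := congrArg (mul x) (add_mul_mul y z x)
  simp only [map_add, mul_mul_same x] at h1 h2 h3 h4
  linear_combination (norm := module) h2 - h1 - h3 + h4

/-- The middle Moufang identity. -/
lemma moufang_middle (x y z : Oct) : (x ⋆ y) ⋆ (z ⋆ x) = x ⋆ ((y ⋆ z) ⋆ x) := by
  have h1 := add_mul_mul y (z ⋆ x) x
  have h2 := moufang_left x z y
  have h3 := congrArg (mul x) (add_mul_mul x y z)
  have h4 := congrArg (mul x) (mul_mul_add y z x)
  rw [mul_mul_flexible] at h2
  simp only [map_add] at h3 h4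
  linear_combination (norm := module) h1 - h2 + h3 + h4

end Algebra

/-! ### The triple product preserved by the spin group. -/

section TripleProduct

/-- The triple product `(x ȳ) z`. -/
def triple (x y z : Oct) : Oct := (x ⋆ conj y) ⋆ z

/-- With `p = x ȳ`, the middle Moufang identity and flexibility give `(w x)(ȳ w) = (w p) w`. The
left Moufang identity then yields `((w p) w)(w z) = w (p (w (w z)))`, and `w (w z) = -|w|² z`. -/
lemma triple_mul {w : Oct} (hw : inner ℝ one w = 0) (x y z : Oct) :
    triple (w ⋆ x) (w ⋆ y) (w ⋆ z) = (inner ℝ w w : ℝ) • (w ⋆ triple x y z) := by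
  rw [triple, conj_mul, conj_of_inner hw, map_neg, map_neg, moufang_middle,
    ← mul_mul_flexible, map_neg, LinearMap.neg_apply, moufang_left, mul_mul_self_of_inner hw,
    map_smul, map_smul, triple, neg_smul, neg_neg]

lemma triple_self (x z : Oct) : triple x x z = (inner ℝ x x : ℝ) • z := by
  rw [triple, mul_conj, map_smul, LinearMap.smul_apply, one_mul]

lemma triple_one (x z : Oct) : triple x one z = x ⋆ z := by
  rw [triple, conj_one, mul_one]

end TripleProduct
end Oct
end InvConn
end

noncomputable section
namespace InvConn

namespace Oct

local notation:70 x:70 " ⋆ " y:71 => mul x y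

/-! ### The spin representation and its stabilizer of `1`. -/

section Spin

lemma spinRep_ι (v : Im) (x : Oct) : spinRep (CliffordAlgebra.ι Q v) x = (v : Oct) ⋆ x := by
  rw [spinRep, CliffordAlgebra.lift_ι_apply]
  rfl

lemma inner_one_coe (v : Im) : inner ℝ one (v : Oct) = 0 :=
  Submodule.mem_orthogonal_singleton_iff_inner_right.1 v.2

lemma Q_apply (v : Im) : Q v = -(inner ℝ (v : Oct) (v : Oct) : ℝ) := rfl

/-- The Lipschitz group is generated by invertible vectors, for which this is `triple_mul` with
factor `|v|²`. Factors multiply under products and invert under inverses. -/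
lemma triple_lipschitz {s : (CliffordAlgebra Q)ˣ} (hs : s ∈ lipschitzGroup Q) :
    ∃ r : ℝ, r ≠ 0 ∧ ∀ x y z,
      triple (spinRep s x) (spinRep s y) (spinRep s z) = r • spinRep s (triple x y z) := by
  induction hs using Subgroup.closure_induction with
  | mem s hs =>
    obtain ⟨v, hv⟩ := hs
    refine ⟨inner ℝ (v : Oct) (v : Oct), fun h => ?_, fun x y z => ?_⟩
    · have h0 : v = 0 := Subtype.ext (inner_self_eq_zero.1 h)
      have h1 : spinRep s * spinRep (↑s⁻¹ : CliffordAlgebra Q) = 1 := by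
        rw [← map_mul, Units.mul_inv, map_one]
      rw [← hv, h0, map_zero, map_zero, zero_mul] at h1
      exact zero_ne_one h1
    · rw [← hv]
      simp only [spinRep_ι]
      exact triple_mul (inner_one_coe v) x y z
  | one => exact ⟨1, one_ne_zero, fun x y z => by simp⟩
  | mul s t _ _ hs ht =>
    obtain ⟨r, hr, hs⟩ := hs
    obtain ⟨q, hq, ht⟩ := ht
    refine ⟨r * q, mul_ne_zero hr hq, fun x y z => ?_⟩
    simp only [Units.val_mul, map_mul, Module.End.mul_apply, hs, ht, map_smul, smul_smul]
  | inv s _ hs =>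
    obtain ⟨r, hr, hs⟩ := hs
    refine ⟨r⁻¹, inv_ne_zero hr, fun x y z => ?_⟩
    have h1 : ∀ x, spinRep (s : CliffordAlgebra Q) (spinRep (↑s⁻¹ : CliffordAlgebra Q) x) = x := by
      intro x
      rw [← Module.End.mul_apply, ← map_mul, Units.mul_inv, map_one, Module.End.one_apply]
    have h2 : ∀ x, spinRep (↑s⁻¹ : CliffordAlgebra Q) (spinRep (s : CliffordAlgebra Q) x) = x := by
      intro x
      rw [← Module.End.mul_apply, ← map_mul, Units.inv_mul, map_one, Module.End.one_apply]
    have h3 := hs (spinRep (↑s⁻¹ : CliffordAlgebra Q) x) (spinRep (↑s⁻¹ : CliffordAlgebra Q) y)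
      (spinRep (↑s⁻¹ : CliffordAlgebra Q) z)
    rw [h1, h1, h1] at h3
    rw [h3, map_smul, h2, smul_smul, inv_mul_cancel₀ hr, one_smul]

lemma triple_spin7 {g : Oct ≃ₗᵢ[ℝ] Oct} (hg : g ∈ spin7) (x y z : Oct) :
    triple (g x) (g y) (g z) = g (triple x y z) := by
  obtain ⟨s, hs, hgs⟩ := hg
  obtain ⟨t, ht, rfl⟩ := (spinGroup.mem_pin hs).1
  obtain ⟨r, hr, h⟩ := triple_lipschitz ht
  have hgs' : ∀ x, spinRep (t : CliffordAlgebra Q) x = g x := fun x => (hgs x).symm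
  simp only [hgs'] at h
  -- An isometry forces the factor to be one, as seen from the triple product of `1` with itself.
  have h1 := h one one one
  rw [triple_self, triple_self, g.inner_map_map, real_inner_self_eq_norm_sq, norm_one, map_smul,
    smul_smul] at h1
  have h2 : g one ≠ 0 := by
    rw [← norm_ne_zero_iff, g.norm_map, norm_one]; exact one_ne_zero
  have h3 := smul_left_injective ℝ h2 h1
  have h4 : r = 1 := by norm_num at h3; exact h3.symm
  rw [h, h4, one_smul]

/-- Inserting `1` in the middle slot of the triple product recovers the multiplication; thus the
isotropy group of `1` acts by automorphisms. -/
lemma mul_of_spin7 {g : Oct ≃ₗᵢ[ℝ] Oct} (hg : g ∈ spin7) (h1 : g one = one) (x y : Oct) :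
    g (x ⋆ y) = g x ⋆ g y := by
  have h := triple_spin7 hg x one y
  rw [h1, triple_one, triple_one] at h
  exact h.symm

lemma inner_self_of_norm {u : Im} (hu : ‖u‖ = 1) : inner ℝ (u : Oct) (u : Oct) = (1 : ℝ) := by
  rw [real_inner_self_eq_norm_sq, show ‖(u : Oct)‖ = 1 from hu]
  norm_num

/-- Left multiplication by a unit imaginary octonion. -/
def leftMul (u : Im) (hu : ‖u‖ = 1) : Oct ≃ₗᵢ[ℝ] Oct :=
  LinearIsometry.toLinearIsometryEquiv
    ⟨mul u, fun x => by
      rw [norm_eq_sqrt_real_inner, inner_mul_of_inner (inner_one_coe u),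
        mul_mul_self_of_inner (inner_one_coe u), inner_smul_right, inner_self_of_norm hu,
        norm_eq_sqrt_real_inner x]
      norm_num⟩ rfl

lemma ι_mem_pinGroup (u : Im) (hu : ‖u‖ = 1) : CliffordAlgebra.ι Q u ∈ pinGroup Q := by
  have h : CliffordAlgebra.ι Q u * CliffordAlgebra.ι Q u = -1 := by
    rw [CliffordAlgebra.ι_sq_scalar, Q_apply, inner_self_of_norm hu]
    simp
  rw [pinGroup.mem_iff]
  refine ⟨⟨⟨CliffordAlgebra.ι Q u, -CliffordAlgebra.ι Q u, ?_, ?_⟩, ?_, rfl⟩, ?_⟩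
  · rw [mul_neg, h, neg_neg]
  · rw [neg_mul, h, neg_neg]
  · exact Subgroup.subset_closure ⟨u, rfl⟩
  · rw [Unitary.mem_iff, CliffordAlgebra.star_ι, neg_mul, mul_neg, h, neg_neg]
    exact ⟨rfl, rfl⟩

lemma leftMul_mul_leftMul_mem (u v : Im) (hu : ‖u‖ = 1) (hv : ‖v‖ = 1) :
    leftMul u hu * leftMul v hv ∈ spin7 := by
  refine ⟨CliffordAlgebra.ι Q u * CliffordAlgebra.ι Q v, ⟨mul_mem (ι_mem_pinGroup u hu)
    (ι_mem_pinGroup v hv), CliffordAlgebra.ι_mul_ι_mem_evenOdd_zero Q u v⟩, fun x => ?_⟩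
  rw [map_mul, Module.End.mul_apply, spinRep_ι, spinRep_ι]
  rfl

/-- An octonion from its components. -/
def mk (a b c d e f g h : ℝ) : Oct := WithLp.toLp 2 (⟨a, b, c, d⟩, ⟨e, f, g, h⟩)

@[simp] lemma re_fst_mk (a b c d e f g h : ℝ) : (mk a b c d e f g h).fst.re = a := rfl

@[simp] lemma imI_fst_mk (a b c d e f g h : ℝ) : (mk a b c d e f g h).fst.imI = b := rfl

@[simp] lemma imJ_fst_mk (a b c d e f g h : ℝ) : (mk a b c d e f g h).fst.imJ = c := rfl

@[simp] lemma imK_fst_mk (a b c d e f g h : ℝ) : (mk a b c d e f g h).fst.imK = d := rfl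

@[simp] lemma re_snd_mk (a b c d e f g h : ℝ) : (mk a b c d e f g h).snd.re = e := rfl

@[simp] lemma imI_snd_mk (a b c d e f g h : ℝ) : (mk a b c d e f g h).snd.imI = f := rfl

@[simp] lemma imJ_snd_mk (a b c d e f g h : ℝ) : (mk a b c d e f g h).snd.imJ = g := rfl

@[simp] lemma imK_snd_mk (a b c d e f g h : ℝ) : (mk a b c d e f g h).snd.imK = h := rfl

/-- An imaginary octonion from its components. -/
def mkIm (b c d e f g h : ℝ) : Im :=
  ⟨mk 0 b c d e f g h, Submodule.mem_orthogonal_singleton_iff_inner_right.2 (by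
    rw [inner_eq]; simp [fst_one, snd_one])⟩

lemma norm_mkIm {b c d e f g h : ℝ}
    (h1 : b * b + c * c + d * d + e * e + f * f + g * g + h * h = 1) :
    ‖mkIm b c d e f g h‖ = 1 := by
  change ‖mk 0 b c d e f g h‖ = 1
  rw [norm_eq_sqrt_real_inner, inner_eq, Real.sqrt_eq_one]
  simpa using h1

lemma mk_mul_mk (a₀ a₁ a₂ a₃ b₀ b₁ b₂ b₃ c₀ c₁ c₂ c₃ d₀ d₁ d₂ d₃ : ℝ) :
    mk a₀ a₁ a₂ a₃ b₀ b₁ b₂ b₃ ⋆ mk c₀ c₁ c₂ c₃ d₀ d₁ d₂ d₃ = mk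
      (a₀ * c₀ - a₁ * c₁ - a₂ * c₂ - a₃ * c₃ - d₀ * b₀ - d₁ * b₁ - d₂ * b₂ - d₃ * b₃)
      (a₀ * c₁ + a₁ * c₀ + a₂ * c₃ - a₃ * c₂ - d₀ * b₁ + d₁ * b₀ + d₂ * b₃ - d₃ * b₂)
      (a₀ * c₂ - a₁ * c₃ + a₂ * c₀ + a₃ * c₁ - d₀ * b₂ - d₁ * b₃ + d₂ * b₀ + d₃ * b₁)
      (a₀ * c₃ + a₁ * c₂ - a₂ * c₁ + a₃ * c₀ - d₀ * b₃ + d₁ * b₂ - d₂ * b₁ + d₃ * b₀)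
      (d₀ * a₀ - d₁ * a₁ - d₂ * a₂ - d₃ * a₃ + b₀ * c₀ + b₁ * c₁ + b₂ * c₂ + b₃ * c₃)
      (d₀ * a₁ + d₁ * a₀ + d₂ * a₃ - d₃ * a₂ - b₀ * c₁ + b₁ * c₀ - b₂ * c₃ + b₃ * c₂)
      (d₀ * a₂ - d₁ * a₃ + d₂ * a₀ + d₃ * a₁ - b₀ * c₂ + b₁ * c₃ + b₂ * c₀ - b₃ * c₁)
      (d₀ * a₃ + d₁ * a₂ - d₂ * a₁ + d₃ * a₀ - b₀ * c₃ - b₁ * c₂ + b₂ * c₁ + b₃ * c₀) := by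
  apply ext_components <;> simp [fst_mul, snd_mul] <;> ring

lemma eq_mk (x : Oct) : x = mk x.fst.re x.fst.imI x.fst.imJ x.fst.imK
    x.snd.re x.snd.imI x.snd.imJ x.snd.imK := rfl

/-- The product of the seven basis vectors is central in the Clifford algebra and acts on `𝕆` by a
scalar, here `-1`. This makes odd products of vectors available in `Spin(7)` up to sign. -/
lemma volume_mul (x : Oct) :
    mk 0 1 0 0 0 0 0 0 ⋆ (mk 0 0 1 0 0 0 0 0 ⋆ (mk 0 0 0 1 0 0 0 0 ⋆ (mk 0 0 0 0 1 0 0 0 ⋆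
      (mk 0 0 0 0 0 1 0 0 ⋆ (mk 0 0 0 0 0 0 1 0 ⋆ (mk 0 0 0 0 0 0 0 1 ⋆ x)))))) = -x := by
  rw [eq_mk x]
  simp only [mk_mul_mk]
  apply ext_components <;> simp

lemma neg_leftMul_mem (u : Im) (hu : ‖u‖ = 1) :
    ∃ g ∈ spin7, ∀ x, g x = -((u : Oct) ⋆ x) := by
  -- Eight vectors, `u` and the seven basis vectors, form an even product acting as `u` followed by
  -- the sign from `volume_mul`.
  refine ⟨_, mul_mem (mul_mem (mul_mem
    (leftMul_mul_leftMul_mem u (mkIm 1 0 0 0 0 0 0) hu (norm_mkIm (by norm_num)))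
    (leftMul_mul_leftMul_mem (mkIm 0 1 0 0 0 0 0) (mkIm 0 0 1 0 0 0 0)
      (norm_mkIm (by norm_num)) (norm_mkIm (by norm_num))))
    (leftMul_mul_leftMul_mem (mkIm 0 0 0 1 0 0 0) (mkIm 0 0 0 0 1 0 0)
      (norm_mkIm (by norm_num)) (norm_mkIm (by norm_num))))
    (leftMul_mul_leftMul_mem (mkIm 0 0 0 0 0 1 0) (mkIm 0 0 0 0 0 0 1)
      (norm_mkIm (by norm_num)) (norm_mkIm (by norm_num))), fun x => ?_⟩
  have h := congrArg (mul u) (volume_mul x)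
  rw [map_neg] at h
  exact h

end Spin

/-! ### The vector product on `Im 𝕆`. -/

section Cross

/-- The vector product on the imaginary octonions. -/
def cross : Im →ₗ[ℝ] Im →ₗ[ℝ] Im :=
  LinearMap.mk₂ ℝ
    (fun u v => ⟨(u : Oct) ⋆ (v : Oct) + (inner ℝ u v : ℝ) • one,
      Submodule.mem_orthogonal_singleton_iff_inner_right.2 (by
        rw [inner_add_right, inner_smul_right, real_inner_self_eq_norm_sq, norm_one,
          real_inner_comm, inner_mul_of_inner (inner_one_coe u), mul_one, real_inner_comm]
        simp)⟩)
    (fun u u' v => Subtype.ext (by simp [inner_add_left]; module))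
    (fun c u v => Subtype.ext (by simp [inner_smul_left, smul_smul]))
    (fun u v v' => Subtype.ext (by simp [inner_add_right]; module))
    (fun c u v => Subtype.ext (by simp [inner_smul_right, smul_smul]))

lemma coe_cross (u v : Im) :
    (cross u v : Oct) = (u : Oct) ⋆ (v : Oct) + (inner ℝ u v : ℝ) • one := rfl

lemma mul_coe (u v : Im) :
    (u : Oct) ⋆ (v : Oct) = (cross u v : Oct) - (inner ℝ u v : ℝ) • one := by
  rw [coe_cross, add_sub_cancel_right]

lemma cross_comm (u v : Im) : cross u v = -cross v u := by
  apply Subtype.ext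
  have h := mul_add_mul (inner_one_coe u) (inner_one_coe v)
  rw [Submodule.coe_neg, coe_cross, coe_cross, real_inner_comm u v, Submodule.coe_inner]
  linear_combination (norm := module) h

lemma cross_self (u : Im) : cross u u = 0 := by
  have h := cross_comm u u
  rwa [eq_neg_iff_add_eq_zero, ← two_smul ℝ, smul_eq_zero_iff_right two_ne_zero] at h

lemma inner_cross (u v w : Im) : inner ℝ (cross u v) w = -(inner ℝ v (cross u w) : ℝ) := by
  rw [Submodule.coe_inner, Submodule.coe_inner, coe_cross, coe_cross, inner_add_left,
    inner_add_right, inner_smul_left, inner_smul_right, inner_one_coe, real_inner_comm one (v : Oct),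
    inner_one_coe, inner_mul_of_inner (inner_one_coe u)]
  simp

/-- This is `u (u v) = -|u|² v` rewritten through the vector product, using that `u × v` is
orthogonal to `u`. -/
lemma cross_cross_self (u v : Im) :
    cross u (cross u v) = (inner ℝ u v : ℝ) • u - (inner ℝ u u : ℝ) • v := by
  apply Subtype.ext
  have h : (inner ℝ u (cross u v) : ℝ) = 0 := by
    have := inner_cross u u v
    rw [cross_self, inner_zero_left] at this
    linarith
  rw [coe_cross, h, coe_cross, map_add, map_smul, mul_one,
    mul_mul_self_of_inner (inner_one_coe u)]
  simp only [Submodule.coe_sub, Submodule.coe_smul, Submodule.coe_inner]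
  module

end Cross
end Oct
end InvConn
end

noncomputable section
namespace InvConn

namespace Oct

local notation:70 x:70 " ⋆ " y:71 => mul x y

/-! ### Flips as elements of `Spin(7)` and `G₂`. -/

section Flip

lemma inner_cross_self (u v : Im) : inner ℝ u (cross u v) = (0 : ℝ) := by
  have := inner_cross u u v
  rw [cross_self, inner_zero_left] at this
  linarith

lemma inner_cross_self' (u v : Im) : inner ℝ v (cross u v) = (0 : ℝ) := by
  rw [cross_comm, inner_neg_right, inner_cross_self, neg_zero]

lemma inner_cross_cross (u v w : Im) : inner ℝ (cross u v) (cross u w)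
    = (inner ℝ u u * inner ℝ v w - inner ℝ u v * inner ℝ u w : ℝ) := by
  rw [inner_cross, cross_cross_self, inner_sub_right, inner_smul_right, inner_smul_right,
    real_inner_comm u v]
  ring

/-- Linearization of `cross_cross_self`. -/
lemma cross_cross_add (u v w : Im) : cross u (cross v w) + cross v (cross u w)
    = (inner ℝ u w : ℝ) • v + (inner ℝ v w : ℝ) • u - (2 * inner ℝ u v : ℝ) • w := by
  have h := cross_cross_self (u + v) w
  simp only [map_add, LinearMap.add_apply, cross_cross_self u, cross_cross_self v,
    inner_add_left, inner_add_right] at h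
  rw [real_inner_comm u v] at h
  linear_combination (norm := module) h

/-- The automorphism of the octonions which is the identity on the quaternion subalgebra generated
by `n`, `m`, and `-1` on its orthogonal complement, restricted to the imaginary octonions. -/
structure IsFlip (n m : Im) (g : Im ≃ₗᵢ[ℝ] Im) : Prop where
  left : g n = n
  right : g m = m
  cross : g (cross n m) = cross n m
  neg : ∀ w, inner ℝ n w = (0 : ℝ) → inner ℝ m w = (0 : ℝ) → inner ℝ (Oct.cross n m) w = (0 : ℝ) →
    g w = -w

/-- The restriction to the imaginary octonions of an isometry fixing the unit. -/
def restrictIm (g : Oct ≃ₗᵢ[ℝ] Oct) (h : g one = one) : Im ≃ₗᵢ[ℝ] Im :=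
  LinearIsometry.toLinearIsometryEquiv
    ⟨(g.toLinearEquiv : Oct →ₗ[ℝ] Oct).restrict (p := (Submodule.span ℝ {one})ᗮ)
      (q := (Submodule.span ℝ {one})ᗮ) fun x hx => by
        rw [Submodule.mem_orthogonal_singleton_iff_inner_right] at hx ⊢
        change inner ℝ one (g x) = 0
        rw [← h, g.inner_map_map, hx], fun x => g.norm_map x⟩ rfl

lemma coe_restrictIm (g : Oct ≃ₗᵢ[ℝ] Oct) (h : g one = one) (v : Im) :
    (restrictIm g h v : Oct) = g v := rfl

lemma restrictIm_mem_g2 {g : Oct ≃ₗᵢ[ℝ] Oct} (hg : g ∈ spin7) (h : g one = one) :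
    restrictIm g h ∈ g2 :=
  ⟨g.toLinearEquiv, mul_of_spin7 hg h, fun _ => rfl⟩

lemma cross_g2 {g : Im ≃ₗᵢ[ℝ] Im} (hg : g ∈ g2) (u v : Im) :
    g (cross u v) = cross (g u) (g v) := by
  obtain ⟨φ, hφ, h⟩ := hg
  have h1 : φ one = one := by
    have := hφ one (φ.symm one)
    rw [one_mul, φ.apply_symm_apply, mul_one] at this
    exact this.symm
  apply Subtype.ext
  rw [← h, coe_cross, coe_cross, map_add, map_smul, hφ, h, h, h1, g.inner_map_map]

lemma mul_of_orthogonal {u v : Im} (h : inner ℝ u v = (0 : ℝ)) :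
    (u : Oct) ⋆ (v : Oct) = (cross u v : Oct) := by
  rw [mul_coe, h, zero_smul, sub_zero]

lemma norm_eq_one_of_inner {u : Im} (h : inner ℝ u u = (1 : ℝ)) : ‖u‖ = 1 := by
  rw [norm_eq_sqrt_real_inner, h, Real.sqrt_one]

/-- With `p = n × m` the flip is `x ↦ -n (m (p x))`, the product of the spin elements `x ↦ -n x` and
`x ↦ m (p x)`. On the quaternion subalgebra spanned by `1, n, m, p` associativity makes it the
identity. -/
lemma exists_flip {n m : Im} (hn : inner ℝ n n = (1 : ℝ)) (hm : inner ℝ m m = (1 : ℝ))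
    (hnm : inner ℝ n m = (0 : ℝ)) :
    ∃ (g : Oct ≃ₗᵢ[ℝ] Oct) (h : g one = one), g ∈ spin7 ∧ IsFlip n m (restrictIm g h) := by
  have hmn : inner ℝ m n = (0 : ℝ) := by rw [real_inner_comm, hnm]
  set p := cross n m with hp
  have hpp : inner ℝ p p = (1 : ℝ) := by
    rw [hp, inner_cross_cross, hn, hm, hnm]; norm_num
  have hnp : inner ℝ n p = (0 : ℝ) := inner_cross_self n m
  have hmp : inner ℝ m p = (0 : ℝ) := inner_cross_self' n m
  have cnp : cross n p = -m := by rw [hp, cross_cross_self, hnm, hn]; module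
  have cmp : cross m p = n := by
    rw [hp, cross_comm n m, map_neg, cross_cross_self, hmn, hm]; module
  have cmn : cross m n = -p := cross_comm m n
  have sq : ∀ {u : Im} (_ : inner ℝ u u = (1 : ℝ)) (x : Oct), (u : Oct) ⋆ ((u : Oct) ⋆ x) = -x := by
    intro u hu x
    rw [mul_mul_self_of_inner (inner_one_coe u), ← Submodule.coe_inner, hu, neg_one_smul]
  have anti : ∀ {u v : Im} (_ : inner ℝ u v = (0 : ℝ)) (x : Oct),
      (u : Oct) ⋆ ((v : Oct) ⋆ x) = -((v : Oct) ⋆ ((u : Oct) ⋆ x)) := by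
    intro u v huv x
    have := mul_mul_of_inner (inner_one_coe u) (inner_one_coe v) x
    rw [← Submodule.coe_inner, huv, mul_zero, neg_zero, zero_smul] at this
    exact eq_neg_of_add_eq_zero_left this
  obtain ⟨a, ha, hax⟩ := neg_leftMul_mem n (norm_eq_one_of_inner hn)
  have hb := leftMul_mul_leftMul_mem m p (norm_eq_one_of_inner hm) (norm_eq_one_of_inner hpp)
  set b := leftMul m (norm_eq_one_of_inner hm) * leftMul p (norm_eq_one_of_inner hpp) with hbdef
  have hg : ∀ x, (a * b) x = -((n : Oct) ⋆ ((m : Oct) ⋆ ((p : Oct) ⋆ x))) := fun x => hax _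
  have h1 : (a * b) one = one := by
    have := sq hn one
    rw [mul_one] at this
    rw [hg, mul_one, mul_of_orthogonal hmp, cmp, this, neg_neg]
  have self : ∀ {u : Im}, inner ℝ u u = (1 : ℝ) → (u : Oct) ⋆ (u : Oct) = -one := by
    intro u hu
    have := sq hu one
    rwa [mul_one] at this
  refine ⟨a * b, h1, mul_mem ha hb, ⟨?_, ?_, ?_, ?_⟩⟩
  · apply Subtype.ext
    rw [coe_restrictIm, hg, mul_of_orthogonal (by rw [real_inner_comm, hnp]), cross_comm, cnp,
      neg_neg, self hm, map_neg, mul_one, neg_neg]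
  · apply Subtype.ext
    rw [coe_restrictIm, hg, mul_of_orthogonal (by rw [real_inner_comm, hmp]), cross_comm, cmp,
      Submodule.coe_neg, map_neg, map_neg, neg_neg, mul_of_orthogonal hmn, cmn, Submodule.coe_neg,
      map_neg, mul_of_orthogonal hnp, cnp, Submodule.coe_neg, neg_neg]
  · apply Subtype.ext
    rw [coe_restrictIm, hg, ← hp, self hpp, map_neg, map_neg, neg_neg, mul_one,
      mul_of_orthogonal hnm]
  · intro w hnw hmw hpw
    apply Subtype.ext
    -- Orthogonal to the subalgebra, multiplication is anti-associative: `p w = -n (m w)`. The flip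
    -- then becomes `n m n m w`, which is `-w` by the Clifford relations.
    have hwp : (p : Oct) ⋆ (w : Oct) = -((n : Oct) ⋆ ((m : Oct) ⋆ (w : Oct))) := by
      have comm : ∀ {u v : Im}, inner ℝ u v = (0 : ℝ) →
          (u : Oct) ⋆ (v : Oct) = -((v : Oct) ⋆ (u : Oct)) := by
        intro u v huv
        rw [mul_of_orthogonal huv, cross_comm, Submodule.coe_neg, mul_of_orthogonal]
        rw [real_inner_comm, huv]
      rw [comm hmw, map_neg, neg_neg, anti hnw, mul_of_orthogonal hnm, ← hp, comm hpw]
    rw [coe_restrictIm, hg, hwp, map_neg, map_neg, neg_neg, anti hmn, sq hm, map_neg, map_neg, map_neg,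
      neg_neg, sq hn]
    rfl

lemma exists_flip_g2 {n m : Im} (hn : inner ℝ n n = (1 : ℝ)) (hm : inner ℝ m m = (1 : ℝ))
    (hnm : inner ℝ n m = (0 : ℝ)) : ∃ g ∈ g2, IsFlip n m g := by
  obtain ⟨g, h, hg, hf⟩ := exists_flip hn hm hnm
  exact ⟨_, restrictIm_mem_g2 hg h, hf⟩

end Flip
end Oct
end InvConn
end

noncomputable section
namespace InvConn

/-! ### Reduction to unit vectors, and symmetric forms. -/

section InnerProduct

variable {F : Type*} [NormedAddCommGroup F] [InnerProductSpace ℝ F]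

lemma unit_induction {C P : F → Prop} (hC : ∀ (r : ℝ) u, C u → C (r • u)) (h0 : P 0)
    (hs : ∀ (r : ℝ) u, P u → P (r • u)) (h1 : ∀ u, inner ℝ u u = (1 : ℝ) → C u → P u)
    (u : F) (hu : C u) : P u := by
  rcases eq_or_ne u 0 with rfl | h
  · exact h0
  · have hn : ‖u‖ ≠ 0 := norm_ne_zero_iff.2 h
    have h2 : u = ‖u‖ • (‖u‖⁻¹ • u) := by rw [smul_smul, mul_inv_cancel₀ hn, one_smul]
    rw [h2]
    refine hs _ _ (h1 _ ?_ (hC _ _ hu))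
    rw [inner_smul_left, inner_smul_right, real_inner_self_eq_norm_sq]
    simp
    field_simp

lemma exists_unit_orthogonal [FiniteDimensional ℝ F] {k : ℕ} (hk : k < Module.finrank ℝ F)
    (f : Fin k → F) : ∃ w, inner ℝ w w = (1 : ℝ) ∧ ∀ i, inner ℝ (f i) w = (0 : ℝ) := by
  have h1 : Module.finrank ℝ (Submodule.span ℝ (Set.range f)) ≤ k := by
    have := finrank_range_le_card (R := ℝ) f
    rwa [Fintype.card_fin] at this
  have h2 : (Submodule.span ℝ (Set.range f))ᗮ ≠ ⊥ := by
    rw [Ne, Submodule.orthogonal_eq_bot_iff]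
    intro h
    rw [h, finrank_top] at h1
    omega
  obtain ⟨w, hw, hne⟩ := Submodule.exists_mem_ne_zero_of_ne_bot h2
  have hn : ‖w‖ ≠ 0 := norm_ne_zero_iff.2 hne
  refine ⟨‖w‖⁻¹ • w, ?_, fun i => ?_⟩
  · rw [inner_smul_left, inner_smul_right, real_inner_self_eq_norm_sq]
    simp
    field_simp
  · rw [inner_smul_right, hw _ (Submodule.subset_span ⟨i, rfl⟩), mul_zero]

lemma eq_inner_smul {p x : F} (hp : inner ℝ p p = (1 : ℝ))
    (h : ∀ w, inner ℝ p w = (0 : ℝ) → inner ℝ x w = (0 : ℝ)) : x = (inner ℝ p x : ℝ) • p := by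
  have h1 : inner ℝ p (x - (inner ℝ p x : ℝ) • p) = (0 : ℝ) := by
    rw [inner_sub_right, inner_smul_right, hp]; ring
  have h2 := h _ h1
  rw [← sub_eq_zero, ← inner_self_eq_zero (𝕜 := ℝ), inner_sub_left, inner_smul_left, h1, h2]
  simp

lemma eq_inner_smul_add {p q x : F} (hp : inner ℝ p p = (1 : ℝ)) (hq : inner ℝ q q = (1 : ℝ))
    (hpq : inner ℝ p q = (0 : ℝ))
    (h : ∀ w, inner ℝ p w = (0 : ℝ) → inner ℝ q w = (0 : ℝ) → inner ℝ x w = (0 : ℝ)) :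
    x = (inner ℝ p x : ℝ) • p + (inner ℝ q x : ℝ) • q := by
  have hqp : inner ℝ q p = (0 : ℝ) := by rw [real_inner_comm, hpq]
  have h1 : inner ℝ p (x - ((inner ℝ p x : ℝ) • p + (inner ℝ q x : ℝ) • q)) = (0 : ℝ) := by
    rw [inner_sub_right, inner_add_right, inner_smul_right, inner_smul_right, hp, hpq]; ring
  have h1' : inner ℝ q (x - ((inner ℝ p x : ℝ) • p + (inner ℝ q x : ℝ) • q)) = (0 : ℝ) := by
    rw [inner_sub_right, inner_add_right, inner_smul_right, inner_smul_right, hq, hqp]; ring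
  have h2 := h _ h1 h1'
  rw [← sub_eq_zero, ← inner_self_eq_zero (𝕜 := ℝ), inner_sub_left, inner_add_left,
    inner_smul_left, inner_smul_left, h1, h1', h2]
  simp

/-- A symmetric form for which orthogonal vectors are orthogonal is a multiple of the inner
product. -/
lemma form_eq_smul_inner (o : F) (h : F →ₗ[ℝ] F →ₗ[ℝ] ℝ) (hs : ∀ u v, h u v = h v u)
    (hz : ∀ u v, inner ℝ u u = (1 : ℝ) → inner ℝ o u = (0 : ℝ) → inner ℝ o v = (0 : ℝ) →
      inner ℝ u v = (0 : ℝ) → h u v = 0)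
    {u₀ : F} (h0 : inner ℝ u₀ u₀ = (1 : ℝ)) (ho : inner ℝ o u₀ = (0 : ℝ)) (u v : F)
    (hu : inner ℝ o u = (0 : ℝ)) (hv : inner ℝ o v = (0 : ℝ)) :
    h u v = h u₀ u₀ * inner ℝ u v := by
  have hsmul : ∀ (r : ℝ) u, (inner ℝ o u = (0 : ℝ)) → inner ℝ o (r • u) = (0 : ℝ) :=
    fun r u hu => by rw [inner_smul_right, hu, mul_zero]
  have hz' : ∀ u, inner ℝ o u = (0 : ℝ) → ∀ v, inner ℝ o v = (0 : ℝ) →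
      inner ℝ u v = (0 : ℝ) → h u v = 0 := by
    intro u hu v hv huv
    refine unit_induction (C := fun u => inner ℝ o u = (0 : ℝ) ∧ inner ℝ u v = (0 : ℝ))
      (P := fun u => h u v = 0) ?_ (by simp) (fun r u hu => by simp [hu])
      (fun u h1 hu => hz u v h1 hu.1 hv hu.2) u ⟨hu, huv⟩
    rintro r u ⟨h1, h2⟩
    exact ⟨hsmul r u h1, by rw [inner_smul_left, h2, mul_zero]⟩
  have hd : ∀ z, inner ℝ o z = (0 : ℝ) → inner ℝ u₀ z = (0 : ℝ) →
      h z z = h u₀ u₀ * inner ℝ z z := by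
    intro z hz1 hz2
    refine unit_induction (C := fun z => inner ℝ o z = (0 : ℝ) ∧ inner ℝ u₀ z = (0 : ℝ))
      (P := fun z => h z z = h u₀ u₀ * inner ℝ z z) ?_ (by simp) ?_ ?_ z ⟨hz1, hz2⟩
    · rintro r u ⟨h1, h2⟩
      exact ⟨hsmul r u h1, by rw [inner_smul_right, h2, mul_zero]⟩
    · intro r z hz
      simp only [map_smul, LinearMap.smul_apply, hz, inner_smul_left, inner_smul_right, smul_eq_mul]
      simp
      ring
    · rintro z hz1 ⟨hz2, hz3⟩
      have hz4 : inner ℝ z u₀ = (0 : ℝ) := by rw [real_inner_comm, hz3]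
      -- For orthogonal unit vectors, `u₀ + z` and `u₀ - z` are orthogonal, which forces equal
      -- diagonal values.
      have h1 := hz' (u₀ + z) (by rw [inner_add_right, ho, hz2, add_zero]) (u₀ - z)
        (by rw [inner_sub_right, ho, hz2, sub_zero])
        (by rw [inner_add_left, inner_sub_right, inner_sub_right, h0, hz1, hz3, hz4]; ring)
      simp only [map_add, map_sub, LinearMap.add_apply, hs z u₀] at h1
      rw [hz1]
      linarith
  have hdiag : ∀ u, inner ℝ o u = (0 : ℝ) → h u u = h u₀ u₀ * inner ℝ u u := by
    intro u hu
    set a : ℝ := inner ℝ u₀ u with ha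
    have h1 : inner ℝ o (u - a • u₀) = (0 : ℝ) := by
      rw [inner_sub_right, inner_smul_right, hu, ho]; ring
    have h2 : inner ℝ u₀ (u - a • u₀) = (0 : ℝ) := by
      rw [inner_sub_right, inner_smul_right, h0]; ring
    have h3 := hd _ h1 h2
    have h4 := hz' u₀ ho _ h1 h2
    simp only [map_sub, LinearMap.sub_apply, map_smul, LinearMap.smul_apply, smul_eq_mul,
      inner_sub_left, inner_sub_right, inner_smul_left, inner_smul_right, h0,
      RCLike.conj_to_real, hs u u₀, real_inner_comm u₀ u, ← ha] at h3 h4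
    linear_combination h3 + 2 * a * h4
  have h1 := hdiag (u + v) (by rw [inner_add_right, hu, hv, add_zero])
  simp only [map_add, LinearMap.add_apply, inner_add_left, inner_add_right, hdiag u hu, hdiag v hv,
    hs v u, real_inner_comm u v] at h1
  linarith

end InnerProduct

end InvConn
end

noncomputable section
namespace InvConn

namespace Oct

/-! ### Bilinear maps on `Im 𝕆` commuting with all flips. -/

section FlipInvariant

lemma exists_unit_im {k : ℕ} (hk : k < 7) (f : Fin k → Im) :
    ∃ w, inner ℝ w w = (1 : ℝ) ∧ ∀ i, inner ℝ (f i) w = (0 : ℝ) :=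
  exists_unit_orthogonal (by rwa [finrank_im.out]) f

lemma inner_cross_rotate (u v w : Im) : inner ℝ u (cross v w) = (inner ℝ (cross u v) w : ℝ) := by
  rw [cross_comm u v, inner_neg_left, inner_cross, neg_neg]

/-- A bilinear map on the imaginary octonions which commutes with all flips. -/
def FlipInvariant (B : Im →ₗ[ℝ] Im →ₗ[ℝ] Im) : Prop :=
  ∀ n m : Im, inner ℝ n n = (1 : ℝ) → inner ℝ m m = (1 : ℝ) → inner ℝ n m = (0 : ℝ) →
    ∃ g ∈ g2, IsFlip n m g ∧ ∀ u v, g (B u v) = B (g u) (g v)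

variable {B : Im →ₗ[ℝ] Im →ₗ[ℝ] Im}

/-- A flip fixing `u` and negating `v` negates `B u v`, so its `u`-component vanishes; likewise for
`v`. The flip of `(u, v)` fixes `B u v`, which confines it to the span of `u, v, u × v`. -/
lemma FlipInvariant.cross_zero_of_unit (hB : FlipInvariant B) {u v : Im}
    (hu : inner ℝ u u = (1 : ℝ)) (hv : inner ℝ v v = (1 : ℝ)) (huv : inner ℝ u v = (0 : ℝ)) :
    B u v = (inner ℝ (cross u v) (B u v) : ℝ) • cross u v := by
  have hvu : inner ℝ v u = (0 : ℝ) := by rw [real_inner_comm, huv]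
  obtain ⟨z, hz, hzf⟩ := exists_unit_im (by norm_num) ![u, v, cross u v]
  simp only [Fin.forall_fin_succ, Matrix.cons_val_zero, Matrix.cons_val_succ, IsEmpty.forall_iff,
    and_true] at hzf
  obtain ⟨hzu, hzv, hzp⟩ := hzf
  have h1 : inner ℝ (B u v) u = (0 : ℝ) := by
    obtain ⟨g, -, hg, hgB⟩ := hB u z hu hz hzu
    have hgv : g v = -v := hg.neg v huv (by rw [real_inner_comm, hzv]) (by
      rw [real_inner_comm, inner_cross_rotate, cross_comm, inner_neg_left, hzp, neg_zero])
    have := g.inner_map_map (B u v) u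
    rw [hgB, hg.left, hgv, map_neg, inner_neg_left] at this
    linarith
  have h2 : inner ℝ (B u v) v = (0 : ℝ) := by
    obtain ⟨g, -, hg, hgB⟩ := hB v z hv hz hzv
    have hgu : g u = -u := hg.neg u hvu (by rw [real_inner_comm, hzu]) (by
      rw [real_inner_comm, inner_cross_rotate, hzp])
    have := g.inner_map_map (B u v) v
    rw [hgB, hg.left, hgu, map_neg, LinearMap.neg_apply, inner_neg_left] at this
    linarith
  refine eq_inner_smul (by rw [inner_cross_cross, hu, hv, huv]; norm_num) fun w hw => ?_
  obtain ⟨g, -, hg, hgB⟩ := hB u v hu hv huv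
  have hgw := hg.neg (w - (inner ℝ u w : ℝ) • u - (inner ℝ v w : ℝ) • v)
    (by simp only [inner_sub_right, inner_smul_right, hu, huv]; ring)
    (by simp only [inner_sub_right, inner_smul_right, hv, hvu]; ring)
    (by
      have e1 : inner ℝ (cross u v) u = (0 : ℝ) := by rw [real_inner_comm, inner_cross_self]
      have e2 : inner ℝ (cross u v) v = (0 : ℝ) := by rw [real_inner_comm, inner_cross_self']
      simp only [inner_sub_right, inner_smul_right, hw, e1, e2]; ring)
  have := g.inner_map_map (B u v) (w - (inner ℝ u w : ℝ) • u - (inner ℝ v w : ℝ) • v)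
  rw [hgB, hg.left, hg.right, hgw, inner_neg_right] at this
  simp only [inner_sub_right, inner_smul_right, h1, h2] at this
  linarith

/-- A flip negating `u` fixes `B u u`, which is therefore orthogonal to `u`. Then a flip fixing `u`
can be chosen that negates `B u u`, although it must also fix it. -/
lemma FlipInvariant.self_of_unit (hB : FlipInvariant B) {u : Im} (hu : inner ℝ u u = (1 : ℝ)) :
    B u u = 0 := by
  have h1 : inner ℝ (B u u) u = (0 : ℝ) := by
    obtain ⟨v, hv, hvf⟩ := exists_unit_im (by norm_num) ![u]
    obtain ⟨z, hz, hzf⟩ := exists_unit_im (by norm_num) ![u, v, cross u v]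
    simp only [Fin.forall_fin_succ, Matrix.cons_val_zero, Matrix.cons_val_succ, IsEmpty.forall_iff,
      and_true] at hvf hzf
    obtain ⟨hzu, hzv, hzp⟩ := hzf
    obtain ⟨g, -, hg, hgB⟩ := hB v z hv hz hzv
    have hgu : g u = -u := hg.neg u (by rw [real_inner_comm, hvf]) (by rw [real_inner_comm, hzu])
      (by rw [real_inner_comm, inner_cross_rotate, hzp])
    have := g.inner_map_map (B u u) u
    rw [hgB, hgu, map_neg, map_neg, LinearMap.neg_apply, neg_neg, inner_neg_right] at this
    linarith
  rw [← inner_self_eq_zero (𝕜 := ℝ)]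
  set w := B u u with hw
  obtain ⟨v, hv, hvf⟩ := exists_unit_im (by norm_num) ![u, w, cross u w]
  simp only [Fin.forall_fin_succ, Matrix.cons_val_zero, Matrix.cons_val_succ, IsEmpty.forall_iff,
    and_true] at hvf
  obtain ⟨hvu, hvw, hvp⟩ := hvf
  obtain ⟨g, -, hg, hgB⟩ := hB u v hu hv hvu
  have hgw : g w = -w := hg.neg w (by rw [real_inner_comm, h1]) (by rw [real_inner_comm, hvw]) (by
    rw [real_inner_comm, inner_cross_rotate, cross_comm, inner_neg_left, hvp, neg_zero])
  have h2 : g w = w := by rw [hw, hgB, hg.left]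
  have h3 : w = -w := h2.symm.trans hgw
  have h4 := congrArg (fun x => (inner ℝ w x : ℝ)) h3
  simp only [inner_neg_right] at h4
  linarith

lemma FlipInvariant.self (hB : FlipInvariant B) (u : Im) : B u u = 0 :=
  unit_induction (C := fun _ => True) (P := fun u => B u u = 0) (fun _ _ _ => trivial) (by simp)
    (fun r u hu => by simp [hu]) (fun u hu _ => hB.self_of_unit hu) u trivial

/-- Alternating bilinear maps are skew. -/
lemma skew_of_self {F : Type*} [AddCommGroup F] [Module ℝ F] {B : F →ₗ[ℝ] F →ₗ[ℝ] F}
    {u v : F} (hu : B u u = 0) (hv : B v v = 0) (huv : B (u + v) (u + v) = 0) : B u v = -B v u := by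
  simp only [map_add, LinearMap.add_apply, hu, hv] at huv
  rw [eq_neg_iff_add_eq_zero]
  simpa [add_comm] using huv

lemma FlipInvariant.eq_smul_cross (hB : FlipInvariant B) {u v : Im}
    (hu : inner ℝ u u = (1 : ℝ)) (huv : inner ℝ u v = (0 : ℝ)) : ∃ c : ℝ, B u v = c • cross u v := by
  refine unit_induction (C := fun v => inner ℝ u v = (0 : ℝ)) (P := fun v => ∃ c : ℝ, B u v = c • cross u v)
    (fun r v hv => by rw [inner_smul_right, hv, mul_zero]) ⟨0, by simp⟩ ?_
    (fun v hv huv => ⟨_, hB.cross_zero_of_unit hu hv huv⟩) v huv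
  rintro r v ⟨c, hc⟩
  exact ⟨c, by rw [map_smul, map_smul, hc, smul_comm]⟩

/-- For `w` orthogonal to `u` and `v`, the vector `B u (v + w) = B u w` is a multiple both of `u × v
+ u × w` and of `u × w`. As `u × v` and `u × w` are orthogonal, the first multiple is zero. -/
lemma FlipInvariant.apply_eq_zero (hB : FlipInvariant B) {u v : Im}
    (hu : inner ℝ u u = (1 : ℝ)) (hv : inner ℝ v v = (1 : ℝ)) (huv : inner ℝ u v = (0 : ℝ))
    (h : B u v = 0) (w : Im) : B u w = 0 := by
  have key : ∀ w, inner ℝ u w = (0 : ℝ) → inner ℝ v w = (0 : ℝ) → B u w = 0 := by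
    intro w huw hvw
    obtain ⟨c, hc⟩ := hB.eq_smul_cross hu huw
    obtain ⟨c', hc'⟩ := hB.eq_smul_cross (v := v + w) hu (by rw [inner_add_right, huv, huw, add_zero])
    have h1 : B u (v + w) = B u w := by rw [map_add, h, zero_add]
    have h2 := congrArg (fun x => (inner ℝ (cross u v) x : ℝ)) (hc'.symm.trans (h1.trans hc))
    simp only [map_add, inner_smul_right, inner_add_right, inner_cross_cross, hu, hv, huv, hvw] at h2
    have h3 : c' = 0 := by linarith
    rw [← h1, hc', h3, zero_smul]
  have hvu : inner ℝ v u = (0 : ℝ) := by rw [real_inner_comm, huv]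
  have h1 := key (w - (inner ℝ u w : ℝ) • u - (inner ℝ v w : ℝ) • v)
    (by simp only [inner_sub_right, inner_smul_right, hu, huv]; ring)
    (by simp only [inner_sub_right, inner_smul_right, hv, hvu]; ring)
  simpa [h, hB.self u] using h1

lemma FlipInvariant.eq_zero (hB : FlipInvariant B) {u v : Im}
    (hu : inner ℝ u u = (1 : ℝ)) (hv : inner ℝ v v = (1 : ℝ)) (huv : inner ℝ u v = (0 : ℝ))
    (h : B u v = 0) (x y : Im) : B x y = 0 := by
  have h1 := hB.apply_eq_zero hu hv huv h
  have h2 : ∀ z, inner ℝ u z = (0 : ℝ) → B z y = 0 := by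
    refine unit_induction (P := fun z => B z y = 0)
      (fun r v hv => by rw [inner_smul_right, hv, mul_zero]) (by simp) (fun r z hz => by simp [hz]) ?_
    intro z hz huz
    refine hB.apply_eq_zero hz hu (by rw [real_inner_comm, huz]) ?_ y
    rw [skew_of_self (hB.self z) (hB.self u) (hB.self _), h1, neg_zero]
  have h3 := h2 (x - (inner ℝ u x : ℝ) • u) (by
    simp only [inner_sub_right, inner_smul_right, hu]; ring)
  simpa [h1] using h3

lemma FlipInvariant.sub_smul_cross (hB : FlipInvariant B) (c : ℝ) : FlipInvariant (B - c • cross) := by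
  intro n m hn hm hnm
  obtain ⟨g, hg, hf, hgB⟩ := hB n m hn hm hnm
  exact ⟨g, hg, hf, fun u v => by simp [hgB, cross_g2 hg]⟩

/-- Subtracting the multiple of the vector product that matches `B` on one orthonormal pair leaves a
flip-invariant map vanishing on that pair, hence everywhere. -/
lemma FlipInvariant.exists_eq_smul_cross (hB : FlipInvariant B) : ∃ c : ℝ, ∀ u v, B u v = c • cross u v := by
  obtain ⟨u, hu, -⟩ := exists_unit_im (by norm_num) ![]
  obtain ⟨v, hv, hvf⟩ := exists_unit_im (by norm_num) ![u]
  have huv : inner ℝ u v = (0 : ℝ) := hvf 0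
  refine ⟨(inner ℝ (cross u v) (B u v) : ℝ), fun x y => ?_⟩
  have := (hB.sub_smul_cross (inner ℝ (cross u v) (B u v) : ℝ)).eq_zero hu hv huv
    (sub_eq_zero.2 (hB.cross_zero_of_unit hu hv huv)) x y
  exact sub_eq_zero.1 this

end FlipInvariant
end Oct
end InvConn
end

noncomputable section
namespace InvConn

namespace Oct

/-! ### Bilinear maps and forms on `i^⊥ ≅ ℂ³` commuting with flips that fix `i`. -/

section ComplexFlip

/-- A bilinear map on the orthogonal complement of `i`, with values in that complement, which
commutes with the flips that fix `i`. -/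
structure ComplexFlipInvariant (i : Im) (B : Im →ₗ[ℝ] Im →ₗ[ℝ] Im) : Prop where
  unit : inner ℝ i i = (1 : ℝ)
  tangent : ∀ u v, inner ℝ i (B u v) = (0 : ℝ)
  exists_flip : ∀ m : Im, inner ℝ m m = (1 : ℝ) → inner ℝ i m = (0 : ℝ) →
    ∃ g ∈ g2, IsFlip i m g ∧ ∀ u v, inner ℝ i u = (0 : ℝ) → inner ℝ i v = (0 : ℝ) →
      g (B u v) = B (g u) (g v)

/-- Vectors orthogonal over the complex numbers, for the complex structure `i ×`. -/
structure COrth (i u v : Im) : Prop where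
  left : inner ℝ i u = (0 : ℝ)
  right : inner ℝ i v = (0 : ℝ)
  re : inner ℝ u v = (0 : ℝ)
  im : inner ℝ (cross i u) v = (0 : ℝ)

variable {i : Im}

lemma inner_cross_comm (u v : Im) : inner ℝ (cross i u) v = -(inner ℝ (cross i v) u : ℝ) := by
  rw [inner_cross, real_inner_comm]

lemma COrth.symm {u v : Im} (h : COrth i u v) : COrth i v u :=
  ⟨h.right, h.left, by rw [real_inner_comm, h.re], by rw [inner_cross_comm, h.im, neg_zero]⟩

lemma COrth.add {u v w : Im} (h : COrth i u v) (h' : COrth i u w) : COrth i u (v + w) :=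
  ⟨h.left, by rw [inner_add_right, h.right, h'.right, add_zero],
    by rw [inner_add_right, h.re, h'.re, add_zero], by rw [inner_add_right, h.im, h'.im, add_zero]⟩

lemma COrth.smul {u v : Im} (h : COrth i u v) (r : ℝ) : COrth i u (r • v) :=
  ⟨h.left, by rw [inner_smul_right, h.right, mul_zero],
    by rw [inner_smul_right, h.re, mul_zero], by rw [inner_smul_right, h.im, mul_zero]⟩

lemma cross_cross_i (hi : inner ℝ i i = (1 : ℝ)) {u : Im} (hu : inner ℝ i u = (0 : ℝ)) :
    cross i (cross i u) = -u := by
  rw [cross_cross_self, hu, hi]; module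

lemma inner_cross_i (hi : inner ℝ i i = (1 : ℝ)) {u : Im} (hu : inner ℝ i u = (0 : ℝ)) (v : Im) :
    inner ℝ (cross i u) (cross i v) = (inner ℝ u v : ℝ) := by
  rw [inner_cross_cross, hi, hu]; ring

lemma COrth.cross_right (hi : inner ℝ i i = (1 : ℝ)) {u v : Im} (h : COrth i u v) :
    COrth i u (cross i v) :=
  ⟨h.left, inner_cross_self i v, by rw [real_inner_comm, inner_cross_comm, h.im, neg_zero],
    by rw [inner_cross_i hi h.left, h.re]⟩

lemma COrth.cross_left (hi : inner ℝ i i = (1 : ℝ)) {u v : Im} (h : COrth i u v) :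
    COrth i (cross i u) v :=
  (h.symm.cross_right hi).symm

/-- For vectors orthogonal to `i`, the product is complex antilinear. -/
lemma cross_cross_anti {u v : Im} (hu : inner ℝ i u = (0 : ℝ)) (hv : inner ℝ i v = (0 : ℝ)) :
    cross u (cross i v) = -cross i (cross u v) + (inner ℝ u v : ℝ) • i := by
  have h := cross_cross_add i u v
  rw [hu, hv] at h
  linear_combination (norm := module) h

lemma COrth.inner_i_cross {u v : Im} (h : COrth i u v) : inner ℝ i (cross u v) = (0 : ℝ) := by
  rw [inner_cross_rotate, h.im]

lemma COrth.left_cross {u v : Im} (h : COrth i u v) : COrth i u (cross u v) :=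
  ⟨h.left, h.inner_i_cross, inner_cross_self u v, by
    rw [inner_cross_rotate, cross_comm, cross_cross_anti h.left h.left, cross_self, map_zero,
      inner_neg_left, inner_add_left, inner_smul_left, h.right]
    simp⟩

lemma COrth.right_cross {u v : Im} (h : COrth i u v) : COrth i v (cross u v) := by
  have := h.symm.left_cross.smul (-1)
  rwa [neg_one_smul, ← cross_comm] at this

/-- Left multiplication by `u` preserves complex orthogonality. -/
lemma COrth.cross_cross {u v w : Im} (hv : COrth i u v) (hw : COrth i u w) (h : COrth i v w) :
    COrth i (cross u v) (cross u w) :=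
  ⟨hv.inner_i_cross, hw.inner_i_cross, by rw [inner_cross_cross, h.re, hv.re]; ring, by
    have h1 : cross i (cross u v) = -cross u (cross i v) := by
      rw [cross_cross_anti hv.left hv.right, hv.re]; module
    rw [h1, inner_neg_left, inner_cross_cross, h.im, hw.re]
    ring⟩

/-- Complex orthogonality to `k` vectors imposes `1 + k + k` real conditions: from `i`, the vectors,
and their products with `i`. -/
lemma exists_cOrth {k : ℕ} (hk : 1 + k + k < 7) (f : Fin k → Im)
    (hf : ∀ j, inner ℝ i (f j) = (0 : ℝ)) : ∃ w, inner ℝ w w = (1 : ℝ) ∧ inner ℝ i w = (0 : ℝ) ∧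
      ∀ j, COrth i (f j) w := by
  obtain ⟨w, hw, h⟩ := exists_unit_im hk (Fin.append (Fin.append ![i] f) fun j => cross i (f j))
  have h0 : inner ℝ i w = (0 : ℝ) := by
    simpa using h (Fin.castAdd k (Fin.castAdd k 0))
  refine ⟨w, hw, h0, fun j => ⟨hf j, h0, ?_, ?_⟩⟩
  · simpa using h (Fin.castAdd k (Fin.natAdd 1 j))
  · simpa using h (Fin.natAdd (1 + k) j)

/-- The component of `w` which is complex orthogonal to a unit vector `u`. -/
lemma COrth.sub (hi : inner ℝ i i = (1 : ℝ)) {u : Im} (hu : inner ℝ u u = (1 : ℝ))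
    (hiu : inner ℝ i u = (0 : ℝ)) {w : Im} (hw : inner ℝ i w = (0 : ℝ)) :
    COrth i u (w - (inner ℝ u w : ℝ) • u - (inner ℝ (cross i u) w : ℝ) • cross i u) := by
  have h1 : inner ℝ u (cross i u) = (0 : ℝ) := inner_cross_self' i u
  refine ⟨hiu, ?_, ?_, ?_⟩
  · simp only [inner_sub_right, inner_smul_right, hw, hiu, inner_cross_self]; ring
  · simp only [inner_sub_right, inner_smul_right, hu, h1]; ring
  · simp only [inner_sub_right, inner_smul_right, inner_cross_i hi hiu, hu,
      real_inner_comm u (cross i u), h1]; ring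

lemma IsFlip.fix_cOrth {m u : Im} {g : Im ≃ₗᵢ[ℝ] Im} (hg : IsFlip i m g) (h : COrth i m u) :
    g u = -u :=
  hg.neg u h.right h.re h.im

variable {B : Im →ₗ[ℝ] Im →ₗ[ℝ] Im}

namespace ComplexFlipInvariant

/-- The flip of `(i, u × v)` negates both `u` and `v`, so it fixes `B u v`. Its fixed space is
spanned by `i`, `u × v` and `i × (u × v)`, and the `i`-component is excluded. -/
lemma apply_of_unit (hB : ComplexFlipInvariant i B) {u v : Im}
    (hu : inner ℝ u u = (1 : ℝ)) (hv : inner ℝ v v = (1 : ℝ)) (h : COrth i u v) :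
    ∃ a b : ℝ, B u v = a • cross u v + b • cross i (cross u v) := by
  have hp : inner ℝ (cross u v) (cross u v) = (1 : ℝ) := by
    rw [inner_cross_cross, hu, hv, h.re]; norm_num
  have hq : inner ℝ (cross i (cross u v)) (cross i (cross u v)) = (1 : ℝ) := by
    rw [inner_cross_i hB.unit h.inner_i_cross, hp]
  refine ⟨_, _, eq_inner_smul_add hp hq (inner_cross_self' i _) fun w hpw hqw => ?_⟩
  obtain ⟨g, -, hg, hgB⟩ := hB.exists_flip _ hp h.inner_i_cross
  have hw := hg.neg (w - (inner ℝ i w : ℝ) • i)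
    (by simp only [inner_sub_right, inner_smul_right, hB.unit]; ring)
    (by simp only [inner_sub_right, inner_smul_right, hpw, real_inner_comm i (cross u v),
          h.inner_i_cross]; ring)
    (by
      have e : inner ℝ (cross i (cross u v)) i = (0 : ℝ) := by
        rw [real_inner_comm, inner_cross_self]
      simp only [inner_sub_right, inner_smul_right, hqw, e]; ring)
  have h1 := g.inner_map_map (B u v) (w - (inner ℝ i w : ℝ) • i)
  rw [hgB u v h.left h.right, hg.fix_cOrth h.left_cross.symm, hg.fix_cOrth h.right_cross.symm, hw,
    map_neg, map_neg, LinearMap.neg_apply, neg_neg, inner_neg_right] at h1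
  have h2 : inner ℝ (B u v) i = (0 : ℝ) := by rw [real_inner_comm, hB.tangent]
  simp only [inner_sub_right, inner_smul_right, h2] at h1
  linarith

lemma exists_apply_eq (hB : ComplexFlipInvariant i B) {u v : Im}
    (hu : inner ℝ u u = (1 : ℝ)) (h : COrth i u v) :
    ∃ a b : ℝ, B u v = a • cross u v + b • cross i (cross u v) := by
  refine unit_induction (C := fun v => COrth i u v)
    (P := fun v => ∃ a b : ℝ, B u v = a • cross u v + b • cross i (cross u v))
    (fun r v hv => hv.smul r) ⟨0, 0, by simp⟩ ?_
    (fun v hv h => hB.apply_of_unit hu hv h) v h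
  rintro r v ⟨a, b, hc⟩
  refine ⟨a, b, ?_⟩
  simp only [map_smul, hc]
  module

/-- Covers `B u (i × u)`, which skewness alone does not. A flip negating the complex line of `u`
fixes `B x y`, so `B x y` is orthogonal to that line; the flip of `(i, u)` fixes the line and hence
`B x y`, yet negates everything orthogonal to `i` and the line. -/
lemma eq_zero_of_line (hB : ComplexFlipInvariant i B) {u x y : Im} (hu : inner ℝ u u = (1 : ℝ))
    (hiu : inner ℝ i u = (0 : ℝ)) (hx : x = u ∨ x = cross i u) (hy : y = u ∨ y = cross i u) :
    B x y = 0 := by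
  obtain ⟨p, hp, hip, hpf⟩ := exists_cOrth (by norm_num) ![u] (fun _ => by simpa using hiu)
  have hup : COrth i u p := hpf 0
  have hi : ∀ {z : Im}, (z = u ∨ z = cross i u) → inner ℝ i z = (0 : ℝ) := by
    rintro z (rfl | rfl)
    · exact hiu
    · exact inner_cross_self i u
  have hz : ∀ z, (z = u ∨ z = cross i u) → inner ℝ (B x y) z = (0 : ℝ) := by
    obtain ⟨g, -, hg, hgB⟩ := hB.exists_flip p hp hip
    have hgz : ∀ {z : Im}, (z = u ∨ z = cross i u) → g z = -z := by
      rintro z (rfl | rfl)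
      · exact hg.fix_cOrth hup.symm
      · exact hg.fix_cOrth (hup.symm.cross_right hB.unit)
    intro z hz
    have h1 := g.inner_map_map (B x y) z
    rw [hgB x y (hi hx) (hi hy), hgz hx, hgz hy, hgz hz, map_neg, map_neg, LinearMap.neg_apply,
      neg_neg, inner_neg_right] at h1
    linarith
  rw [← inner_self_eq_zero (𝕜 := ℝ)]
  set w := B x y with hw
  obtain ⟨g, -, hg, hgB⟩ := hB.exists_flip u hu hiu
  have hgz : ∀ {z : Im}, (z = u ∨ z = cross i u) → g z = z := by
    rintro z (rfl | rfl)
    · exact hg.right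
    · exact hg.cross
  have h1 : g w = -w := hg.neg w (hB.tangent x y) (by rw [real_inner_comm, hz _ (.inl rfl)])
    (by rw [real_inner_comm, hz _ (.inr rfl)])
  have h2 : g w = w := by rw [hw, hgB x y (hi hx) (hi hy), hgz hx, hgz hy]
  have h4 := congrArg (fun x => (inner ℝ w x : ℝ)) (h2.symm.trans h1)
  simp only [inner_neg_right] at h4
  linarith

lemma self (hB : ComplexFlipInvariant i B) (u : Im) (hu : inner ℝ i u = (0 : ℝ)) : B u u = 0 :=
  unit_induction (C := fun u => inner ℝ i u = (0 : ℝ)) (P := fun u => B u u = 0)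
    (fun r u hu => by rw [inner_smul_right, hu, mul_zero]) (by simp)
    (fun r u hu => by simp [hu])
    (fun u hu hiu => hB.eq_zero_of_line hu hiu (.inl rfl) (.inl rfl)) u hu

lemma skew (hB : ComplexFlipInvariant i B) {u v : Im} (hu : inner ℝ i u = (0 : ℝ))
    (hv : inner ℝ i v = (0 : ℝ)) : B u v = -B v u :=
  skew_of_self (hB.self u hu) (hB.self v hv)
    (hB.self _ (by rw [inner_add_right, hu, hv, add_zero]))

/-- The comparison of `B u (v + w)` with `B u w` as over the reals, with complex coefficients: both
the `u × v` and the `i × (u × v)` coordinates are read off. -/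
lemma apply_eq_zero_of_cOrth (hB : ComplexFlipInvariant i B) {u v w : Im}
    (hu : inner ℝ u u = (1 : ℝ)) (hv : inner ℝ v v = (1 : ℝ)) (huv : COrth i u v)
    (h : B u v = 0) (huw : COrth i u w) (hvw : COrth i v w) : B u w = 0 := by
  obtain ⟨a, b, hc⟩ := hB.exists_apply_eq hu huw
  obtain ⟨a', b', hc'⟩ := hB.exists_apply_eq hu (huv.add huw)
  have h1 : B u (v + w) = B u w := by rw [map_add, h, zero_add]
  have h2 := hc'.symm.trans (h1.trans hc)
  have hvw' := huv.cross_cross huw hvw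
  have hp : inner ℝ (cross u v) (cross u v) = (1 : ℝ) := by
    rw [inner_cross_cross, hu, hv, huv.re]; norm_num
  have e1 : inner ℝ (cross u v) (cross i (cross u v)) = (0 : ℝ) := inner_cross_self' i _
  have e2 : inner ℝ (cross u v) (cross i (cross u w)) = (0 : ℝ) := (hvw'.cross_right hB.unit).re
  have e3 : inner ℝ (cross i (cross u v)) (cross u v) = (0 : ℝ) := by rw [real_inner_comm, e1]
  have h3 := congrArg (fun x => (inner ℝ (cross u v) x : ℝ)) h2
  have h4 := congrArg (fun x => (inner ℝ (cross i (cross u v)) x : ℝ)) h2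
  simp only [map_add, inner_smul_right, inner_add_right, hp, hvw'.re, e1, e2] at h3
  simp only [map_add, inner_smul_right, inner_add_right, inner_cross_i hB.unit huv.inner_i_cross,
    hp, hvw'.re, hvw'.im, e3] at h4
  have h5 : a' = 0 := by linarith
  have h6 : b' = 0 := by linarith
  rw [← h1, hc', h5, h6, zero_smul, zero_smul, add_zero]

lemma apply_eq_zero (hB : ComplexFlipInvariant i B) {u v : Im}
    (hu : inner ℝ u u = (1 : ℝ)) (hv : inner ℝ v v = (1 : ℝ)) (huv : COrth i u v)
    (h : B u v = 0) (w : Im) (hw : inner ℝ i w = (0 : ℝ)) : B u w = 0 := by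
  obtain ⟨z, hz, hiz, hzf⟩ := exists_cOrth (by norm_num) ![u, v] (by
    simp only [Fin.forall_fin_succ, Matrix.cons_val_zero, Matrix.cons_val_succ, IsEmpty.forall_iff,
      and_true]
    exact ⟨huv.left, huv.right⟩)
  have huz : COrth i u z := hzf 0
  have hvz : COrth i v z := hzf 1
  have h1 := hB.apply_eq_zero_of_cOrth hu hv huv h huz hvz
  -- `i × v` is not complex-orthogonal to `v`, so it is reached through a third direction `z`.
  have h2 := hB.apply_eq_zero_of_cOrth hu hz huz h1 (huv.cross_right hB.unit)
    (hvz.symm.cross_right hB.unit)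
  have h3 : ∀ w, COrth i u w → B u w = 0 := by
    intro w hw
    have h4 := hB.apply_eq_zero_of_cOrth hu hv huv h
      (w := w - (inner ℝ v w : ℝ) • v - (inner ℝ (cross i v) w : ℝ) • cross i v)
      (by
        have := (hw.add (huv.smul (-(inner ℝ v w : ℝ)))).add
          ((huv.cross_right hB.unit).smul (-(inner ℝ (cross i v) w : ℝ)))
        convert this using 1
        module)
      (COrth.sub hB.unit hv huv.right hw.right)
    simpa [h, h2] using h4
  have h5 := h3 _ (COrth.sub hB.unit hu huv.left hw)
  simpa [hB.eq_zero_of_line hu huv.left (.inl rfl) (.inl rfl),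
    hB.eq_zero_of_line hu huv.left (.inl rfl) (.inr rfl)] using h5

lemma eq_zero (hB : ComplexFlipInvariant i B) {u v : Im}
    (hu : inner ℝ u u = (1 : ℝ)) (hv : inner ℝ v v = (1 : ℝ)) (huv : COrth i u v)
    (h : B u v = 0) (x y : Im) (hx : inner ℝ i x = (0 : ℝ)) (hy : inner ℝ i y = (0 : ℝ)) :
    B x y = 0 := by
  have h1 := hB.apply_eq_zero hu hv huv h
  have h2 : ∀ z, inner ℝ z z = (1 : ℝ) → COrth i u z → ∀ y, inner ℝ i y = (0 : ℝ) → B z y = 0 := by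
    intro z hz huz y hy
    refine hB.apply_eq_zero hz hu huz.symm ?_ y hy
    rw [hB.skew huz.right huz.left, h1 z huz.right, neg_zero]
  have h3 : ∀ z, COrth i u z → B z y = 0 :=
    unit_induction (P := fun z => B z y = 0)
      (fun r v hv => hv.smul r) (by simp) (fun r z hz => by simp [hz])
      (fun z hz huz => h2 z hz huz y hy)
  have h4 : B (cross i u) y = 0 := by
    refine hB.apply_eq_zero (by rw [inner_cross_i hB.unit huv.left, hu]) hv
      (huv.cross_left hB.unit) ?_ y hy
    rw [hB.skew (inner_cross_self i u) huv.right, h2 v hv huv _ (inner_cross_self i u), neg_zero]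
  have h5 := h3 _ (COrth.sub hB.unit hu huv.left hx)
  simpa [h1 y hy, h4] using h5

end ComplexFlipInvariant

/-- The component orthogonal to `i` of the vector product. -/
def crossPerp (i : Im) : Im →ₗ[ℝ] Im →ₗ[ℝ] Im :=
  cross.compr₂ (LinearMap.id - (innerₗ Im i).smulRight i)

lemma crossPerp_apply (i u v : Im) :
    crossPerp i u v = cross u v - (inner ℝ i (cross u v) : ℝ) • i := rfl

/-- The product by `i` of the vector product. -/
def crossI (i : Im) : Im →ₗ[ℝ] Im →ₗ[ℝ] Im := cross.compr₂ (cross i)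

lemma crossI_apply (i u v : Im) : crossI i u v = cross i (cross u v) := rfl

lemma inner_crossPerp (hi : inner ℝ i i = (1 : ℝ)) (u v : Im) :
    inner ℝ i (crossPerp i u v) = (0 : ℝ) := by
  rw [crossPerp_apply, inner_sub_right, inner_smul_right, hi]; ring

lemma inner_crossI (u v : Im) : inner ℝ i (crossI i u v) = (0 : ℝ) := inner_cross_self i _

lemma crossPerp_map {g : Im ≃ₗᵢ[ℝ] Im} (hg : g ∈ g2) (i u v : Im) :
    g (crossPerp i u v) = crossPerp (g i) (g u) (g v) := by
  rw [crossPerp_apply, crossPerp_apply, map_sub, map_smul, ← cross_g2 hg, g.inner_map_map]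

lemma crossI_map {g : Im ≃ₗᵢ[ℝ] Im} (hg : g ∈ g2) (i u v : Im) :
    g (crossI i u v) = crossI (g i) (g u) (g v) := by
  rw [crossI_apply, crossI_apply, cross_g2 hg, cross_g2 hg]

lemma COrth.crossPerp {u v : Im} (h : COrth i u v) : crossPerp i u v = cross u v := by
  rw [crossPerp_apply, h.inner_i_cross, zero_smul, sub_zero]

lemma ComplexFlipInvariant.exists_eq (hB : ComplexFlipInvariant i B) :
    ∃ a b : ℝ, ∀ u v, inner ℝ i u = (0 : ℝ) → inner ℝ i v = (0 : ℝ) →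
      B u v = a • crossPerp i u v + b • crossI i u v := by
  obtain ⟨u, hu, hiu, -⟩ := exists_cOrth (by norm_num) ![] (fun j => j.elim0)
  obtain ⟨v, hv, hiv, hvf⟩ := exists_cOrth (by norm_num) ![u] (fun _ => by simpa using hiu)
  have huv : COrth i u v := hvf 0
  obtain ⟨a, b, hab⟩ := hB.apply_of_unit hu hv huv
  have hB' : ComplexFlipInvariant i (B - (a • Oct.crossPerp i + b • crossI i)) := by
    refine ⟨hB.unit, fun u v => ?_, fun m hm him => ?_⟩
    · simp only [LinearMap.sub_apply, LinearMap.add_apply, LinearMap.smul_apply, inner_sub_right,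
        inner_add_right, inner_smul_right, hB.tangent, inner_crossPerp hB.unit, inner_crossI]
      ring
    · obtain ⟨g, hg, hgf, hgB⟩ := hB.exists_flip m hm him
      refine ⟨g, hg, hgf, fun u v hu hv => ?_⟩
      simp only [LinearMap.sub_apply, LinearMap.add_apply, LinearMap.smul_apply, map_sub, map_add,
        map_smul, hgB u v hu hv, crossPerp_map hg, crossI_map hg, hgf.left]
  refine ⟨a, b, fun x y hx hy => ?_⟩
  have := hB'.eq_zero hu hv huv (by
    simp only [LinearMap.sub_apply, LinearMap.add_apply, LinearMap.smul_apply, hab, huv.crossPerp,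
      crossI_apply, sub_self]) x y hx hy
  exact sub_eq_zero.1 this

lemma crossPerp_crossI_independent (hi : inner ℝ i i = (1 : ℝ)) {a b : ℝ}
    (h : ∀ u v, inner ℝ i u = (0 : ℝ) → inner ℝ i v = (0 : ℝ) →
      a • crossPerp i u v + b • crossI i u v = 0) : a = 0 ∧ b = 0 := by
  obtain ⟨u, hu, hiu, -⟩ := exists_cOrth (by norm_num) ![] (fun j => j.elim0)
  obtain ⟨v, hv, hiv, hvf⟩ := exists_cOrth (by norm_num) ![u] (fun _ => by simpa using hiu)
  have huv : COrth i u v := hvf 0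
  have hp : inner ℝ (cross u v) (cross u v) = (1 : ℝ) := by
    rw [inner_cross_cross, hu, hv, huv.re]; norm_num
  have h1 := h u v hiu hiv
  rw [huv.crossPerp, crossI_apply] at h1
  have e1 : inner ℝ (cross u v) (cross i (cross u v)) = (0 : ℝ) := inner_cross_self' i _
  have e3 : inner ℝ (cross i (cross u v)) (cross u v) = (0 : ℝ) := by rw [real_inner_comm, e1]
  have h3 := congrArg (fun x => (inner ℝ (cross u v) x : ℝ)) h1
  have h4 := congrArg (fun x => (inner ℝ (cross i (cross u v)) x : ℝ)) h1
  simp only [inner_smul_right, inner_add_right, hp, e1, inner_zero_right] at h3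
  simp only [inner_smul_right, inner_add_right, inner_cross_i hi huv.inner_i_cross, hp, e3,
    inner_zero_right] at h4
  exact ⟨by linarith, by linarith⟩

/-- Symmetric forms on the orthogonal complement of `i` invariant under flips fixing `i`. -/
lemma form_eq_zero_of_flip (hi : inner ℝ i i = (1 : ℝ)) (h : Im →ₗ[ℝ] Im →ₗ[ℝ] ℝ)
    (hs : ∀ u v, h u v = h v u)
    (hf : ∀ m : Im, inner ℝ m m = (1 : ℝ) → inner ℝ i m = (0 : ℝ) →
      ∃ g, IsFlip i m g ∧ ∀ u v, inner ℝ i u = (0 : ℝ) → inner ℝ i v = (0 : ℝ) →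
        h (g u) (g v) = h u v) (u v : Im) (hu : inner ℝ u u = (1 : ℝ)) (hiu : inner ℝ i u = (0 : ℝ))
    (hiv : inner ℝ i v = (0 : ℝ)) (huv : inner ℝ u v = (0 : ℝ)) : h u v = 0 := by
  have h1 : ∀ u v, COrth i u v → h u v = 0 := by
    intro u v huv
    refine unit_induction (C := fun u => COrth i u v) (P := fun u => h u v = 0)
      (fun r u hu => (hu.symm.smul r).symm) (by simp) (fun r u hu => by simp [hu]) ?_ u huv
    intro u hu huv
    obtain ⟨g, hg, hgh⟩ := hf u hu huv.left
    have := hgh u v huv.left huv.right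
    rw [hg.right, hg.fix_cOrth huv, map_neg] at this
    linarith
  -- Writing `J` for `i ×`, the complex-orthogonal pairs `(u + w, Ju - Jw)` and `(u + Jw, Ju + w)`
  -- give `h(u, Ju) = h(w, Jw)` and `h(u, Ju) = -h(w, Jw)`.
  have h2 : h u (cross i u) = 0 := by
    obtain ⟨w, hw, hiw, hwf⟩ := exists_cOrth (by norm_num) ![u] (fun _ => by simpa using hiu)
    have huw : COrth i u w := hwf 0
    have hJ := huw.cross_left hi
    have hK := huw.cross_right hi
    have e : ∀ z : Im, inner ℝ (cross i z) z = (0 : ℝ) := fun z => by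
      rw [real_inner_comm, inner_cross_self']
    have e' : ∀ z : Im, inner ℝ z (cross i z) = (0 : ℝ) := fun z => inner_cross_self' i z
    have k1 := h1 (u + w) (cross i u - cross i w) ⟨by rw [inner_add_right, hiu, hiw, add_zero],
      by rw [inner_sub_right, inner_cross_self, inner_cross_self, sub_zero],
      by simp only [inner_add_left, inner_sub_right, e', hK.re, hJ.symm.re]; ring,
      by simp only [map_add, inner_add_left, inner_sub_right, inner_cross_i hi hiu,
          inner_cross_i hi hiw, hu, hw, huw.re, huw.symm.re]; ring⟩
    have k2 := h1 (u + cross i w) (cross i u + w)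
      ⟨by rw [inner_add_right, hiu, inner_cross_self, add_zero],
      by rw [inner_add_right, hiw, inner_cross_self, add_zero],
      by simp only [inner_add_left, inner_add_right, e, e', huw.re, inner_cross_i hi hiw,
          huw.symm.re]; ring,
      by simp only [map_add, inner_add_left, inner_add_right, inner_cross_i hi hiu, huw.im,
          cross_cross_i hi hiw, inner_neg_left, hJ.symm.re, hu, hw]; ring⟩
    simp only [map_add, map_sub, LinearMap.add_apply, h1 u _ hK, h1 w _ hJ.symm] at k1
    simp only [map_add, LinearMap.add_apply, h1 u w huw,
      h1 _ _ (hK.symm.cross_right hi), hs (cross i w) w] at k2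
    linarith
  have h3 := h1 _ _ (COrth.sub hi hu hiu hiv)
  simpa [huv, h2] using h3

end ComplexFlip
end Oct
end InvConn
end

noncomputable section
namespace InvConn

/-! ### One-parameter subgroups and derivations. -/

section Bilinear

variable {E : Type*} [NormedAddCommGroup E] [InnerProductSpace ℝ E] [FiniteDimensional ℝ E]

/-- A bilinear map on a finite-dimensional space as a continuous bilinear map. -/
def toBilin (m : E →ₗ[ℝ] E →ₗ[ℝ] E) : E →L[ℝ] E →L[ℝ] E :=
  LinearMap.toContinuousLinearMap (LinearMap.toContinuousLinearMap.toLinearMap ∘ₗ m)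

lemma contMDiff_bilin {n : ℕ} [Fact (Module.finrank ℝ E = n + 1)] (m : E →ₗ[ℝ] E →ₗ[ℝ] E)
    {f g : Sph E → E} (hf : ContMDiff (𝓡 n) 𝓘(ℝ, E) ∞ f) (hg : ContMDiff (𝓡 n) 𝓘(ℝ, E) ∞ g) :
    ContMDiff (𝓡 n) 𝓘(ℝ, E) ∞ (fun x => m (f x) (g x)) :=
  ((toBilin m).contMDiff.comp hf).clm_apply hg

lemma hasDerivAt_bilin (m : E →ₗ[ℝ] E →ₗ[ℝ] E) {f g : ℝ → E} {f' g' : E} {t : ℝ}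
    (hf : HasDerivAt f f' t) (hg : HasDerivAt g g' t) :
    HasDerivAt (fun t => m (f t) (g t)) (m f' (g t) + m (f t) g') t :=
  ((toBilin m).hasFDerivAt.comp_hasDerivAt t hf).clm_apply hg

attribute [local instance] LieRing.ofAssociativeRing

/-- The product `c t * exp(-t D)` has derivative zero. -/
lemma exp_smul_eq_of_hasDerivAt {c : ℝ → E →L[ℝ] E} {D : E →L[ℝ] E} (h0 : c 0 = 1)
    (hc : ∀ t, HasDerivAt c (c t * D) t) (t : ℝ) : NormedSpace.exp (t • D) = c t := by
  have h1 : ∀ t, HasDerivAt (fun t => c t * NormedSpace.exp (t • -D)) 0 t := fun t => by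
    convert! (hc t).mul (hasDerivAt_exp_smul_const' (-D) t) using 1
    simp [mul_assoc]
  have h2 := is_const_of_deriv_eq_zero (fun t => (h1 t).differentiableAt) (fun t => (h1 t).deriv) t 0
  simp only [h0, zero_smul, NormedSpace.exp_zero, mul_one] at h2
  have h3 : NormedSpace.exp (t • -D) * NormedSpace.exp (t • D) = 1 := by
    let _ := NormedAlgebra.restrictScalars ℚ ℝ (E →L[ℝ] E)
    rw [← NormedSpace.exp_add_of_commute]
    · simp
    · simp [Commute, SemiconjBy]
  rw [← one_mul (NormedSpace.exp (t • D)), ← h2, mul_assoc, h3, mul_one]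

lemma mem_lieAlg_of_hasDerivAt {G : Subgroup (E ≃ₗᵢ[ℝ] E)} {c : ℝ → E →L[ℝ] E} {D : E →L[ℝ] E}
    (h0 : c 0 = 1) (hc : ∀ t, HasDerivAt c (c t * D) t) (hG : ∀ t, ∃ g ∈ G, toOp g = c t) :
    D ∈ lieAlg G :=
  LieSubalgebra.subset_lieSpan fun t => by
    rw [exp_smul_eq_of_hasDerivAt h0 hc]
    exact hG t

lemma mem_lieAlg_of_sq {G : Subgroup (E ≃ₗᵢ[ℝ] E)} {J : E →L[ℝ] E} (hJ : J * J = -1)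
    (hG : ∀ t, ∃ g ∈ G, toOp g = Real.cos t • 1 + Real.sin t • J) : J ∈ lieAlg G := by
  refine mem_lieAlg_of_hasDerivAt (c := fun t => Real.cos t • 1 + Real.sin t • J)
    (by simp) (fun t => ?_) hG
  convert! ((Real.hasDerivAt_cos t).smul_const (1 : E →L[ℝ] E)).add
    ((Real.hasDerivAt_sin t).smul_const J) using 1
  rw [add_mul, smul_mul_assoc, smul_mul_assoc, hJ, one_mul]
  module

/-- The model is `D = J - K` and `F = J K` with commuting `J`, `K` of square `-1`: the curve is
`(cos t + sin t J)(cos t - sin t K)`. -/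
lemma mem_lieAlg_of_mul_self {G : Subgroup (E ≃ₗᵢ[ℝ] E)} {D F : E →L[ℝ] E}
    (hD : D * D = -((2 : ℝ) • 1) - (2 : ℝ) • F) (hF : F * D = D)
    (hG : ∀ t, ∃ g ∈ G, toOp g = (Real.cos t * Real.cos t) • 1 + (Real.cos t * Real.sin t) • D
      - (Real.sin t * Real.sin t) • F) : D ∈ lieAlg G := by
  refine mem_lieAlg_of_hasDerivAt (c := fun t => (Real.cos t * Real.cos t) • 1
    + (Real.cos t * Real.sin t) • D - (Real.sin t * Real.sin t) • F) (by simp) (fun t => ?_) hG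
  have hc := Real.hasDerivAt_cos t
  have hs := Real.hasDerivAt_sin t
  convert! (((hc.mul hc).smul_const (1 : E →L[ℝ] E)).add ((hc.mul hs).smul_const D)).sub
    ((hs.mul hs).smul_const F) using 1
  rw [sub_mul, add_mul, smul_mul_assoc, smul_mul_assoc, smul_mul_assoc, hD, hF, one_mul]
  module

/-- The Lie algebra of a group of automorphisms of a product consists of derivations. -/
lemma lieAlg_bilin {G : Subgroup (E ≃ₗᵢ[ℝ] E)} {m : E →ₗ[ℝ] E →ₗ[ℝ] E}
    (hm : ∀ g ∈ G, ∀ x y, g (m x y) = m (g x) (g y)) {A : E →L[ℝ] E} (hA : A ∈ lieAlg G) :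
    ∀ x y, A (m x y) = m (A x) y + m x (A y) := by
  induction hA using LieSubalgebra.lieSpan_induction with
  | mem A hA =>
    intro x y
    have h1 := hasDerivAt_bilin m (hasDerivAt_exp_apply A x) (hasDerivAt_exp_apply A y)
    have h2 := hasDerivAt_exp_apply A (m x y)
    have h3 : (fun t : ℝ => NormedSpace.exp (t • A) (m x y)) = fun t : ℝ =>
        m (NormedSpace.exp (t • A) x) (NormedSpace.exp (t • A) y) := by
      funext t
      obtain ⟨g, hg, hgt⟩ := hA t
      rw [← hgt]
      exact hm g hg x y
    rw [h3] at h2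
    simpa using h2.unique h1
  | zero => intro x y; simp
  | add A B _ _ hA hB =>
    intro x y
    simp only [_root_.add_apply, hA, hB, map_add, LinearMap.add_apply]
    abel
  | smul c A _ hA => intro x y; simp [hA]
  | lie A B _ _ hA hB =>
    have hAB : ∀ w, (⁅A, B⁆ : E →L[ℝ] E) w = A (B w) - B (A w) := fun _ => rfl
    intro x y
    simp only [hAB, hA, hB, map_add, map_sub, LinearMap.sub_apply]
    abel

/-- The Lie algebra of a group of automorphisms of a triple product consists of derivations. -/
lemma lieAlg_trilin {G : Subgroup (E ≃ₗᵢ[ℝ] E)} {m k : E →ₗ[ℝ] E →ₗ[ℝ] E}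
    (hm : ∀ g ∈ G, ∀ x y z, g (m (k x y) z) = m (k (g x) (g y)) (g z)) {A : E →L[ℝ] E}
    (hA : A ∈ lieAlg G) :
    ∀ x y z, A (m (k x y) z) = m (k (A x) y) z + m (k x (A y)) z + m (k x y) (A z) := by
  induction hA using LieSubalgebra.lieSpan_induction with
  | mem A hA =>
    intro x y z
    have h1 := hasDerivAt_bilin m (hasDerivAt_bilin k (hasDerivAt_exp_apply A x)
      (hasDerivAt_exp_apply A y)) (hasDerivAt_exp_apply A z)
    have h2 := hasDerivAt_exp_apply A (m (k x y) z)
    have h3 : (fun t : ℝ => NormedSpace.exp (t • A) (m (k x y) z)) = fun t : ℝ =>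
        m (k (NormedSpace.exp (t • A) x) (NormedSpace.exp (t • A) y))
          (NormedSpace.exp (t • A) z) := by
      funext t
      obtain ⟨g, hg, hgt⟩ := hA t
      rw [← hgt]
      exact hm g hg x y z
    rw [h3] at h2
    simpa using h2.unique h1
  | zero => intro x y z; simp
  | add A B _ _ hA hB =>
    intro x y z
    simp only [_root_.add_apply, hA, hB, map_add, LinearMap.add_apply]
    abel
  | smul c A _ hA => intro x y z; simp [hA]
  | lie A B _ _ hA hB =>
    have hAB : ∀ w, (⁅A, B⁆ : E →L[ℝ] E) w = A (B w) - B (A w) := fun _ => rfl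
    intro x y z
    simp only [hAB, hA, hB, map_add, map_sub, LinearMap.sub_apply]
    abel

end Bilinear

end InvConn
end

noncomputable section
namespace InvConn

namespace Oct

local notation:70 x:70 " ⋆ " y:71 => mul x y

/-! ### The seven-sphere. -/

section SevenSphere

lemma coe_basePoint7 : (basePoint7 : Oct) = one := rfl

/-- The invariant tensor `(u, v) ↦ (u x̄) v` on the seven-sphere. -/
def tensor7 : TangentTensor Oct 7 where
  toFun x := (mul ∘ₗ mul.flip (conj x)).compr₂
    (LinearMap.id - (innerₗ Oct (x : Oct)).smulRight (x : Oct))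
  smooth {f g} hf hg := by
    have h1 : ContMDiff (𝓡 7) 𝓘(ℝ, Oct) ∞ (fun x : Sph Oct => (f x ⋆ conj x) ⋆ g x) :=
      contMDiff_bilin mul (contMDiff_bilin (mul.compl₂ conj) hf contMDiff_coe_sphere) hg
    exact h1.sub ((contMDiff_inner contMDiff_coe_sphere h1).smul contMDiff_coe_sphere)
  tangent x u v := by
    change inner ℝ (x : Oct) ((u ⋆ conj x) ⋆ v
      - (inner ℝ (x : Oct) ((u ⋆ conj x) ⋆ v) : ℝ) • (x : Oct)) = 0
    rw [inner_sub_right, inner_smul_right, inner_coe_self]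
    ring

lemma tensor7_apply (x : Sph Oct) (u v : Oct) :
    tensor7 x u v = triple u x v - (inner ℝ (x : Oct) (triple u x v) : ℝ) • (x : Oct) := rfl

lemma tensor7_coe (u v : Im) : tensor7 basePoint7 (u : Oct) (v : Oct) = (cross u v : Oct) := by
  rw [tensor7_apply, coe_basePoint7, triple_one, coe_cross, real_inner_comm,
    inner_mul_of_inner (inner_one_coe u), mul_one, real_inner_comm, Submodule.coe_inner]
  module

lemma exists_coe_eq {u : Oct} (hu : inner ℝ one u = (0 : ℝ)) : ∃ v : Im, (v : Oct) = u :=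
  ⟨⟨u, Submodule.mem_orthogonal_singleton_iff_inner_right.2 hu⟩, rfl⟩

/-- For a unit imaginary `v` orthogonal to `x`, the element `u = -x v` is imaginary and `u v = x`,
so the product of the two left multiplications moves `1` to `x`. -/
lemma transitive_spin7 (x : Sph Oct) : ∃ g ∈ spin7, sphereMap g basePoint7 = x := by
  obtain ⟨v, hv, hvf⟩ := exists_unit_orthogonal (F := Oct) (k := 2)
    (by rw [finrank_oct.out]; norm_num) ![one, (x : Oct)]
  have h1 : inner ℝ one v = (0 : ℝ) := hvf 0
  have h2 : inner ℝ (x : Oct) v = (0 : ℝ) := hvf 1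
  have hvv : (x : Oct) ⋆ v ⋆ v = -(x : Oct) := by
    rw [mul_same_mul, mul_self_of_inner h1, hv, neg_one_smul, map_neg, mul_one]
  obtain ⟨v, rfl⟩ := exists_coe_eq h1
  obtain ⟨u, hu⟩ := exists_coe_eq (u := -((x : Oct) ⋆ (v : Oct))) (by
    rw [inner_neg_right, real_inner_comm, inner_mul_of_inner_right h1, one_mul, h2]
    simp)
  have huu : inner ℝ u u = (1 : ℝ) := by
    rw [Submodule.coe_inner, hu, inner_neg_left, inner_neg_right, inner_mul_of_inner_right h1, hvv,
      inner_neg_right, inner_coe_self]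
    norm_num
  refine ⟨_, leftMul_mul_leftMul_mem u v (norm_eq_one_of_inner huu) (norm_eq_one_of_inner hv), ?_⟩
  apply Subtype.ext
  change (u : Oct) ⋆ ((v : Oct) ⋆ one) = x
  rw [mul_one, hu, map_neg, LinearMap.neg_apply, hvv, neg_neg]

/-- The restriction to the imaginary octonions of a bilinear map with imaginary values. -/
def restrictBilin (B : Oct →ₗ[ℝ] Oct →ₗ[ℝ] Oct) (hB : ∀ u v, inner ℝ one (B u v) = (0 : ℝ)) :
    Im →ₗ[ℝ] Im →ₗ[ℝ] Im :=
  LinearMap.mk₂ ℝ (fun u v => ⟨B u v, Submodule.mem_orthogonal_singleton_iff_inner_right.2 (hB u v)⟩)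
    (fun u u' v => Subtype.ext (by simp)) (fun c u v => Subtype.ext (by simp))
    (fun u v v' => Subtype.ext (by simp)) (fun c u v => Subtype.ext (by simp))

lemma classified7 : Classified (fun _ : Unit => tensor7) spin7 basePoint7 where
  transitive := transitive_spin7
  equivariant _ g hg x u v := by
    simp only [tensor7_apply, coe_sphereMap, triple_spin7 hg, map_sub, map_smul, g.inner_map_map]
  classify B hB heq := by
    have hf : FlipInvariant (restrictBilin B hB) := by
      intro n m hn hm hnm
      obtain ⟨g, h, hg, hgf⟩ := exists_flip hn hm hnm
      exact ⟨_, restrictIm_mem_g2 hg h, hgf, fun u v => Subtype.ext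
        (heq g hg h u v (inner_one_coe u) (inner_one_coe v))⟩
    obtain ⟨c, hc⟩ := hf.exists_eq_smul_cross
    refine ⟨fun _ => c, fun u v hu hv => ?_⟩
    obtain ⟨u, rfl⟩ := exists_coe_eq hu
    obtain ⟨v, rfl⟩ := exists_coe_eq hv
    rw [Fintype.sum_unique, tensor7_coe, ← Submodule.coe_smul, ← hc]
    rfl
  independent c hc := by
    obtain ⟨u, hu, -⟩ := exists_unit_im (by norm_num) ![]
    obtain ⟨v, hv, hvf⟩ := exists_unit_im (by norm_num) ![u]
    have huv : inner ℝ u v = (0 : ℝ) := hvf 0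
    have h := hc u v (inner_one_coe u) (inner_one_coe v)
    rw [Fintype.sum_unique, tensor7_coe, ← Submodule.coe_smul] at h
    have h1 := congrArg (fun x => (inner ℝ (cross u v) x : ℝ)) (Subtype.ext h :
      c default • cross u v = (0 : Im))
    simp only [inner_smul_right, inner_cross_cross, hu, hv, huv, inner_zero_right] at h1
    funext i
    rw [Unique.eq_default i]
    simpa using h1
  antisymm _ u v hu hv := by
    obtain ⟨u, rfl⟩ := exists_coe_eq hu
    obtain ⟨v, rfl⟩ := exists_coe_eq hv
    rw [tensor7_coe, tensor7_coe, cross_comm]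
    rfl
  skew _ x u v w hu hv hw := by
    -- As `u` is tangent at `x`, the factor `u x̄` is imaginary, and left multiplication by it is
    -- skew.
    have h1 : inner ℝ one (u ⋆ conj x) = (0 : ℝ) := by
      rw [real_inner_comm, inner_mul_right, conj_conj, one_mul, real_inner_comm, hu]
    have hv' : inner ℝ v (x : Oct) = (0 : ℝ) := by rw [real_inner_comm, hv]
    rw [tensor7_apply, tensor7_apply, inner_sub_left, inner_sub_right, inner_smul_left,
      inner_smul_right, hw, hv', triple, triple, inner_mul_of_inner h1]
    simp
  metric_unique h hs heq := by
    obtain ⟨u₀, hu₀, -⟩ := exists_unit_im (by norm_num) ![]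
    refine ⟨h u₀ u₀, form_eq_smul_inner one h hs ?_ hu₀ (inner_one_coe u₀)⟩
    intro u v hu hu' hv huv
    obtain ⟨u, rfl⟩ := exists_coe_eq hu'
    obtain ⟨v, rfl⟩ := exists_coe_eq hv
    obtain ⟨z, hz, hzf⟩ := exists_unit_im (by norm_num) ![u, v, cross u v]
    simp only [Fin.forall_fin_succ, Matrix.cons_val_zero, Matrix.cons_val_succ, IsEmpty.forall_iff,
      and_true] at hzf
    obtain ⟨hzu, hzv, hzp⟩ := hzf
    -- This flip fixes `u` and negates `v`, so `h u v = -h u v`.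
    obtain ⟨g, hg1, hg, hgf⟩ := exists_flip hu hz hzu
    have h1 : g u = u := congrArg Subtype.val hgf.left
    have h2 : g v = -(v : Oct) := congrArg Subtype.val (hgf.neg v huv (by rw [real_inner_comm, hzv]) (by
      rw [real_inner_comm, inner_cross_rotate, cross_comm, inner_neg_left, hzp, neg_zero]))
    have h3 := heq g hg hg1 u v (inner_one_coe u) (inner_one_coe v)
    rw [h1, h2, map_neg] at h3
    linarith

lemma lieAlg_triple {A : Oct →L[ℝ] Oct} (hA : A ∈ lieAlg spin7) (x y z : Oct) :
    A (triple x y z) = triple (A x) y z + triple x (A y) z + triple x y (A z) :=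
  lieAlg_trilin (m := mul) (k := mul.compl₂ conj)
    (fun _ hg x y z => (triple_spin7 hg x y z).symm) hA x y z

/-- The composition of two left multiplications. -/
def mulMul (a b : Oct) : Oct →L[ℝ] Oct := LinearMap.toContinuousLinearMap (mul a ∘ₗ mul b)

lemma mulMul_apply (a b x : Oct) : mulMul a b x = a ⋆ (b ⋆ x) := rfl

lemma mul_mul_of_unit {u : Im} (hu : inner ℝ u u = (1 : ℝ)) (x : Oct) :
    (u : Oct) ⋆ ((u : Oct) ⋆ x) = -x := by
  rw [mul_mul_self_of_inner (inner_one_coe u), ← Submodule.coe_inner, hu, neg_one_smul]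

lemma mul_mul_of_orthogonal {u v : Im} (huv : inner ℝ u v = (0 : ℝ)) (x : Oct) :
    (u : Oct) ⋆ ((v : Oct) ⋆ x) = -((v : Oct) ⋆ ((u : Oct) ⋆ x)) := by
  have := mul_mul_of_inner (inner_one_coe u) (inner_one_coe v) x
  rw [← Submodule.coe_inner, huv, mul_zero, neg_zero, zero_smul] at this
  exact eq_neg_of_add_eq_zero_left this

lemma mulMul_sq {a b : Im} (ha : inner ℝ a a = (1 : ℝ)) (hb : inner ℝ b b = (1 : ℝ))
    (hab : inner ℝ a b = (0 : ℝ)) : mulMul a b * mulMul a b = -1 := by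
  ext1 x
  change (a : Oct) ⋆ ((b : Oct) ⋆ ((a : Oct) ⋆ ((b : Oct) ⋆ x))) = -x
  rw [mul_mul_of_orthogonal hab, mul_mul_of_unit ha, map_neg, mul_mul_of_unit hb, neg_neg]

/-- The rotation `cos t + sin t a b`. -/
lemma exists_rotation {a b : Im} (ha : inner ℝ a a = (1 : ℝ)) (hb : inner ℝ b b = (1 : ℝ))
    (hab : inner ℝ a b = (0 : ℝ)) (t : ℝ) :
    ∃ g ∈ spin7, toOp g = Real.cos t • 1 + Real.sin t • mulMul a b := by
  have hba : inner ℝ b a = (0 : ℝ) := by rw [real_inner_comm, hab]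
  have h1 : inner ℝ (-a) (-a) = (1 : ℝ) := by rw [inner_neg_left, inner_neg_right, neg_neg, ha]
  have h2 : inner ℝ (Real.cos t • a - Real.sin t • b) (Real.cos t • a - Real.sin t • b)
      = (1 : ℝ) := by
    simp only [inner_sub_left, inner_sub_right, inner_smul_left, inner_smul_right, ha, hb, hab, hba,
      RCLike.conj_to_real]
    have := Real.cos_sq_add_sin_sq t
    linear_combination this
  -- Since `a a = -1`, the product `(-a)(cos t a - sin t b)` is `cos t + sin t a b`.
  refine ⟨_, leftMul_mul_leftMul_mem _ _ (norm_eq_one_of_inner h1) (norm_eq_one_of_inner h2), ?_⟩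
  ext1 x
  change ((-a : Im) : Oct) ⋆ (((Real.cos t • a - Real.sin t • b : Im) : Oct) ⋆ x)
    = Real.cos t • x + Real.sin t • ((a : Oct) ⋆ ((b : Oct) ⋆ x))
  simp only [Submodule.coe_neg, Submodule.coe_sub, Submodule.coe_smul, map_neg, map_sub, map_smul,
    LinearMap.neg_apply, LinearMap.sub_apply, LinearMap.smul_apply, mul_mul_of_unit ha]
  module

lemma mulMul_mem_lieAlg {a b : Im} (ha : inner ℝ a a = (1 : ℝ)) (hb : inner ℝ b b = (1 : ℝ))
    (hab : inner ℝ a b = (0 : ℝ)) : mulMul a b ∈ lieAlg spin7 :=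
  mem_lieAlg_of_sq (mulMul_sq ha hb hab) (exists_rotation ha hb hab)

lemma infinitesimal7 : Infinitesimal spin7 basePoint7 where
  surj := by
    refine unit_induction (P := fun v => ∃ A ∈ lieAlg spin7, A one = v)
      (fun r u hu => by rw [inner_smul_right, hu, mul_zero]) ⟨0, zero_mem _, rfl⟩ ?_ ?_
    · rintro r u ⟨A, hA, rfl⟩
      exact ⟨r • A, SMulMemClass.smul_mem r hA, rfl⟩
    · intro v hv h1
      obtain ⟨v, rfl⟩ := exists_coe_eq h1
      obtain ⟨b, hb, hbf⟩ := exists_unit_im (by norm_num) ![v]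
      have hvb : inner ℝ v b = (0 : ℝ) := hbf 0
      have hbv : inner ℝ b v = (0 : ℝ) := by rw [real_inner_comm, hvb]
      have ha : inner ℝ (cross b v) (cross b v) = (1 : ℝ) := by
        rw [inner_cross_cross, hb, hbv, Submodule.coe_inner, hv]; norm_num
      -- Applied to `1` this operator gives `(b × v) × b = v`.
      refine ⟨_, mulMul_mem_lieAlg ha hb (by rw [real_inner_comm, inner_cross_self]), ?_⟩
      rw [mulMul_apply, mul_one, mul_of_orthogonal (by rw [real_inner_comm, inner_cross_self]),
        cross_comm, cross_cross_self, hbv, hb]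
      simp
  not_flat := by
    obtain ⟨u, hu, -⟩ := exists_unit_im (by norm_num) ![]
    refine ⟨u, inner_one_coe u, fun A hA hAu => ?_⟩
    by_contra! hw
    -- Such an `A` would kill all imaginary vectors orthogonal to `u`. The derivation rule on the
    -- triple product of `v, 1, z`, with `z` outside the quaternions of `u, v`, would leave only `(v
    -- ū) z = 0`.
    have hA0 : ∀ w : Im, inner ℝ u w = (0 : ℝ) → A w = 0 := fun w huw => by
      rw [hw w (inner_one_coe w), ← Submodule.coe_inner, huw, neg_zero, zero_smul]
    obtain ⟨v, hv, hvf⟩ := exists_unit_im (by norm_num) ![u]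
    have huv : inner ℝ u v = (0 : ℝ) := hvf 0
    have hvu : inner ℝ v u = (0 : ℝ) := by rw [real_inner_comm, huv]
    obtain ⟨z, hz, hzf⟩ := exists_unit_im (by norm_num) ![u, v, cross u v]
    simp only [Fin.forall_fin_succ, Matrix.cons_val_zero, Matrix.cons_val_succ, IsEmpty.forall_iff,
      and_true] at hzf
    obtain ⟨hzu, hzv, hzp⟩ := hzf
    have h1 := lieAlg_triple hA v one z
    rw [triple_one, mul_of_orthogonal hzv, hA0 _ (by rw [inner_cross_rotate, hzp]), hA0 v huv,
      hA0 z hzu, show A one = u from hAu] at h1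
    simp only [triple, map_zero, LinearMap.zero_apply, zero_add, add_zero,
      conj_of_inner (inner_one_coe u), map_neg, LinearMap.neg_apply, mul_of_orthogonal hvu] at h1
    have hp : inner ℝ (cross v u) (cross v u) = (1 : ℝ) := by
      rw [inner_cross_cross, hv, hu, hvu]; norm_num
    have h2 := congrArg (mul (cross v u : Oct)) h1
    rw [map_zero, map_neg, mul_mul_of_unit hp, neg_neg] at h2
    have h3 : z = 0 := Subtype.ext h2.symm
    rw [h3, inner_zero_left] at hz
    exact zero_ne_one hz

end SevenSphere
end Oct
end InvConn
end

noncomputable section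
namespace InvConn

namespace Oct

local notation:70 x:70 " ⋆ " y:71 => mul x y

/-! ### The six-sphere. -/

section SixSphere

/-- The tangential component of the vector product on the six-sphere. -/
def tensorPerp : TangentTensor Im 6 where
  toFun x := crossPerp x
  smooth {f g} hf hg := by
    have h1 : ContMDiff (𝓡 6) 𝓘(ℝ, Im) ∞ (fun x : Sph Im => cross (f x) (g x)) :=
      contMDiff_bilin cross hf hg
    exact h1.sub ((contMDiff_inner contMDiff_coe_sphere h1).smul contMDiff_coe_sphere)
  tangent x u v := inner_crossPerp (inner_coe_self x) u v

/-- The tensor `(u, v) ↦ x × (u × v)` on the six-sphere. -/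
def tensorI : TangentTensor Im 6 where
  toFun x := crossI x
  smooth {f g} hf hg := by
    have h1 : ContMDiff (𝓡 6) 𝓘(ℝ, Im) ∞ (fun x : Sph Im => cross (f x) (g x)) :=
      contMDiff_bilin cross hf hg
    have h2 : ContMDiff (𝓡 6) 𝓘(ℝ, Im) ∞ (fun x : Sph Im => cross (x : Im) (cross (f x) (g x))) :=
      contMDiff_bilin cross contMDiff_coe_sphere h1
    exact h2
  tangent x u v := inner_crossI u v

/-- The invariant tensors on the six-sphere. -/
def tensor6 : Fin 2 → TangentTensor Im 6 := ![tensorPerp, tensorI]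

/-- A flip fixing `i + x` and negating `i - x` moves `i` to `x`. The vector `n` is taken along `i +
x`, or any unit vector orthogonal to `i - x` when `x = -i`. -/
lemma exists_flip_add {i x : Im} (hi : inner ℝ i i = (1 : ℝ)) (hx : inner ℝ x x = (1 : ℝ)) :
    ∃ g ∈ g2, g i = x := by
  have hpq : inner ℝ (i + x) (i - x) = (0 : ℝ) := by
    rw [inner_add_left, inner_sub_right, inner_sub_right, hi, hx, real_inner_comm i x]
    ring
  obtain ⟨n, hn, r, hr, hnq⟩ : ∃ n : Im, inner ℝ n n = (1 : ℝ) ∧ ∃ r : ℝ, i + x = r • n ∧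
      inner ℝ n (i - x) = (0 : ℝ) := by
    rcases eq_or_ne (i + x) 0 with h0 | h0
    · obtain ⟨n, hn, hnf⟩ := exists_unit_im (by norm_num) ![i - x]
      exact ⟨n, hn, 0, by rw [h0, zero_smul], by rw [real_inner_comm]; exact hnf 0⟩
    · have h1 : ‖i + x‖ ≠ 0 := norm_ne_zero_iff.2 h0
      refine ⟨‖i + x‖⁻¹ • (i + x), ?_, ‖i + x‖, ?_, ?_⟩
      · rw [inner_smul_left, inner_smul_right, real_inner_self_eq_norm_sq]
        simp only [RCLike.conj_to_real]
        field_simp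
      · rw [smul_smul, mul_inv_cancel₀ h1, one_smul]
      · rw [inner_smul_left, hpq, mul_zero]
  obtain ⟨m, hm, hmf⟩ := exists_unit_im (by norm_num) ![n, i - x, cross n (i - x)]
  simp only [Fin.forall_fin_succ, Matrix.cons_val_zero, Matrix.cons_val_succ, IsEmpty.forall_iff,
    and_true] at hmf
  obtain ⟨hnm, hqm, hpm⟩ := hmf
  obtain ⟨g, hg, hgf⟩ := exists_flip_g2 hn hm hnm
  have h1 : g (i + x) = i + x := by rw [hr, map_smul, hgf.left]
  have h2 : g (i - x) = -(i - x) := hgf.neg _ hnq (by rw [real_inner_comm, hqm]) (by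
    rw [real_inner_comm, inner_cross_rotate, cross_comm, inner_neg_left, hpm, neg_zero])
  refine ⟨g, hg, ?_⟩
  have h3 : i = (1 / 2 : ℝ) • ((i + x) + (i - x)) := by module
  rw [h3, map_smul, map_add, h1, h2]
  module

lemma inner_crossPerp_skew {x v w : Im} (u : Im) (hv : inner ℝ x v = (0 : ℝ))
    (hw : inner ℝ x w = (0 : ℝ)) :
    inner ℝ (crossPerp x u v) w = -(inner ℝ v (crossPerp x u w) : ℝ) := by
  rw [crossPerp_apply, crossPerp_apply, inner_sub_left, inner_sub_right, inner_smul_left,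
    inner_smul_right, hw, real_inner_comm x v, hv, inner_cross]
  ring

/-- Polarizing `inner_cross_cross` at `u + x` gives `⟨u × v, x × w⟩ + ⟨x × v, u × w⟩ = 0`, because
`x` is orthogonal to `u, v, w`. -/
lemma inner_crossI_skew {x u v w : Im} (hu : inner ℝ x u = (0 : ℝ)) (hv : inner ℝ x v = (0 : ℝ))
    (hw : inner ℝ x w = (0 : ℝ)) :
    inner ℝ (crossI x u v) w = -(inner ℝ v (crossI x u w) : ℝ) := by
  rw [crossI_apply, crossI_apply, inner_cross]
  have h4 := inner_cross x v (cross u w)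
  have h1 := inner_cross_cross (u + x) v w
  have h2 := inner_cross_cross u v w
  have h3 := inner_cross_cross x v w
  simp only [map_add, LinearMap.add_apply, inner_add_left, inner_add_right, real_inner_comm x u,
    hu, hv, hw] at h1 h2 h3
  linarith

lemma classified6 : Classified tensor6 g2 basePoint6 where
  transitive x := by
    obtain ⟨g, hg, h⟩ := exists_flip_add (inner_coe_self basePoint6) (inner_coe_self x)
    exact ⟨g, hg, Subtype.ext h⟩
  equivariant i g hg x u v := by
    fin_cases i
    · exact crossPerp_map hg x u v
    · exact crossI_map hg x u v
  classify B hB heq := by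
    have hf : ComplexFlipInvariant basePoint6 B := by
      refine ⟨inner_coe_self _, hB, fun m hm him => ?_⟩
      obtain ⟨g, hg, hgf⟩ := exists_flip_g2 (inner_coe_self basePoint6) hm him
      exact ⟨g, hg, hgf, heq g hg hgf.left⟩
    obtain ⟨a, b, hab⟩ := hf.exists_eq
    refine ⟨![a, b], fun u v hu hv => ?_⟩
    rw [Fin.sum_univ_two, hab u v hu hv]
    rfl
  independent c hc := by
    have h := crossPerp_crossI_independent (a := c 0) (b := c 1) (inner_coe_self basePoint6)
      (fun u v hu hv => by
        have := hc u v hu hv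
        rwa [Fin.sum_univ_two] at this)
    funext i
    fin_cases i
    · exact h.1
    · exact h.2
  antisymm i u v hu hv := by
    fin_cases i
    · change crossPerp _ u v = -crossPerp _ v u
      rw [crossPerp_apply, crossPerp_apply, cross_comm u v, inner_neg_right]
      module
    · change crossI _ u v = -crossI _ v u
      rw [crossI_apply, crossI_apply, cross_comm u v, map_neg]
  skew i x u v w hu hv hw := by
    fin_cases i
    · exact inner_crossPerp_skew u hv hw
    · exact inner_crossI_skew hu hv hw
  metric_unique h hs heq := by
    have hi := inner_coe_self basePoint6
    obtain ⟨u₀, hu₀, huf⟩ := exists_unit_im (by norm_num) ![(basePoint6 : Im)]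
    refine ⟨h u₀ u₀, form_eq_smul_inner _ h hs ?_ hu₀ (huf 0)⟩
    refine fun u v hu hiu hiv huv => form_eq_zero_of_flip hi h hs (fun m hm him => ?_) u v hu hiu hiv huv
    obtain ⟨g, hg, hgf⟩ := exists_flip_g2 hi hm him
    exact ⟨g, hgf, heq g hg hgf.left⟩

lemma lieAlg_cross {A : Im →L[ℝ] Im} (hA : A ∈ lieAlg g2) (x y : Im) :
    A (cross x y) = cross (A x) y + cross x (A y) :=
  lieAlg_bilin (fun _ hg => cross_g2 hg) hA x y

/-- Two pairs of orthonormal vectors, mutually orthogonal, with the same product. -/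
structure IsDoublePair (a b c d : Im) : Prop where
  aa : inner ℝ a a = (1 : ℝ)
  bb : inner ℝ b b = (1 : ℝ)
  cc : inner ℝ c c = (1 : ℝ)
  dd : inner ℝ d d = (1 : ℝ)
  ab : inner ℝ a b = (0 : ℝ)
  ac : inner ℝ a c = (0 : ℝ)
  ad : inner ℝ a d = (0 : ℝ)
  bc : inner ℝ b c = (0 : ℝ)
  bd : inner ℝ b d = (0 : ℝ)
  cd : inner ℝ c d = (0 : ℝ)
  mul_eq : (a : Oct) ⋆ (b : Oct) = (c : Oct) ⋆ (d : Oct)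

/-- Choose `c` orthogonal to `a, b, a × b` and solve `c × d = a × b` by `d = -c × (a × b)`. -/
lemma exists_isDoublePair {a b : Im} (ha : inner ℝ a a = (1 : ℝ)) (hb : inner ℝ b b = (1 : ℝ))
    (hab : inner ℝ a b = (0 : ℝ)) : ∃ c d, IsDoublePair a b c d := by
  have hba : inner ℝ b a = (0 : ℝ) := by rw [real_inner_comm, hab]
  obtain ⟨c, hc, hcf⟩ := exists_unit_im (by norm_num) ![a, b, cross a b]
  simp only [Fin.forall_fin_succ, Matrix.cons_val_zero, Matrix.cons_val_succ, IsEmpty.forall_iff,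
    and_true] at hcf
  obtain ⟨hac, hbc, hpc⟩ := hcf
  have hcp : inner ℝ c (cross a b) = (0 : ℝ) := by rw [real_inner_comm, hpc]
  have hcd : inner ℝ c (-cross c (cross a b)) = (0 : ℝ) := by
    rw [inner_neg_right, inner_cross_self, neg_zero]
  refine ⟨c, -cross c (cross a b), ha, hb, hc, ?_, hab, hac, ?_, hbc, ?_, hcd, ?_⟩
  · rw [inner_neg_left, inner_neg_right, inner_cross_cross, inner_cross_cross, ha, hb, hc, hab, hcp]
    norm_num
  · rw [inner_neg_right, inner_cross_rotate, inner_cross_cross, ha, hac, real_inner_comm b c, hbc]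
    norm_num
  · rw [inner_neg_right, inner_cross_rotate, cross_comm a b, inner_neg_right, inner_cross_cross,
      hba, hbc, real_inner_comm a c, hac]
    norm_num
  · rw [mul_of_orthogonal hab, mul_of_orthogonal hcd, map_neg, cross_cross_self, hcp, hc]
    simp

namespace IsDoublePair

variable {a b c d : Im}

lemma mulMul_comm (h : IsDoublePair a b c d) (x : Oct) :
    mulMul a b (mulMul c d x) = mulMul c d (mulMul a b x) := by
  simp only [mulMul_apply]
  rw [mul_mul_of_orthogonal h.bc, mul_mul_of_orthogonal h.bd, map_neg, map_neg, map_neg, neg_neg,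
    mul_mul_of_orthogonal h.ac, mul_mul_of_orthogonal h.ad, map_neg, neg_neg]

lemma mulMul_one (h : IsDoublePair a b c d) : mulMul a b one = mulMul c d one := by
  rw [mulMul_apply, mulMul_apply, mul_one, mul_one, h.mul_eq]

end IsDoublePair

lemma mulMul_mulMul {a b : Im} (ha : inner ℝ a a = (1 : ℝ)) (hb : inner ℝ b b = (1 : ℝ))
    (hab : inner ℝ a b = (0 : ℝ)) (x : Oct) : mulMul a b (mulMul a b x) = -x := by
  simp only [mulMul_apply]
  rw [mul_mul_of_orthogonal hab, mul_mul_of_unit ha, map_neg, mul_mul_of_unit hb, neg_neg]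

lemma inner_mulMul {a b : Im} (hab : inner ℝ a b = (0 : ℝ)) (x y : Oct) :
    inner ℝ (mulMul a b x) y = -(inner ℝ x (mulMul a b y) : ℝ) := by
  rw [mulMul_apply, mulMul_apply, inner_mul_of_inner (inner_one_coe a),
    inner_mul_of_inner (inner_one_coe b), mul_mul_of_orthogonal hab, inner_neg_right, neg_neg]

/-- The restriction to the imaginary octonions of an operator with imaginary values. -/
def restrictOp (A : Oct →L[ℝ] Oct) (hA : ∀ v : Im, inner ℝ one (A v) = (0 : ℝ)) : Im →L[ℝ] Im :=
  LinearMap.toContinuousLinearMap (((A : Oct →ₗ[ℝ] Oct) ∘ₗ Submodule.subtype _).codRestrict _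
    fun v => Submodule.mem_orthogonal_singleton_iff_inner_right.2 (hA v))

lemma mul_comm_of_orthogonal {u v : Im} (huv : inner ℝ u v = (0 : ℝ)) :
    (u : Oct) ⋆ (v : Oct) = -((v : Oct) ⋆ (u : Oct)) := by
  simpa only [mul_one] using mul_mul_of_orthogonal huv one

/-- The operators `J = mulMul a b` and `K = mulMul c d` commute, square to `-1` and agree on `1`.
Hence rotating by `t` with `J` and by `-t` with `K` fixes `1`, giving a curve in `G₂` with velocity
`J - K`. -/
lemma IsDoublePair.exists_lieAlg {a b c d : Im} (h : IsDoublePair a b c d) :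
    ∃ D ∈ lieAlg g2, ∀ v : Im, (D v : Oct) = mulMul a b v - mulMul c d v := by
  have hJ := mulMul_mulMul h.aa h.bb h.ab
  have hK := mulMul_mulMul h.cc h.dd h.cd
  have hD : ∀ v : Im, inner ℝ one ((mulMul a b - mulMul c d) v) = (0 : ℝ) := fun v => by
    have h1 := inner_mulMul h.ab one v
    have h2 := inner_mulMul h.cd one v
    rw [_root_.sub_apply, inner_sub_right]
    rw [h.mulMul_one] at h1
    linarith
  have hF : ∀ v : Im, inner ℝ one ((mulMul a b ∘L mulMul c d) v) = (0 : ℝ) := fun v => by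
    have h1 := inner_mulMul h.ab one (mulMul c d v)
    have h2 := inner_mulMul h.cd (mulMul c d one) v
    rw [h.mulMul_one, ] at h1
    rw [hK, inner_neg_left, inner_one_coe] at h2
    change inner ℝ one (mulMul a b (mulMul c d v)) = (0 : ℝ)
    linarith
  refine ⟨restrictOp _ hD, mem_lieAlg_of_mul_self (F := restrictOp _ hF) ?_ ?_ fun t => ?_,
    fun v => rfl⟩
  · ext1 v
    apply Subtype.ext
    change mulMul a b (mulMul a b v - mulMul c d v) - mulMul c d (mulMul a b v - mulMul c d v)
      = -((2 : ℝ) • (v : Oct)) - (2 : ℝ) • mulMul a b (mulMul c d v)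
    rw [map_sub, map_sub, hJ, hK, ← h.mulMul_comm]
    module
  · ext1 v
    apply Subtype.ext
    change mulMul a b (mulMul c d (mulMul a b v - mulMul c d v)) = mulMul a b v - mulMul c d v
    rw [map_sub, map_sub, ← h.mulMul_comm, hJ, hK, map_neg]
    module
  · obtain ⟨g, hg, hgt⟩ := exists_rotation h.aa h.bb h.ab t
    obtain ⟨k, hk, hkt⟩ := exists_rotation h.cc h.dd h.cd (-t)
    have hgt' : ∀ x, g x = Real.cos t • x + Real.sin t • mulMul a b x := fun x =>
      congrArg (fun A : Oct →L[ℝ] Oct => A x) hgt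
    have hkt' : ∀ x, k x = Real.cos t • x - Real.sin t • mulMul c d x := fun x => by
      have h1 : k x = Real.cos (-t) • x + Real.sin (-t) • mulMul c d x :=
        congrArg (fun A : Oct →L[ℝ] Oct => A x) hkt
      rw [h1, Real.cos_neg, Real.sin_neg]
      module
    have hgk : ∀ x, (g * k) x = (Real.cos t * Real.cos t) • x + (Real.cos t * Real.sin t) •
        (mulMul a b x - mulMul c d x) - (Real.sin t * Real.sin t) • mulMul a b (mulMul c d x) := by
      intro x
      change g (k x) = _
      rw [hgt', hkt', map_sub, map_smul, map_smul]
      module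
    have h1 : (g * k) one = one := by
      rw [hgk, h.mulMul_one, ← h.mulMul_one, hJ, h.mulMul_one, sub_self]
      have := Real.cos_sq_add_sin_sq t
      linear_combination (norm := module) this • one
    refine ⟨restrictIm (g * k) h1, restrictIm_mem_g2 (mul_mem hg hk) h1, ?_⟩
    ext1 v
    apply Subtype.ext
    exact hgk v

lemma infinitesimal6 : Infinitesimal g2 basePoint6 where
  surj := by
    refine unit_induction (P := fun v => ∃ A ∈ lieAlg g2, A (basePoint6 : Im) = v)
      (fun r u hu => by rw [inner_smul_right, hu, mul_zero]) ⟨0, zero_mem _, rfl⟩ ?_ ?_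
    · rintro r u ⟨A, hA, rfl⟩
      exact ⟨r • A, SMulMemClass.smul_mem r hA, rfl⟩
    · intro b hb hib
      have hi := inner_coe_self basePoint6
      obtain ⟨c, d, h⟩ := exists_isDoublePair hi hb hib
      obtain ⟨D, hD, hDv⟩ := h.exists_lieAlg
      -- With `a = i`, one has `a (b a) = b` and `c (d a) = a (c d) = a (a b) = -b`.
      have h1 : D (basePoint6 : Im) = (2 : ℝ) • b := by
        apply Subtype.ext
        rw [hDv, mulMul_apply, mulMul_apply, ← neg_eq_iff_eq_neg.2 (mul_comm_of_orthogonal h.ab),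
          ← neg_eq_iff_eq_neg.2 (mul_comm_of_orthogonal h.ad), map_neg, map_neg,
          ← neg_eq_iff_eq_neg.2 (mul_mul_of_orthogonal h.ac _), ← h.mul_eq, mul_mul_of_unit hi,
          Submodule.coe_smul]
        module
      exact ⟨(2⁻¹ : ℝ) • D, SMulMemClass.smul_mem _ hD, by
        rw [_root_.smul_apply, h1, smul_smul]; norm_num⟩
  not_flat := by
    obtain ⟨u, hu, huf⟩ := exists_unit_im (by norm_num) ![(basePoint6 : Im)]
    have hiu : inner ℝ (basePoint6 : Im) u = (0 : ℝ) := huf 0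
    have hi := inner_coe_self basePoint6
    refine ⟨u, hiu, fun A hA hAu => ?_⟩
    by_contra! hw
    obtain ⟨w, hww, hiw, hwf⟩ := exists_cOrth (by norm_num) ![u] (fun _ => by simpa using hiu)
    have huw : COrth basePoint6 u w := hwf 0
    -- In the derivation rule for `i × w`, flatness kills `A (i × w)` and `A w`, leaving `u × w = 0`
    -- for complex-orthogonal unit vectors.
    have h1 := lieAlg_cross hA basePoint6 w
    rw [hw _ (inner_cross_self _ _), hw w hiw, hAu, huw.re, (huw.cross_right hi).re, neg_zero,
      zero_smul, map_zero, add_zero] at h1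
    have h2 := inner_cross_cross u w w
    rw [← h1, inner_zero_left, hu, hww, huw.re] at h2
    norm_num at h2

lemma nonempty_complexStructure6 (R : ReductiveDecomposition g2 basePoint6) :
    Nonempty R.ComplexStructure :=
  ReductiveDecomposition.nonempty_complexStructure infinitesimal6 R (cross basePoint6)
    (fun u _ => inner_cross_self _ u) (fun _ hu => cross_cross_i (inner_coe_self _) hu)
    (fun g hg hgo u _ => by rw [cross_g2 hg, hgo])

end SixSphere
end Oct
end InvConn
end

open InvConn in
theorem mainTheorem4 :
    -- the sphere `S⁷ = Spin(7)/G₂`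
    (Module.finrank ℝ Oct.aff7.direction = 1 ∧
      Nonempty (ReductiveDecomposition Oct.spin7 Oct.basePoint7) ∧
      (∀ R : ReductiveDecomposition Oct.spin7 Oct.basePoint7,
        (∀ α : ℝ, ∃! D : Operator (𝓡 7) (Sph Oct),
          D ∈ Oct.aff7 ∧ R.HasNomizuMap D (R.nomizu α)) ∧
        (∀ D ∈ Oct.aff7, ∃! α : ℝ, R.HasNomizuMap D (R.nomizu α))) ∧
      (∃ g : RMetric (𝓡 7) (Sph Oct), ∀ φ ∈ sphereMaps Oct.spin7, IsInvariantMetric φ g) ∧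
      (∀ g : RMetric (𝓡 7) (Sph Oct), (∀ φ ∈ sphereMaps Oct.spin7, IsInvariantMetric φ g) →
        invariantMetricConnections (sphereMaps Oct.spin7) g = (Oct.aff7 : Set _))) ∧
    -- the sphere `S⁶ = G₂/SU(3)`
    (Module.finrank ℝ Oct.aff6.direction = 2 ∧
      Nonempty (ReductiveDecomposition Oct.g2 Oct.basePoint6) ∧
      (∀ R : ReductiveDecomposition Oct.g2 Oct.basePoint6,
        Nonempty R.ComplexStructure ∧
        ∀ S : R.ComplexStructure,
          (∀ α : ℂ, ∃! D : Operator (𝓡 6) (Sph Oct.Im),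
            D ∈ Oct.aff6 ∧ R.HasNomizuMap D (R.nomizuC S α)) ∧
          (∀ D ∈ Oct.aff6, ∃! α : ℂ, R.HasNomizuMap D (R.nomizuC S α))) ∧
      (∃ g : RMetric (𝓡 6) (Sph Oct.Im), ∀ φ ∈ sphereMaps Oct.g2, IsInvariantMetric φ g) ∧
      (∀ g : RMetric (𝓡 6) (Sph Oct.Im), (∀ φ ∈ sphereMaps Oct.g2, IsInvariantMetric φ g) →
        invariantMetricConnections (sphereMaps Oct.g2) g = (Oct.aff6 : Set _))) := by
  refine ⟨⟨?_, nonempty_reductiveDecomposition _ _,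
      fun R => R.existsUnique_nomizu Oct.classified7 Oct.infinitesimal7, ⟨roundMetric Oct 7, ?_⟩,
      fun g hg => Oct.classified7.invariantMetricConnections_eq hg⟩,
    ⟨?_, nonempty_reductiveDecomposition _ _,
      fun R => ⟨Oct.nonempty_complexStructure6 R, fun S =>
        R.existsUnique_nomizuC (Equiv.refl _) Oct.classified6 Oct.infinitesimal6 S⟩,
      ⟨roundMetric Oct.Im 6, ?_⟩, fun g hg => Oct.classified6.invariantMetricConnections_eq hg⟩⟩
  · exact Oct.classified7.finrank_direction
  · rintro φ ⟨g, -, rfl⟩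
    exact isInvariantMetric_roundMetric g
  · exact Oct.classified6.finrank_direction
  · rintro φ ⟨g, -, rfl⟩
    exact isInvariantMetric_roundMetric g
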